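/- Let $p\ge 0$ be an integer and let $z',w'$ be real with $z'>p-1$, $w'>-1$. \emph{The process.} A signature of order $N$ is an integer vector $\lambda=(\lambda_1\ge\dots\ge\lambda_N)$. For signatures $\lambda$ of order $N$ and $\mu$ of order $N+1$ write $\lambda\prec\mu$ if $\mu_1\ge\lambda_1\ge\mu_2\ge\dots\ge\lambda_N\ge\mu_{N+1}$, and let $\operatorname{Dim}(\lambda)$ be the number of chains $\emptyset\prec\lambda(1)\prec\dots\prec\lambda(N)=\lambda$. Let $M_N$ be the probability measure on signatures of order $N$ proportional to $$\operatorname{Dim}^2(\lambda)\prod_{i=1}^N\frac{1}{\Gamma(p-\lambda_i+i)\,\Gamma(N+1+\lambda_i-i)\,\Gamma(z'-\lambda_i+i)\,\Gamma(w'+N+1+\lambda_i-i)} .$$ Put $p^\downarrow(\lambda\mid\mu)=\operatorname{Dim}(\lambda)/\operatorname{Dim}(\mu)$ if $\lambda\prec\mu$ and $0$ otherwise, and $p^\uparrow(\mu\mid\lambda)=\frac{M_{N+1}(\mu)}{M_N(\lambda)}p^\downarrow(\lambda\mid\mu)$ for $M_N(\lambda)\ne0$. Let $T_N$ be the Markov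 chain with initial distribution $M_N$ and one-step transition probabilities $\lambda'\to\lambda$ given by $\sum_\mu p^\downarrow(\lambda\mid\mu)\,p^\uparrow(\mu\mid\lambda')$. For $\lambda$ with $M_N(\lambda)\neq0$, let $X(\lambda)=(x_1<\dots<x_p)$ be the $p$ elements of $\{0,\dots,N+p-1\}\setminus\{\lambda_i-i+N:1\le i\le N\}$, and set $$J^N_{p,z',w'}(t)=\tfrac{1}{N+p-1}\,X\bigl(T_N(\lfloor tN^2\rfloor)\bigr)\in\mathbb R^p,\qquad t\ge0 .$$ There is a process $J_{p,z',w'}(t)$, $t\ge 0$, with values in $[0,1]^p$, such that the finite-dimensional distributions of $J^N_{p,z',w'}$ converge weakly, as $N\to\infty$, to those of $J_{p,z',w'}$. \emph{The kernel.} Put $w(x)=x^{w'}(1-x)^{z'-p}$ for $0<x<1$. With $\alpha=z'-p$, $\beta=w'$, let $Jac^k(x)=\frac{(\alpha+1)_k}{k!}\,{}_2F_1(-k,k+\alpha+\beta+1;\alpha+1;1-x)$ be the Jacobi polynomials, and put $$j^k(x)=\frac{Jac^k(x)\sqrt{w(x)}}{\bigl(\int_0^1 Jac^k(y)^2w(y)\,dy\bigr)^{1/2}},\qquad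 K(i)=i\,(i+w'+z'+1-p).$$ For $x,y\in(0,1)$ and $t,s\ge0$ define $$\mathrm{Ker}(x,t;y,s)=\begin{cases}\displaystyle\sum_{i=0}^{p-1}e^{(t-s)K(i)}j^i(x)j^i(y),& t\ge s,\\[2mm] \displaystyle-\sum_{i=p}^{\infty}e^{(t-s)K(i)}j^i(x)j^i(y),& t<s;\end{cases}$$ the infinite series converges absolutely for $t<s$. \emph{Claim.} The space-time correlation functions of (every realization of) $J=J_{p,z',w'}=(J_1,\dots,J_p)$ are determinantal: for every $n$ and all $t_1,\dots,t_n\ge0$, not necessarily distinct, $$\rho_n(x_1,t_1;\dots;x_n,t_n)=\det\bigl[\mathrm{Ker}(x_i,t_i;x_j,t_j)\bigr]_{i,j=1}^n ,$$ that is, the right-hand side is measurable and almost everywhere non-negative on $(0,1)^n$, and for every measurable $f:\mathbb R^n\to[0,\infty]$ $$\mathbb E\sum_{k}f\bigl(J_{k_1}(t_1),\dots,J_{k_n}(t_n)\bigr)=\int_{(0,1)^n}f(x)\det\bigl[\mathrm{Ker}(x_i,t_i;x_j,t_j)\bigr]_{i,j=1}^n\,dx ,$$ where the sum is over all $k\in\{1,\dots,p\}^n$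 for which the pairs $(k_1,t_1),\dots,(k_n,t_n)$ are distinct. -/

import Mathlib

open MeasureTheory Filter Topology
open scoped NNReal ENNReal BoundedContinuousFunction

noncomputable section

/-! ## The Gelfand–Tsetlin graph -/

/-- Signatures of order `N`: integers `λ₁ ≥ λ₂ ≥ … ≥ λ_N`. The entry `λ_{i+1}` is `l.1 i`. -/
def Signature (N : ℕ) : Type := {l : Fin N → ℤ // Antitone l}

/-- The edge relation `l ≺ m`: `m₁ ≥ l₁ ≥ m₂ ≥ … ≥ l_N ≥ m_{N+1}`. -/
def Interlaces {N : ℕ} (l : Signature N) (m : Signature (N + 1)) : Prop :=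
  ∀ i : Fin N, m.1 i.succ ≤ l.1 i ∧ l.1 i ≤ m.1 i.castSucc

/-- Paths in the Gelfand–Tsetlin graph from the empty signature to a given signature. -/
inductive GTPath : {N : ℕ} → Signature N → Type
  | nil (e : Signature 0) : GTPath e
  | cons {N : ℕ} {l : Signature N} {m : Signature (N + 1)} (path : GTPath l)
      (h : Interlaces l m) : GTPath m

/-- `Dim l`, the number of paths from the empty signature to `l`. -/
def gtDim {N : ℕ} (l : Signature N) : ℕ := Nat.card (GTPath l)

open Classical in
/-- The cotransition probability `p↓(l | m)`. -/
def pDown {N : ℕ} (l : Signature N) (m : Signature (N + 1)) : ℝ :=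
  if Interlaces l m then (gtDim l : ℝ) / (gtDim m : ℝ) else 0

/-! ## The coherent system and the up-down chains -/

/-- The unnormalized weight
`Dim² l · ∏ᵢ 1 / (Γ(z - lᵢ + i) Γ(w + N + 1 + lᵢ - i) Γ(z' - lᵢ + i) Γ(w' + N + 1 + lᵢ - i))`,
`i = 1, …, N`. The function `1 / Γ` vanishes at the non-positive integers, and so does its Lean
version, because there `Real.Gamma` has the value `0` and `0⁻¹ = 0`. -/
def zwWeight (z w z' w' : ℝ) {N : ℕ} (l : Signature N) : ℝ :=
  (gtDim l : ℝ) ^ 2 * ∏ i : Fin N,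
    ((Real.Gamma (z - l.1 i + (i + 1)))⁻¹ * (Real.Gamma (w + N + 1 + l.1 i - (i + 1)))⁻¹ *
      (Real.Gamma (z' - l.1 i + (i + 1)))⁻¹ * (Real.Gamma (w' + N + 1 + l.1 i - (i + 1)))⁻¹)

/-- The probability `M_N(l)`, with the integral parameters `z = p`, `w = 0`. -/
def zwMeasure (p : ℕ) (z' w' : ℝ) {N : ℕ} (l : Signature N) : ℝ :=
  zwWeight p 0 z' w' l / ∑' m : Signature N, zwWeight p 0 z' w' m

/-- The transition probability `p↑(m | l)` of the up chain (used only where `M_N(l) ≠ 0`). -/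
def pUp (p : ℕ) (z' w' : ℝ) {N : ℕ} (m : Signature (N + 1)) (l : Signature N) : ℝ :=
  zwMeasure p z' w' m / zwMeasure p z' w' l * pDown l m

/-- The one-step transition probability `p^st_N(l | l')` of the up-down chain at level `N`. -/
def pUpDown (p : ℕ) (z' w' : ℝ) {N : ℕ} (l l' : Signature N) : ℝ :=
  ∑' m : Signature (N + 1), pDown l m * pUp p z' w' m l'

/-- The probability that the stationary up-down chain `T_N` (initial distribution `M_N`,
transitions `p^st_N`) satisfies `T_N(k) = τ k` for `k = 0, …, m`. -/
def pathProb (p : ℕ) (z' w' : ℝ) {N m : ℕ} (τ : Fin (m + 1) → Signature N) : ℝ :=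
  zwMeasure p z' w' (τ 0) * ∏ k : Fin m, pUpDown p z' w' (τ k.succ) (τ k.castSucc)

/-- The `k`-th smallest element (`k = 0, …, p - 1`) of the `p`-point configuration
`X(l) = {0, …, N + p - 1} \ {l₁ - 1 + N, …, l_N - N + N}`. -/
def particle (p : ℕ) {N : ℕ} (l : Signature N) (k : Fin p) : ℕ :=
  Nat.nth (fun x => x < N + p ∧ ∀ i : Fin N, (x : ℤ) ≠ l.1 i - ((i : ℤ) + 1) + N) k

/-- The rescaled configuration `π_N(X(l))`, points divided by `N + p - 1`. -/
def scaledParticle (p : ℕ) {N : ℕ} (l : Signature N) (k : Fin p) : ℝ :=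
  (particle p l k : ℝ) / ((N : ℝ) + p - 1)

/-- The number of steps `⌊t N²⌋` made by the chain up to time `t`. -/
def stepCount (N : ℕ) (t : ℝ≥0) : ℕ := ⌊(t : ℝ) * (N : ℝ) ^ 2⌋₊

/-- The largest of the step counts for the times `t₁, …, t_n`. -/
def maxStep (N : ℕ) {n : ℕ} (t : Fin n → ℝ≥0) : ℕ :=
  Finset.univ.sup fun i => stepCount N (t i)

theorem stepCount_lt (N : ℕ) {n : ℕ} (t : Fin n → ℝ≥0) (i : Fin n) :
    stepCount N (t i) < maxStep N t + 1 :=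
  Nat.lt_succ_of_le (Finset.le_sup (f := fun i => stepCount N (t i)) (Finset.mem_univ i))

/-- The joint law of `(J^N(t₁), …, J^N(t_n))`, where `J^N(t) = π_N(X(T_N(⌊t N²⌋)))`: the sum over
all trajectories of the chain up to the last time that is needed. -/
def prelimitLaw (p : ℕ) (z' w' : ℝ) (N : ℕ) {n : ℕ} (t : Fin n → ℝ≥0) :
    Measure (Fin n → Fin p → ℝ) :=
  Measure.sum fun τ : Fin (maxStep N t + 1) → Signature N =>
    ENNReal.ofReal (pathProb p z' w' τ) •
      Measure.dirac fun i => scaledParticle p (τ ⟨stepCount N (t i), stepCount_lt N t i⟩)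

/-- `J` is a realization, on the probability space `(Ω, P)`, of the limit process on `[0,1]^p`:
the finite-dimensional distributions of `J^N` converge weakly to those of `J`. -/
structure IsLimitProcess (p : ℕ) (z' w' : ℝ) {Ω : Type*} [MeasurableSpace Ω] (P : Measure Ω)
    (J : ℝ≥0 → Ω → Fin p → ℝ) : Prop where
  measurable : ∀ t, Measurable (J t)
  mem_Icc : ∀ t ω k, J t ω k ∈ Set.Icc (0 : ℝ) 1
  tendsto : ∀ (n : ℕ) (t : Fin n → ℝ≥0) (f : (Fin n → Fin p → ℝ) →ᵇ ℝ),
    Tendsto (fun N : ℕ => ∫ y, f y ∂(prelimitLaw p z' w' N t)) atTop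
      (𝓝 (∫ ω, f (fun i => J (t i) ω) ∂P))

/-! ## Correlation functions -/

/-- `ρ` is (a version of) the space-time correlation function
`(x₁, …, x_n) ↦ ρ_n(x₁, t₁; …; x_n, t_n)` on `(0,1)^n` of the process `J` of `p`-point
configurations: `ρ` is the density of the expected number of `n`-tuples of distinct space-time
points, the `i`-th of them being a point of the configuration at time `t i`. -/
structure IsCorrelationFunction {p : ℕ} {Ω : Type*} [MeasurableSpace Ω] (P : Measure Ω)
    (J : ℝ≥0 → Ω → Fin p → ℝ) {n : ℕ} (t : Fin n → ℝ≥0) (ρ : (Fin n → ℝ) → ℝ) : Prop where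
  aemeasurable :
    AEMeasurable ρ (volume.restrict (Set.univ.pi fun _ : Fin n => Set.Ioo (0 : ℝ) 1))
  nonneg :
    ∀ᵐ x ∂(volume.restrict (Set.univ.pi fun _ : Fin n => Set.Ioo (0 : ℝ) 1)), 0 ≤ ρ x
  lintegral_eq : ∀ f : (Fin n → ℝ) → ℝ≥0∞, Measurable f →
    ∫⁻ ω, (∑ k : {k : Fin n → Fin p // Function.Injective fun i => (k i, t i)},
        f (fun i => J (t i) ω (k.1 i))) ∂P =
      ∫⁻ x in Set.univ.pi fun _ : Fin n => Set.Ioo (0 : ℝ) 1, f x * ENNReal.ofReal (ρ x)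

/-! ## Jacobi polynomials and the extended kernel -/

/-- The Jacobi polynomial of degree `n` on `(0,1)`,
`(α+1)_n / n! · ₂F₁(-n, n+α+β+1; α+1; 1-x)`. -/
def jacobiPoly (n : ℕ) (α β x : ℝ) : ℝ :=
  (ascPochhammer ℝ n).eval (α + 1) / (n.factorial : ℝ) *
    ordinaryHypergeometric (-(n : ℝ)) ((n : ℝ) + α + β + 1) (α + 1) (1 - x)

/-- The weight `x^{w'} (1-x)^{z'-p}` on `(0,1)`. -/
def jacobiWeight (p : ℕ) (z' w' x : ℝ) : ℝ := x ^ w' * (1 - x) ^ (z' - p)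

/-- The orthonormal functions `j^k` in `L₂([0,1])`. -/
def jacobiFun (p : ℕ) (z' w' : ℝ) (k : ℕ) (x : ℝ) : ℝ :=
  jacobiPoly k (z' - p) w' x * √(jacobiWeight p z' w' x) /
    √(∫ y in Set.Ioo (0 : ℝ) 1, jacobiPoly k (z' - p) w' y ^ 2 * jacobiWeight p z' w' y)

/-- `K(i) = i (i + w' + z' + 1 - p)`. -/
def jacobiEigenvalue (p : ℕ) (z' w' : ℝ) (i : ℕ) : ℝ := i * (i + w' + z' + 1 - p)

/-- The extended kernel `Ker(x, t; y, s)`. -/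
def extendedKernel (p : ℕ) (z' w' x t y s : ℝ) : ℝ :=
  if s ≤ t then
    ∑ i ∈ Finset.range p, Real.exp ((t - s) * jacobiEigenvalue p z' w' i) *
      jacobiFun p z' w' i x * jacobiFun p z' w' i y
  else
    -∑' i : ℕ, Real.exp ((t - s) * jacobiEigenvalue p z' w' (p + i)) *
      jacobiFun p z' w' (p + i) x * jacobiFun p z' w' (p + i) y

end

/-!
Signatures `λ` with `M_N(λ) ≠ 0` are partitions in the `N × p` box, and the `p` holes of the point
configuration `λ_i - i + N` in `{0, …, N + p - 1}` determine them. In the holes, interlacing means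
that every hole stays or moves one step to the left (`interlaces_confSig_iff`), the dimension is a
Vandermonde determinant times a product of one-particle factors (`gtDim_confSig`), and `M_N` is the
`p`-point Hahn ensemble (`zwMeasure_confSig`). Therefore the up-down chain is the `h`-transform, by
the Vandermonde determinant, of `p` independent copies of a one-particle chain on
`{0, …, N + p - 1}` (`sum_chainQ_slater`). With the Cauchy–Binet formula, the expectation of a
product `∏ᵢ ∏ₖ gᵢ(x_k(tᵢ))` over the times and the particles becomes a `p × p` determinant of
one-particle quantities (`sum_pathWt_chain`).

On the time scale `N²`, the generator of the one-particle chain converges on polynomials to the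
Jacobi operator (`gridTendsto_generator`). The Jacobi polynomials are thus approximate
eigenfunctions, the chain is a contraction for the supremum norm, and so its iterates converge to
the semigroup `exp(-t K(k))` in the Jacobi basis, uniformly on the grids (`GridTendsto.iterate`);
stationarity yields the convergence of the Hahn weight to the Jacobi weight. Hence all
multiplicative statistics with polynomial factors converge (`tendsto_integral_prelimitLaw_prod`).

For the existence of the limit process, the chains are viewed as states on the continuous functions
on the compact space of all trajectories in the closed Weyl chamber of `[0,1]^p`. The multiplicative
statistics separate trajectories, so the states converge on all continuous functions by the
Stone–Weierstrass theorem, and the Riesz–Markov–Kakutani theorem produces a law under which the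
coordinates are a limit process (`exists_isLimitProcess`).

For the correlation functions, the factor at the time `τ` is chosen as `1 + ∑_{tᵢ = τ} sᵢ fᵢ`. In
the Jacobi basis the limiting `p × p` determinant is a minor of a time-ordered product of matrices
`1 + ∑ sᵢ Bᵢ`, and a manipulation of determinants rewrites it as a Fredholm determinant
(`det_orderedProd`). There the projection onto the first `p` levels is corrected by `-1` for pairs of
times in increasing order, which is the difference between the two cases of the extended kernel.
The coefficient of `s₁ ⋯ sₙ` is the correlation sum on the side of the process, and a sum of minors
on the side of the Fredholm determinant (`sum_graphFinset_eq`,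
`IsLimitProcess.integral_sum_prod_eval`); the latter is the integral of `∏ᵢ fᵢ(xᵢ)` against the
determinant of the extended kernel truncated at a level `D`, where `D` is any sufficiently large
number (`sum_det_fredholmMat`).

The normalized Jacobi polynomials grow at most exponentially with the degree
(`exists_jacN_sq_le`), whereas the coefficients of the kernel for `t < s` decay like a Gaussian. So
the kernel converges and the truncation is removed by dominated convergence. This proves the
correlation identity for monomials. Measures on a cube are determined by their moments, which gives
both the non-negativity of the determinant and the identity for all measurable test functions
(`nonneg_and_eq_withDensity_of_moments`).
-/


noncomputable section

/-! ### Signatures in a box and their hole configurations -/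

/-- Strictly increasing `p`-tuples of elements of `{0, …, n - 1}`. -/
abbrev Conf (p n : ℕ) : Type := {x : Fin p → Fin n // StrictMono x}

instance (p n : ℕ) : Fintype (Conf p n) := Fintype.ofFinite _

/-- The signature `l` is a partition inside the `N × p` box. -/
def InBox (p : ℕ) {N : ℕ} (l : Signature N) : Prop := ∀ i, 0 ≤ l.1 i ∧ l.1 i ≤ p

/-- The signature in the box whose hole configuration is `x`. -/
def confSig {p N : ℕ} (x : Conf p (N + p)) : Signature N :=
  ⟨fun i => ((Finset.univ.filter fun k : Fin p => (x.1 k : ℕ) + i < N + k).card : ℤ), by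
    intro i j hij
    have : (i : ℕ) ≤ j := hij
    simp only [Nat.cast_le]
    apply Finset.card_le_card
    intro k hk
    simp only [Finset.mem_filter, Finset.mem_univ, true_and] at hk ⊢
    omega⟩

/-- The entries of a strictly increasing tuple grow at least as fast as their indices. -/
theorem Conf.add_le {p n : ℕ} (x : Conf p n) {j k : Fin p} (h : j ≤ k) :
    (x.1 j : ℕ) + (k - j : ℕ) ≤ x.1 k := by
  obtain ⟨j, hj⟩ := j
  obtain ⟨k, hk⟩ := k
  simp only [Fin.mk_le_mk] at h
  obtain ⟨d, rfl⟩ := Nat.exists_eq_add_of_le h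
  clear h
  induction d with
  | zero => simp
  | succ d ih =>
    have h1 := ih (by omega)
    have h2 : x.1 ⟨j + d, by omega⟩ < x.1 ⟨j + (d + 1), hk⟩ := x.2 (by simp)
    simp only at h1 ⊢
    omega

theorem Conf.le_apply {p n : ℕ} (x : Conf p n) (k : Fin p) : (k : ℕ) ≤ x.1 k := by
  have h : (⟨0, by have := k.2; omega⟩ : Fin p) ≤ k := by simp [Fin.le_def]
  have := x.add_le h
  simp only at this
  omega

theorem Conf.apply_le {p N : ℕ} (x : Conf p (N + p)) (k : Fin p) : (x.1 k : ℕ) ≤ N + k := by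
  have hk := k.2
  have h : k ≤ (⟨p - 1, by omega⟩ : Fin p) := by simp only [Fin.le_def]; omega
  have := x.add_le h
  simp only at this
  omega

/-- The description of the signature by its holes. -/
theorem confSig_le_iff {p N : ℕ} (x : Conf p (N + p)) (i : Fin N) (k : Fin p) :
    (confSig x).1 i ≤ (k : ℤ) ↔ N + (k : ℕ) ≤ (x.1 k : ℕ) + i := by
  have key : ∀ j k : Fin p, j ≤ k → (x.1 k : ℕ) + i < N + k → (x.1 j : ℕ) + i < N + j := by
    intro j k hjk h
    have := x.add_le hjk
    omega
  simp only [confSig, Nat.cast_le]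
  constructor
  · intro h
    by_contra hc
    push Not at hc
    have : (Finset.Iic k).card ≤
        (Finset.univ.filter fun k : Fin p => (x.1 k : ℕ) + i < N + k).card := by
      apply Finset.card_le_card
      intro j hj
      simp only [Finset.mem_filter, Finset.mem_univ, true_and, Finset.mem_Iic] at hj ⊢
      exact key j k hj hc
    rw [Fin.card_Iic] at this
    omega
  · intro h
    have : (Finset.univ.filter fun k : Fin p => (x.1 k : ℕ) + i < N + k).card ≤
        (Finset.Iio k).card := by
      apply Finset.card_le_card
      intro j hj
      simp only [Finset.mem_filter, Finset.mem_univ, true_and, Finset.mem_Iio] at hj ⊢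
      by_contra hc
      push Not at hc
      have := key k j hc hj
      omega
    rwa [Fin.card_Iio] at this

theorem inBox_confSig {p N : ℕ} (x : Conf p (N + p)) : InBox p (confSig x) := by
  intro i
  simp only [confSig, Nat.cast_nonneg, Nat.cast_le, true_and]
  exact (Finset.card_le_univ _).trans (by simp)

/-- A signature in the box is determined by its level sets. -/
theorem inBox_ext {p N : ℕ} {l m : Signature N} (hl : InBox p l) (hm : InBox p m)
    (h : ∀ (i : Fin N) (k : Fin p), l.1 i ≤ (k : ℤ) ↔ m.1 i ≤ (k : ℤ)) : l = m := by
  apply Subtype.ext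
  funext i
  have h1 := hl i
  have h2 := hm i
  by_contra hne
  rcases lt_or_gt_of_ne hne with hlt | hlt
  · have := (h i ⟨(l.1 i).toNat, by omega⟩).1 (by simp only; omega)
    simp only at this
    omega
  · have := (h i ⟨(m.1 i).toNat, by omega⟩).2 (by simp only; omega)
    simp only at this
    omega

theorem confSig_injective {p N : ℕ} :
    Function.Injective (confSig : Conf p (N + p) → Signature N) := by
  intro x y h
  apply Subtype.ext
  funext k
  apply Fin.ext
  have hx := x.apply_le k
  have hy := y.apply_le k
  have hx' := x.le_apply k
  have hy' := y.le_apply k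
  by_contra hne
  rcases lt_or_gt_of_ne hne with hlt | hlt
  · have h1 := confSig_le_iff x ⟨N + k - y.1 k, by omega⟩ k
    have h2 := confSig_le_iff y ⟨N + k - y.1 k, by omega⟩ k
    rw [h] at h1
    rw [h1] at h2
    simp only at h2
    omega
  · have h1 := confSig_le_iff x ⟨N + k - x.1 k, by omega⟩ k
    have h2 := confSig_le_iff y ⟨N + k - x.1 k, by omega⟩ k
    rw [h] at h1
    rw [h1] at h2
    simp only at h2
    omega

theorem exists_confSig {p N : ℕ} {l : Signature N} (hl : InBox p l) :
    ∃ x : Conf p (N + p), confSig x = l := by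
  -- the hole number `k` is `k` plus the number of parts of size at most `k`
  let c : ℕ → ℕ := fun k => (Finset.univ.filter fun i : Fin N => l.1 i ≤ (k : ℤ)).card
  have hcN : ∀ k, c k ≤ N := fun k => (Finset.card_le_univ _).trans (by simp)
  have hmono : Monotone c := by
    intro j k hjk
    apply Finset.card_le_card
    intro i hi
    simp only [Finset.mem_filter, Finset.mem_univ, true_and] at hi ⊢
    omega
  have hle : ∀ (i : Fin N) (k : ℕ), l.1 i ≤ (k : ℤ) ↔ N ≤ c k + i := by
    intro i k
    constructor
    · intro h
      have : (Finset.Ici i).card ≤ c k := by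
        apply Finset.card_le_card
        intro j hj
        simp only [Finset.mem_filter, Finset.mem_univ, true_and, Finset.mem_Ici] at hj ⊢
        exact (l.2 hj).trans h
      rw [Fin.card_Ici] at this
      omega
    · intro h
      by_contra hc
      have : c k ≤ (Finset.Ioi i).card := by
        apply Finset.card_le_card
        intro j hj
        simp only [Finset.mem_filter, Finset.mem_univ, true_and, Finset.mem_Ioi] at hj ⊢
        by_contra hji
        push Not at hji
        exact hc ((l.2 hji).trans hj)
      rw [Fin.card_Ioi] at this
      omega
  let x : Conf p (N + p) := ⟨fun k => ⟨k + c k, by have := hcN k; have := k.2; omega⟩, by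
    intro j k hjk
    have h1 : (j : ℕ) < k := hjk
    have := hmono h1.le
    simp only [Fin.mk_lt_mk]
    omega⟩
  refine ⟨x, inBox_ext (inBox_confSig x) hl fun i k => ?_⟩
  rw [confSig_le_iff, hle]
  simp only [x]
  omega

/-- Interlacing of signatures means that every hole stays or moves one step to the left. -/
theorem interlaces_confSig_iff {p N : ℕ} (x : Conf p (N + p)) (y : Conf p (N + 1 + p)) :
    Interlaces (confSig x) (confSig y) ↔
      ∀ k, (x.1 k : ℕ) = y.1 k ∨ (x.1 k : ℕ) + 1 = y.1 k := by
  constructor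
  · intro h k
    have hx := x.apply_le k
    have hy := y.apply_le k
    have hx' := x.le_apply k
    have hy' := y.le_apply k
    have h1 : (x.1 k : ℕ) ≤ y.1 k := by
      by_contra hc
      have hl := (confSig_le_iff x ⟨N + k - x.1 k, by omega⟩ k).2 (by simp only; omega)
      have := (confSig_le_iff y _ k).1 (((h ⟨N + k - x.1 k, by omega⟩).1).trans hl)
      simp only [Fin.val_succ] at this
      omega
    have h2 : (y.1 k : ℕ) ≤ x.1 k + 1 := by
      by_contra hc
      have hl := (confSig_le_iff y (Fin.castSucc ⟨N + 1 + k - y.1 k, by omega⟩) k).2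
        (by simp only [Fin.val_castSucc]; omega)
      have := (confSig_le_iff x _ k).1 (((h ⟨N + 1 + k - y.1 k, by omega⟩).2).trans hl)
      simp only at this
      omega
    omega
  · intro h i
    have hxb := inBox_confSig x i
    constructor
    · by_cases hp : (confSig x).1 i < p
      · have h1 := (confSig_le_iff x i ⟨((confSig x).1 i).toNat, by omega⟩).1 (by simp only; omega)
        have h2 := (confSig_le_iff y i.succ ⟨((confSig x).1 i).toNat, by omega⟩).2 (by
          have := h ⟨((confSig x).1 i).toNat, by omega⟩
          simp only [Fin.val_succ] at *
          omega)
        simp only at h2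
        omega
      · exact ((inBox_confSig y i.succ).2).trans (by omega)
    · have hyb := inBox_confSig y i.castSucc
      by_cases hp : (confSig y).1 i.castSucc < p
      · have h1 := (confSig_le_iff y i.castSucc ⟨((confSig y).1 i.castSucc).toNat, by omega⟩).1
          (by simp only; omega)
        have h2 := (confSig_le_iff x i ⟨((confSig y).1 i.castSucc).toNat, by omega⟩).2 (by
          have := h ⟨((confSig y).1 i.castSucc).toNat, by omega⟩
          simp only [Fin.val_castSucc] at *
          omega)
        simp only at h2
        omega
      · exact (hxb.2).trans (by omega)

theorem InBox.of_interlaces {p N : ℕ} {l : Signature N} {m : Signature (N + 1)} (hm : InBox p m)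
    (h : Interlaces l m) : InBox p l := fun i =>
  ⟨(hm i.succ).1.trans (h i).1, (h i).2.trans (hm i.castSucc).2⟩

/-- The holes `x_k` and the points `l_i - i + N` of the signature fill `{0, …, N + p - 1}`. -/
def confSumEquiv {p N : ℕ} (x : Conf p (N + p)) : Fin p ⊕ Fin N ≃ Fin (N + p) :=
  Equiv.ofBijective
    (Sum.elim x.1 fun i => ⟨((confSig x).1 i - ((i : ℤ) + 1) + N).toNat, by
      have := inBox_confSig x i
      have := i.2
      omega⟩) (by
    rw [Fintype.bijective_iff_injective_and_card]
    refine ⟨?_, by simp [add_comm]⟩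
    have hs := (confSig x).2
    refine Function.Injective.sumElim x.2.injective ?_ ?_
    · intro i j hij
      simp only [Fin.mk.injEq] at hij
      have h1 := inBox_confSig x i
      have h2 := inBox_confSig x j
      rcases le_total i j with hle | hle
      · have := hs hle
        have h3 : (i : ℕ) ≤ j := hle
        apply Fin.ext
        omega
      · have := hs hle
        have h3 : (j : ℕ) ≤ i := hle
        apply Fin.ext
        omega
    · intro k i h
      have h' := congrArg Fin.val h
      simp only at h'
      have h1 := inBox_confSig x i
      have h2 := confSig_le_iff x i k
      have := i.2
      by_cases hc : (confSig x).1 i ≤ k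
      · have := h2.1 hc
        omega
      · have := h2.not.1 hc
        omega)

theorem confSumEquiv_inl {p N : ℕ} (x : Conf p (N + p)) (k : Fin p) :
    confSumEquiv x (Sum.inl k) = x.1 k := rfl

theorem confSumEquiv_inr {p N : ℕ} (x : Conf p (N + p)) (i : Fin N) :
    ((confSumEquiv x (Sum.inr i) : ℕ) : ℤ) = (confSig x).1 i - ((i : ℤ) + 1) + N := by
  have h1 := inBox_confSig x i
  have h2 := i.2
  have : (confSumEquiv x (Sum.inr i) : ℕ) = ((confSig x).1 i - ((i : ℤ) + 1) + N).toNat := rfl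
  omega

theorem particle_confSig {p N : ℕ} (x : Conf p (N + p)) (k : Fin p) :
    particle p (confSig x) k = x.1 k := by
  have hpred : ∀ v : ℕ, (v < N + p ∧ ∀ i : Fin N, (v : ℤ) ≠ (confSig x).1 i - ((i : ℤ) + 1) + N) ↔
      ∃ j, (x.1 j : ℕ) = v := by
    intro v
    constructor
    · rintro ⟨h1, h2⟩
      obtain ⟨s, hs⟩ := (confSumEquiv x).surjective ⟨v, h1⟩
      rcases s with j | i
      · exact ⟨j, by rw [← confSumEquiv_inl, hs]⟩
      · have := confSumEquiv_inr x i
        rw [hs] at this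
        exact absurd this (h2 i)
    · rintro ⟨j, rfl⟩
      refine ⟨(x.1 j).2, fun i h => ?_⟩
      rw [← confSumEquiv_inr, ← confSumEquiv_inl] at h
      have := (confSumEquiv x).injective (Fin.ext (by exact_mod_cast h))
      simp at this
  unfold particle
  simp only [hpred]
  classical
  have hcount : Nat.count (fun v => ∃ j, (x.1 j : ℕ) = v) (x.1 k) = k := by
    rw [Nat.count_eq_card_filter_range]
    have : (Finset.range (x.1 k : ℕ)).filter (fun v => ∃ j, (x.1 j : ℕ) = v) =
        (Finset.Iio k).image fun j => (x.1 j : ℕ) := by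
      ext v
      simp only [Finset.mem_filter, Finset.mem_range, Finset.mem_image, Finset.mem_Iio]
      constructor
      · rintro ⟨h1, j, rfl⟩
        exact ⟨j, x.2.lt_iff_lt.1 h1, rfl⟩
      · rintro ⟨j, hj, rfl⟩
        exact ⟨x.2 hj, j, rfl⟩
    rw [this, Finset.card_image_of_injective, Fin.card_Iio]
    intro a b hab
    exact x.2.injective (Fin.ext hab)
  conv_lhs => rw [← hcount]
  exact Nat.nth_count (p := fun v => ∃ j, (x.1 j : ℕ) = v) ⟨k, rfl⟩

/-- A sum over all signatures of a function supported in the box is a finite sum. -/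
theorem tsum_eq_sum_conf {p N : ℕ} (f : Signature N → ℝ) (hf : ∀ l, f l ≠ 0 → InBox p l) :
    ∑' l, f l = ∑ x : Conf p (N + p), f (confSig x) := by
  rw [← tsum_fintype (L := .unconditional _)]
  refine (Function.Injective.tsum_eq confSig_injective ?_).symm
  intro l hl
  exact exists_confSig (hf l hl)

end

noncomputable section

/-! ### Vandermonde determinants and independent steps of the holes -/

/-- The Vandermonde determinant of a tuple of natural numbers. -/
def vdm {p : ℕ} (x : Fin p → ℕ) : ℝ := (Matrix.vandermonde fun k => (x k : ℝ)).det

/-- The Slater determinant `det [h_a(x_k)]`. -/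
def slater {p : ℕ} (h : Fin p → ℕ → ℝ) (x : Fin p → ℕ) : ℝ :=
  (Matrix.of fun k a : Fin p => h a (x k)).det

theorem vdm_pos {p : ℕ} {x : Fin p → ℕ} (hx : StrictMono x) : 0 < vdm x := by
  rw [vdm, Matrix.det_vandermonde]
  refine Finset.prod_pos fun i _ => Finset.prod_pos fun j hj => ?_
  have := hx (Finset.mem_Ioi.1 hj)
  rw [sub_pos]
  exact_mod_cast this

theorem vdm_eq_slater {p : ℕ} (x : Fin p → ℕ) :
    vdm x = slater (fun (a : Fin p) v => (v : ℝ) ^ (a : ℕ)) x := rfl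

theorem slater_eq_zero {p : ℕ} (h : Fin p → ℕ → ℝ) {x : Fin p → ℕ}
    (hx : ¬ Function.Injective x) : slater h x = 0 := by
  simp only [Function.Injective, not_forall] at hx
  obtain ⟨i, j, hij, hne⟩ := hx
  refine Matrix.det_zero_of_row_eq hne ?_
  funext a
  simp [hij]

/-- A family of polynomials with `deg P_a ≤ a` gives a multiple of the Vandermonde determinant. -/
theorem det_eval_eq_vandermonde {p : ℕ} (v : Fin p → ℝ) (P : Fin p → Polynomial ℝ)
    (hP : ∀ a, (P a).natDegree ≤ a) :
    (Matrix.of fun k a => (P a).eval (v k)).det =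
      (∏ a : Fin p, (P a).coeff a) * (Matrix.vandermonde v).det := by
  rw [Matrix.eval_matrixOfPolynomials_eq_vandermonde_mul_matrixOfPolynomials v P hP,
    Matrix.det_mul, mul_comm]
  congr 1
  rw [Matrix.det_of_isUpperTriangular]
  · rfl
  · intro i j hij
    exact Polynomial.coeff_eq_zero_of_natDegree_lt ((hP j).trans_lt hij)

theorem slater_mul {p : ℕ} (g : ℕ → ℝ) (h : Fin p → ℕ → ℝ) (x : Fin p → ℕ) :
    slater (fun a v => g v * h a v) x = (∏ k, g (x k)) * slater h x :=
  Matrix.det_mul_column (fun k => g (x k)) (Matrix.of fun k a : Fin p => h a (x k))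

/-- Independent one-particle sums applied to a Slater determinant. -/
theorem sum_prod_mul_slater {p n : ℕ} (q : Fin p → ℕ → ℝ) (h : Fin p → ℕ → ℝ) :
    ∑ x : Fin p → Fin n, (∏ k, q k (x k)) * slater h (fun k => x k) =
      (Matrix.of fun k a : Fin p => ∑ y : Fin n, q k y * h a y).det := by
  simp only [slater, Matrix.det_apply', Matrix.of_apply, Finset.mul_sum]
  rw [Finset.sum_comm]
  refine Finset.sum_congr rfl fun σ _ => ?_
  rw [Finset.prod_univ_sum, Finset.mul_sum, Fintype.piFinset_univ,
    ← Equiv.sum_comp (Equiv.arrowCongr σ (Equiv.refl (Fin n)))]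
  refine Finset.sum_congr rfl fun x _ => ?_
  rw [← Equiv.prod_comp σ fun i => q i _, mul_left_comm, ← Finset.prod_mul_distrib]
  simp

/-- The weight of a step of a single hole from level `N + 1` to level `N`, where `n = N + p`. -/
def downWt (n y x : ℕ) : ℝ := if x = y then (n : ℝ) - y else if x + 1 = y then (y : ℝ) else 0

/-- The weight of a step of a single hole from level `N` to level `N + 1`, where `n = N + p`. -/
def upWt (a b : ℝ) (n x y : ℕ) : ℝ :=
  if y = x then a + n - x else if y = x + 1 then b + 1 + x else 0

/-- The operator with kernel `downWt`. -/
def stepDown (n : ℕ) (h : ℕ → ℝ) (y : ℕ) : ℝ := (n - y) * h y + y * h (y - 1)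

/-- The operator with kernel `upWt`. -/
def stepUp (a b : ℝ) (n : ℕ) (h : ℕ → ℝ) (x : ℕ) : ℝ :=
  (a + n - x) * h x + (b + 1 + x) * h (x + 1)

theorem sum_downWt (n : ℕ) (h : ℕ → ℝ) {y : ℕ} (hy : y ≤ n) :
    ∑ x : Fin n, downWt n y x * h x = stepDown n h y := by
  rw [Fin.sum_univ_eq_sum_range (fun x => downWt n y x * h x)]
  have : ∀ x ∈ Finset.range n, downWt n y x * h x =
      (if x = y then ((n : ℝ) - y) * h y else 0) +
        if x + 1 = y then (y : ℝ) * h (y - 1) else 0 := by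
    intro x _
    unfold downWt
    split_ifs with h1 h2 h3
    · omega
    · rw [h1]; ring
    · rw [← h3]; simp
    · simp
  rw [Finset.sum_congr rfl this, Finset.sum_add_distrib, stepDown, Finset.sum_ite_eq']
  congr 1
  · rcases hy.lt_or_eq with h | rfl
    · simp [h]
    · simp
  · rcases y with _ | y
    · simp
    · simp only [add_left_inj, Finset.sum_ite_eq', Finset.mem_range]
      rw [if_pos (by omega)]

theorem sum_upWt (a b : ℝ) (n n' : ℕ) (hn : n' = n + 1) (h : ℕ → ℝ) {x : ℕ} (hx : x < n) :
    ∑ y : Fin n', upWt a b n x y * h y = stepUp a b n h x := by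
  rw [Fin.sum_univ_eq_sum_range (fun y => upWt a b n x y * h y)]
  have : ∀ y ∈ Finset.range n', upWt a b n x y * h y =
      (if y = x then (a + n - x) * h x else 0) +
        if y = x + 1 then (b + 1 + x) * h (x + 1) else 0 := by
    intro y _
    unfold upWt
    split_ifs with h1 h2 h3
    · omega
    · rw [h1]; ring
    · rw [h3]; simp
    · simp
  rw [Finset.sum_congr rfl this, Finset.sum_add_distrib, stepUp, Finset.sum_ite_eq',
    Finset.sum_ite_eq', if_pos (by simp; omega), if_pos (by simp; omega)]

theorem sum_conf_eq_sum {p n : ℕ} (f : (Fin p → Fin n) → ℝ)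
    (hf : ∀ x, f x ≠ 0 → StrictMono x) : ∑ x : Conf p n, f x.1 = ∑ x, f x := by
  classical
  rw [← Finset.sum_filter_of_ne (p := StrictMono) (fun x _ h => hf x h)]
  exact (Finset.sum_subtype (Finset.univ.filter fun x : Fin p → Fin n => StrictMono x)
    (by simp) f).symm

theorem strictMono_of_injective_of_le {p n : ℕ} {x : Fin p → Fin n}
    (hx : Function.Injective fun k => (x k : ℕ)) (h : Monotone fun k => (x k : ℕ)) :
    StrictMono x := by
  intro i j hij
  exact (h.strictMono_of_injective hx) hij

/-- Ordered configurations may be replaced by arbitrary tuples in the sum over down steps. -/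
theorem sum_down_slater {p n : ℕ} {y : Fin p → ℕ} (hy : StrictMono y) (hyn : ∀ k, y k ≤ n)
    (h : Fin p → ℕ → ℝ) :
    ∑ x : Conf p n, (∏ k, downWt n (y k) (x.1 k)) * slater h (fun k => x.1 k) =
      slater (fun a => stepDown n (h a)) y := by
  rw [sum_conf_eq_sum fun x : Fin p → Fin n =>
    (∏ k, downWt n (y k) (x k)) * slater h (fun k => x k), sum_prod_mul_slater]
  · simp only [sum_downWt n _ (hyn _), slater]
  · intro x hx
    have hinj : Function.Injective fun k => (x k : ℕ) := by
      by_contra hc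
      exact hx (by rw [slater_eq_zero h hc, mul_zero])
    refine strictMono_of_injective_of_le hinj ?_
    have hstep : ∀ k, (x k : ℕ) = y k ∨ (x k : ℕ) + 1 = y k := by
      intro k
      have := (Finset.prod_ne_zero_iff.1 (left_ne_zero_of_mul hx)) k (Finset.mem_univ k)
      unfold downWt at this
      split_ifs at this with h1 h2
      · exact Or.inl h1
      · exact Or.inr h2
      · exact absurd rfl this
    intro i j hij
    rcases hij.lt_or_eq with hlt | rfl
    · have := hy hlt
      have h1 := hstep i
      have h2 := hstep j
      simp only
      omega
    · rfl

/-- Ordered configurations may be replaced by arbitrary tuples in the sum over up steps. -/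
theorem sum_up_slater {p n n' : ℕ} (hn : n' = n + 1) (a b : ℝ) {x : Fin p → ℕ}
    (hx : StrictMono x) (hxn : ∀ k, x k < n) (h : Fin p → ℕ → ℝ) :
    ∑ y : Conf p n', (∏ k, upWt a b n (x k) (y.1 k)) * slater h (fun k => y.1 k) =
      slater (fun i => stepUp a b n (h i)) x := by
  rw [sum_conf_eq_sum fun y : Fin p → Fin n' =>
    (∏ k, upWt a b n (x k) (y k)) * slater h (fun k => y k),
    sum_prod_mul_slater (fun k => upWt a b n (x k))]
  · simp only [sum_upWt a b n n' hn _ (hxn _), slater]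
  · intro y hy
    have hinj : Function.Injective fun k => (y k : ℕ) := by
      by_contra hc
      exact hy (by rw [slater_eq_zero h hc, mul_zero])
    refine strictMono_of_injective_of_le hinj ?_
    have hstep : ∀ k, (y k : ℕ) = x k ∨ (y k : ℕ) = x k + 1 := by
      intro k
      have := (Finset.prod_ne_zero_iff.1 (left_ne_zero_of_mul hy)) k (Finset.mem_univ k)
      unfold upWt at this
      split_ifs at this with h1 h2
      · exact Or.inl h1
      · exact Or.inr h2
      · exact absurd rfl this
    intro i j hij
    rcases hij.lt_or_eq with hlt | rfl
    · have := hx hlt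
      have h1 := hstep i
      have h2 := hstep j
      simp only
      omega
    · rfl

open Polynomial in
theorem natDegree_coeff_X_add_C_mul {P : ℝ[X]} {k : ℕ} (c : ℝ) (hP : P.natDegree ≤ k) :
    ((X + C c) * P).natDegree ≤ k + 1 ∧ ((X + C c) * P).coeff (k + 1) = P.coeff k := by
  constructor
  · refine natDegree_mul_le.trans ?_
    rw [natDegree_X_add_C]
    omega
  · rw [add_mul, coeff_add, coeff_X_mul, coeff_C_mul,
      coeff_eq_zero_of_natDegree_lt (Nat.lt_succ_of_le hP)]
    simp

open Polynomial in
/-- The down step is triangular on polynomials; the diagonal entries are the eigenvalues `n - k`. -/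
theorem exists_stepDown_pow (n k : ℕ) : ∃ P : ℝ[X], P.natDegree ≤ k ∧ P.coeff k = n - k ∧
    ∀ y : ℕ, stepDown n (fun v => (v : ℝ) ^ k) y = P.eval (y : ℝ) := by
  have key : ∀ k : ℕ, (X * ((X - 1) ^ k - X ^ k) : ℝ[X]).natDegree ≤ k ∧
      (X * ((X - 1) ^ k - X ^ k) : ℝ[X]).coeff k = -k := by
    intro k
    induction k with
    | zero => simp
    | succ k ih =>
      have h1 : (X * ((X - 1) ^ (k + 1) - X ^ (k + 1)) : ℝ[X]) =
          (X + C (-1)) * (X * ((X - 1) ^ k - X ^ k)) - X ^ (k + 1) := by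
        rw [C_neg, C_1]; ring
      obtain ⟨h2, h3⟩ := natDegree_coeff_X_add_C_mul (-1) ih.1
      rw [h1, coeff_sub, h3, ih.2, coeff_X_pow_self]
      refine ⟨(natDegree_sub_le _ _).trans (max_le h2 (natDegree_X_pow_le _)), ?_⟩
      push_cast; ring
  refine ⟨X * ((X - 1) ^ k - X ^ k) + C (n : ℝ) * X ^ k, ?_, ?_, ?_⟩
  · exact (natDegree_add_le _ _).trans (max_le (key k).1 (natDegree_C_mul_X_pow_le _ _))
  · rw [coeff_add, (key k).2, coeff_C_mul_X_pow, if_pos rfl]; ring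
  · intro y
    simp only [stepDown, eval_add, eval_mul, eval_C, eval_pow, eval_X, eval_sub, eval_one]
    -- truncated subtraction is harmless, as the factor `y` vanishes at `y = 0`
    have h2 : (y : ℝ) * ((y - 1 : ℕ) : ℝ) ^ k = y * ((y : ℝ) - 1) ^ k := by
      rcases y with _ | y
      · simp
      · simp
    rw [h2]; ring

open Polynomial in
/-- The up step is triangular on polynomials, with diagonal entries `n + a + b + 1 + k`. -/
theorem exists_stepUp_pow (a b : ℝ) (n k : ℕ) : ∃ P : ℝ[X], P.natDegree ≤ k ∧
    P.coeff k = n + a + b + 1 + k ∧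
    ∀ y : ℕ, stepUp a b n (fun v => (v : ℝ) ^ k) y = P.eval (y : ℝ) := by
  have key : ∀ k : ℕ, ((X + C (b + 1)) * ((X + 1) ^ k - X ^ k) : ℝ[X]).natDegree ≤ k ∧
      ((X + C (b + 1)) * ((X + 1) ^ k - X ^ k) : ℝ[X]).coeff k = k := by
    intro k
    induction k with
    | zero => simp
    | succ k ih =>
      have h1 : ((X + C (b + 1)) * ((X + 1) ^ (k + 1) - X ^ (k + 1)) : ℝ[X]) =
          (X + C 1) * ((X + C (b + 1)) * ((X + 1) ^ k - X ^ k)) + (X + C (b + 1)) * X ^ k := by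
        rw [C_1]; ring
      obtain ⟨h2, h3⟩ := natDegree_coeff_X_add_C_mul 1 ih.1
      obtain ⟨h4, h5⟩ := natDegree_coeff_X_add_C_mul (P := X ^ k) (b + 1) (natDegree_X_pow_le k)
      rw [h1, coeff_add, h3, h5, ih.2, coeff_X_pow_self]
      refine ⟨(natDegree_add_le _ _).trans (max_le h2 h4), ?_⟩
      push_cast; ring
  refine ⟨(X + C (b + 1)) * ((X + 1) ^ k - X ^ k) + C (n + a + b + 1) * X ^ k, ?_, ?_, ?_⟩
  · exact (natDegree_add_le _ _).trans (max_le (key k).1 (natDegree_C_mul_X_pow_le _ _))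
  · rw [coeff_add, (key k).2, coeff_C_mul_X_pow, if_pos rfl]; ring
  · intro y
    simp only [stepUp, eval_add, eval_mul, eval_C, eval_pow, eval_X, eval_sub, eval_one,
      Nat.cast_add, Nat.cast_one]
    ring

/-- The Vandermonde determinant is an eigenfunction of independent down steps. -/
theorem slater_stepDown_pow (p n : ℕ) (y : Fin p → ℕ) :
    slater (fun a : Fin p => stepDown n fun v => (v : ℝ) ^ (a : ℕ)) y =
      (∏ a : Fin p, ((n : ℝ) - (a : ℕ))) * vdm y := by
  choose P h1 h2 h3 using fun a : Fin p => exists_stepDown_pow n a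
  simp only [slater, h3]
  rw [det_eval_eq_vandermonde _ _ h1]
  simp only [h2]
  rfl

/-- The Vandermonde determinant is an eigenfunction of independent up steps. -/
theorem slater_stepUp_pow (a b : ℝ) (p n : ℕ) (y : Fin p → ℕ) :
    slater (fun i : Fin p => stepUp a b n fun v => (v : ℝ) ^ (i : ℕ)) y =
      (∏ i : Fin p, (n + a + b + 1 + (i : ℕ))) * vdm y := by
  choose P h1 h2 h3 using fun i : Fin p => exists_stepUp_pow a b n i
  simp only [slater, h3]
  rw [det_eval_eq_vandermonde _ _ h1]
  simp only [h2]
  rfl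

end

noncomputable section

/-! ### The dimension formula -/

/-- The last edge of a path in the Gelfand–Tsetlin graph. -/
def gtPathSuccEquiv {N : ℕ} (m : Signature (N + 1)) :
    GTPath m ≃ Σ l : {l : Signature N // Interlaces l m}, GTPath l.1 where
  toFun path := match path with
    | .cons path h => ⟨⟨_, h⟩, path⟩
  invFun s := .cons s.2 s.1.2
  left_inv path := by cases path; rfl
  right_inv _ := rfl

/-- The constant in the dimension formula for signatures in the `N × p` box. -/
def dimConst (p : ℕ) : ℕ → ℝ
  | 0 => (∏ k : Fin p, (((k : ℕ).factorial : ℝ) * ((p - 1 - k : ℕ).factorial : ℝ))) /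
      vdm fun k : Fin p => (k : ℕ)
  | N + 1 => dimConst p N * ∏ a : Fin p, (((N + p : ℕ) : ℝ) - (a : ℕ))

theorem prod_sub_pos (p N : ℕ) : 0 < ∏ a : Fin p, (((N + p : ℕ) : ℝ) - (a : ℕ)) := by
  refine Finset.prod_pos fun a _ => ?_
  have : ((a : ℕ) : ℝ) < p := by exact_mod_cast a.2
  push_cast
  linarith

theorem dimConst_pos (p N : ℕ) : 0 < dimConst p N := by
  induction N with
  | zero =>
    refine div_pos (Finset.prod_pos fun k _ => by positivity) (vdm_pos fun _ _ h => h)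
  | succ N ih => exact mul_pos ih (prod_sub_pos p N)

/-- The recursion behind the product in `gtDim_confSig`: a down step changes the factorials by its weight. -/
theorem downWt_div {n x y : ℕ} (hx : x < n) (hy : y ≤ n) (h : x = y ∨ x + 1 = y) :
    (1 : ℝ) / (x.factorial * (n - 1 - x).factorial) =
      downWt n y x / (y.factorial * (n - y).factorial) := by
  rcases h with rfl | rfl
  · obtain ⟨d, rfl⟩ := Nat.exists_eq_add_of_lt hx
    have h1 : x + d + 1 - 1 - x = d := by omega
    have h2 : x + d + 1 - x = d + 1 := by omega
    rw [h1, h2, downWt, if_pos rfl, Nat.factorial_succ]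
    have : (d.factorial : ℝ) ≠ 0 := by positivity
    have : (x.factorial : ℝ) ≠ 0 := by positivity
    have : (d : ℝ) + 1 ≠ 0 := by positivity
    push_cast
    field_simp
    ring
  · have h1 : n - (x + 1) = n - 1 - x := by omega
    rw [h1, downWt, if_neg (by omega), if_pos rfl, Nat.factorial_succ]
    have : ((n - 1 - x).factorial : ℝ) ≠ 0 := by positivity
    have : (x.factorial : ℝ) ≠ 0 := by positivity
    have : (x : ℝ) + 1 ≠ 0 := by positivity
    push_cast
    field_simp

theorem prod_downWt_eq_zero {p n : ℕ} {x y : Fin p → ℕ}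
    (h : ¬ ∀ k, x k = y k ∨ x k + 1 = y k) : ∏ k, downWt n (y k) (x k) = 0 := by
  push Not at h
  obtain ⟨k, h1, h2⟩ := h
  refine Finset.prod_eq_zero (Finset.mem_univ k) ?_
  rw [downWt, if_neg h1, if_neg h2]

/-- Weyl's dimension formula, written in the holes. -/
theorem gtDim_confSig {p N : ℕ} (x : Conf p (N + p)) :
    Finite (GTPath (confSig x)) ∧ (gtDim (confSig x) : ℝ) = dimConst p N *
      vdm (fun k => x.1 k) *
        ∏ k, (1 / (((x.1 k : ℕ).factorial : ℝ) * ((N + p - 1 - x.1 k : ℕ).factorial : ℝ))) := by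
  induction N with
  | zero =>
    have hu : ∀ (l : Signature 0) (P Q : GTPath l), P = Q := by
      intro l P Q
      cases P
      cases Q
      rfl
    have : Subsingleton (GTPath (confSig x)) := ⟨hu _⟩
    refine ⟨inferInstance, ?_⟩
    have h1 : gtDim (confSig x) = 1 :=
      Nat.card_eq_one_iff_unique.2 ⟨inferInstance, ⟨GTPath.nil _⟩⟩
    have hx : ∀ k, (x.1 k : ℕ) = k := fun k => by
      have := x.apply_le k
      have := x.le_apply k
      omega
    rw [h1]
    simp only [hx, dimConst, one_div, Finset.prod_inv_distrib, zero_add]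
    have h2 : vdm (fun k : Fin p => (k : ℕ)) ≠ 0 := (vdm_pos fun _ _ h => h).ne'
    have h3 : (∏ k : Fin p, (((k : ℕ).factorial : ℝ) * ((p - 1 - k : ℕ).factorial : ℝ))) ≠ 0 :=
      Finset.prod_ne_zero_iff.2 fun k _ => by positivity
    rw [div_mul_cancel₀ _ h2, mul_inv_cancel₀ h3]
    simp
  | succ N ih =>
    let P : Conf p (N + p) → Prop := fun z => Interlaces (confSig z) (confSig x)
    let e : {z : Conf p (N + p) // P z} ≃
        {l : Signature N // Interlaces l (confSig x)} :=
      Equiv.ofBijective (fun z => ⟨confSig z.1, z.2⟩)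
        ⟨fun a b h => Subtype.ext (confSig_injective (congrArg Subtype.val h)), fun l => by
          obtain ⟨z, hz⟩ := exists_confSig ((inBox_confSig x).of_interlaces l.2)
          exact ⟨⟨z, by simp only [P, hz]; exact l.2⟩, Subtype.ext hz⟩⟩
    -- a path is its last edge together with a path to the penultimate signature
    let E : GTPath (confSig x) ≃ Σ z : {z : Conf p (N + p) // P z}, GTPath (confSig z.1) :=
      (gtPathSuccEquiv _).trans
        (Equiv.sigmaCongrLeft (β := fun l : {l : Signature N // Interlaces l (confSig x)} =>
          GTPath l.1) e).symm
    have hfin : ∀ z : {z : Conf p (N + p) // P z}, Finite (GTPath (confSig z.1)) :=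
      fun z => (ih z.1).1
    refine ⟨Finite.of_equiv _ E.symm, ?_⟩
    classical
    have hcard : (gtDim (confSig x) : ℝ) =
        ∑ z : {z : Conf p (N + p) // P z}, (gtDim (confSig z.1) : ℝ) := by
      unfold gtDim
      rw [Nat.card_congr E, Nat.card_sigma]
      push_cast
      rfl
    have hstep : ∀ z : Conf p (N + p), (if P z then (gtDim (confSig z) : ℝ) else 0) =
        dimConst p N * (∏ k, (1 / (((x.1 k : ℕ).factorial : ℝ) *
          ((N + 1 + p - 1 - x.1 k : ℕ).factorial : ℝ)))) *
          ((∏ k, downWt (N + p) (x.1 k) (z.1 k)) *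
            slater (fun (a : Fin p) v => (v : ℝ) ^ (a : ℕ)) (fun k => z.1 k)) := by
      intro z
      split_ifs with hz
      · rw [(ih z).2, vdm_eq_slater]
        have hz' := (interlaces_confSig_iff z x).1 hz
        have : ∀ k, (1 / (((z.1 k : ℕ).factorial : ℝ) * ((N + p - 1 - z.1 k : ℕ).factorial : ℝ)))
            = (1 / (((x.1 k : ℕ).factorial : ℝ) * ((N + 1 + p - 1 - x.1 k : ℕ).factorial : ℝ))) *
              downWt (N + p) (x.1 k) (z.1 k) := by
          intro k
          have hk := (x.1 k).2
          rw [downWt_div (z.1 k).2 (by omega) (hz' k),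
            show N + 1 + p - 1 - (x.1 k : ℕ) = N + p - x.1 k by omega]
          ring
        simp only [this, Finset.prod_mul_distrib]
        ring
      · rw [prod_downWt_eq_zero (fun hc => hz ((interlaces_confSig_iff z x).2 hc))]
        simp
    -- the sum over the down steps reproduces the Vandermonde determinant
    rw [hcard, ← Finset.sum_subtype (Finset.univ.filter P) (by simp)
      (fun z => (gtDim (confSig z) : ℝ)), Finset.sum_filter, Finset.sum_congr rfl fun z _ => hstep z,
      ← Finset.mul_sum, sum_down_slater (y := fun k => (x.1 k : ℕ)) x.2
        (fun k => by have := (x.1 k).2; omega), slater_stepDown_pow, dimConst]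
    ring

/-- The cotransition probabilities as an `h`-transform of independent steps. -/
theorem pDown_confSig {p N : ℕ} (x : Conf p (N + p)) (y : Conf p (N + 1 + p)) :
    pDown (confSig x) (confSig y) =
      (∏ k, downWt (N + p) (y.1 k) (x.1 k)) * vdm (fun k => x.1 k) / vdm (fun k => y.1 k) /
        ∏ a : Fin p, (((N + p : ℕ) : ℝ) - (a : ℕ)) := by
  unfold pDown
  split_ifs with h
  · have h' := (interlaces_confSig_iff x y).1 h
    rw [(gtDim_confSig x).2, (gtDim_confSig y).2, dimConst]
    have h1 : ∀ k, (1 / (((x.1 k : ℕ).factorial : ℝ) * ((N + p - 1 - x.1 k : ℕ).factorial : ℝ)))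
        = downWt (N + p) (y.1 k) (x.1 k) *
          (1 / (((y.1 k : ℕ).factorial : ℝ) * ((N + 1 + p - 1 - y.1 k : ℕ).factorial : ℝ))) := by
      intro k
      have hk := (y.1 k).2
      rw [downWt_div (x.1 k).2 (by omega) (h' k),
        show N + 1 + p - 1 - (y.1 k : ℕ) = N + p - y.1 k by omega]
      ring
    simp only [h1, Finset.prod_mul_distrib]
    have h2 := (dimConst_pos p N).ne'
    have h3 := (prod_sub_pos p N).ne'
    have h4 := (vdm_pos (x := fun k => (y.1 k : ℕ)) y.2).ne'
    rw [div_div, div_eq_div_iff (by positivity) (by positivity)]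
    ring
  · rw [prod_downWt_eq_zero (fun hc => h ((interlaces_confSig_iff x y).2 hc))]
    simp

/-! ### The weights -/

/-- The one-particle (Hahn) weight on `{0, …, n - 1}`. -/
def hahnWt (a b : ℝ) (n x : ℕ) : ℝ :=
  Real.Gamma (a + n - x) * Real.Gamma (b + 1 + x) / (x.factorial * (n - 1 - x).factorial)

theorem hahnWt_pos {a b : ℝ} (ha : -1 < a) (hb : -1 < b) {n x : ℕ} (hx : x < n) :
    0 < hahnWt a b n x := by
  have h1 : (x : ℝ) + 1 ≤ n := by exact_mod_cast hx
  have := Real.Gamma_pos_of_pos (show 0 < a + n - x by linarith)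
  have := Real.Gamma_pos_of_pos (show 0 < b + 1 + x by linarith)
  unfold hahnWt
  positivity

theorem hahnWt_succ_same {a b : ℝ} (ha : -1 < a) {n x : ℕ} (hx : x < n) :
    hahnWt a b (n + 1) x * (n - x) = hahnWt a b n x * (a + n - x) := by
  obtain ⟨d, rfl⟩ := Nat.exists_eq_add_of_lt hx
  unfold hahnWt
  have h1 : x + d + 1 - 1 - x = d := by omega
  have h2 : x + d + 1 + 1 - 1 - x = d + 1 := by omega
  have h3 : a + ((x + d + 1 + 1 : ℕ) : ℝ) - x = (a + ((x + d + 1 : ℕ) : ℝ) - x) + 1 := by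
    push_cast; ring
  rw [h1, h2, h3, Real.Gamma_add_one (by push_cast; have : (0 : ℝ) ≤ d := by positivity
                                         intro h; linarith), Nat.factorial_succ]
  push_cast
  field_simp
  ring

theorem hahnWt_succ_succ {a b : ℝ} (hb : -1 < b) {n x : ℕ} (hx : x < n) :
    hahnWt a b (n + 1) (x + 1) * (x + 1) = hahnWt a b n x * (b + 1 + x) := by
  unfold hahnWt
  have h1 : n + 1 - 1 - (x + 1) = n - 1 - x := by omega
  have h2 : b + 1 + ((x + 1 : ℕ) : ℝ) = (b + 1 + x) + 1 := by push_cast; ring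
  have h3 : a + ((n + 1 : ℕ) : ℝ) - ((x + 1 : ℕ) : ℝ) = a + n - x := by push_cast; ring
  rw [h1, h2, h3, Real.Gamma_add_one (by intro h; linarith), Nat.factorial_succ]
  have : ((n - 1 - x).factorial : ℝ) ≠ 0 := by positivity
  have : (x.factorial : ℝ) ≠ 0 := by positivity
  have : (x : ℝ) + 1 ≠ 0 := by positivity
  push_cast
  field_simp

/-- Detailed balance between neighbouring sites. -/
theorem hahnWt_balance {a b : ℝ} (ha : -1 < a) (hb : -1 < b) {n x : ℕ} (hx : x + 1 < n) :
    hahnWt a b n (x + 1) * ((a + n - (x + 1)) * (x + 1)) =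
      hahnWt a b n x * ((b + 1 + x) * (n - 1 - x)) := by
  have h1 := hahnWt_succ_same (b := b) ha hx
  have h2 := hahnWt_succ_succ (a := a) hb (show x < n by omega)
  push_cast at h1
  linear_combination (-(x + 1 : ℝ)) * h1 + (n - (x + 1) : ℝ) * h2

/-- An up step is the reversal of a down step with respect to the Hahn weights. -/
theorem upWt_eq {a b : ℝ} (ha : -1 < a) (hb : -1 < b) {n x y : ℕ} (hx : x < n) :
    hahnWt a b (n + 1) y * downWt n y x / hahnWt a b n x = upWt a b n x y := by
  have h0 := (hahnWt_pos ha hb hx).ne'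
  rw [div_eq_iff h0]
  unfold upWt downWt
  by_cases h1 : x = y
  · subst h1
    rw [if_pos rfl, if_pos rfl, hahnWt_succ_same ha hx]
    ring
  · by_cases h2 : x + 1 = y
    · subst h2
      rw [if_neg h1, if_pos rfl, if_neg (fun h => h1 h.symm), if_pos rfl]
      push_cast
      rw [hahnWt_succ_succ hb hx]
      ring
    · rw [if_neg h1, if_neg h2, if_neg (fun h => h1 h.symm), if_neg (fun h => h2 h.symm)]
      simp

/-- The weight of a hole configuration, up to a constant. -/
def confWt (a b : ℝ) {p n : ℕ} (x : Conf p n) : ℝ :=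
  vdm (fun k => x.1 k) ^ 2 * ∏ k, hahnWt a b n (x.1 k)

theorem confWt_pos {a b : ℝ} (ha : -1 < a) (hb : -1 < b) {p n : ℕ} (x : Conf p n) :
    0 < confWt a b x :=
  mul_pos (pow_pos (vdm_pos x.2) 2) (Finset.prod_pos fun k _ => hahnWt_pos ha hb (x.1 k).2)

/-- The poles of `Γ(p - λ₁ + 1)` and `Γ(1 + λ_N)` confine the support of the weight to the `N × p` box.
Here `Real.Gamma` vanishes at its poles, as does its inverse. -/
theorem inBox_of_zwWeight_ne_zero {p : ℕ} {z' w' : ℝ} {N : ℕ} {l : Signature N}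
    (h : zwWeight p 0 z' w' l ≠ 0) : InBox p l := by
  have hprod := right_ne_zero_of_mul h
  rw [Finset.prod_ne_zero_iff] at hprod
  have hGamma : ∀ c : ℤ, (Real.Gamma c)⁻¹ ≠ 0 → 0 < c := by
    intro c hc
    by_contra hneg
    apply hc
    obtain ⟨m, hm⟩ := Int.exists_eq_neg_ofNat (not_lt.1 hneg)
    rw [hm]
    push_cast
    rw [Real.Gamma_neg_nat_eq_zero, inv_zero]
  intro i
  have hN : 0 < N := i.pos
  constructor
  · have h1 := hprod ⟨N - 1, by omega⟩ (Finset.mem_univ _)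
    have h2 := hGamma (l.1 ⟨N - 1, by omega⟩ + 1) (by
      have := right_ne_zero_of_mul (left_ne_zero_of_mul (left_ne_zero_of_mul h1))
      convert this using 3
      push_cast [Nat.cast_sub (show 1 ≤ N by omega)]
      ring)
    have : l.1 ⟨N - 1, by omega⟩ ≤ l.1 i := l.2 (by
      simp only [Fin.le_def]
      have := i.2
      omega)
    omega
  · have h1 := hprod ⟨0, hN⟩ (Finset.mem_univ _)
    have h2 := hGamma (p - l.1 ⟨0, hN⟩ + 1) (by
      have := left_ne_zero_of_mul (left_ne_zero_of_mul (left_ne_zero_of_mul h1))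
      convert this using 3
      push_cast
      ring)
    have : l.1 i ≤ l.1 ⟨0, hN⟩ := l.2 (by simp [Fin.le_def])
    omega

/-- The Gamma factors form a product over the points of the signature. Since the points and the holes
fill `{0, …, N + p - 1}`, this is, up to a constant, the product of the reciprocals over the holes. -/
theorem exists_zwWeight_confSig (p : ℕ) {z' w' : ℝ} (hz : (p : ℝ) - 1 < z') (hw : -1 < w')
    (N : ℕ) : ∃ κ : ℝ, 0 < κ ∧ ∀ x : Conf p (N + p),
      zwWeight p 0 z' w' (confSig x) = κ * confWt (z' - p) w' x := by
  have ha : -1 < z' - p := by linarith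
  let G : ℕ → ℝ := fun v => ((v.factorial : ℝ) * ((N + p - 1 - v).factorial : ℝ)) ^ 2 *
    hahnWt (z' - p) w' (N + p) v
  have hG : ∀ v, v < N + p → 0 < G v := fun v hv =>
    mul_pos (by positivity) (hahnWt_pos ha hw hv)
  refine ⟨dimConst p N ^ 2 * (∏ v : Fin (N + p), G v)⁻¹,
    mul_pos (pow_pos (dimConst_pos p N) 2)
      (inv_pos.2 (Finset.prod_pos fun v _ => hG v v.2)), fun x => ?_⟩
  have hprod : ∏ v : Fin (N + p), G v = (∏ k, G (x.1 k)) *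
      ∏ i, G (confSumEquiv x (Sum.inr i)) := by
    rw [← (confSumEquiv x).prod_comp, Fintype.prod_sum_type]
    rfl
  have hfac : ∀ i : Fin N,
      ((Real.Gamma ((p : ℝ) - (confSig x).1 i + (i + 1)))⁻¹ *
        (Real.Gamma ((0 : ℝ) + N + 1 + (confSig x).1 i - (i + 1)))⁻¹ *
        (Real.Gamma (z' - (confSig x).1 i + (i + 1)))⁻¹ *
        (Real.Gamma (w' + N + 1 + (confSig x).1 i - (i + 1)))⁻¹) =
        (G (confSumEquiv x (Sum.inr i)))⁻¹ := by
    intro i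
    have hl := confSumEquiv_inr x i
    have hlt := (confSumEquiv x (Sum.inr i)).2
    generalize (confSumEquiv x (Sum.inr i) : ℕ) = v at hl hlt
    have hl' : (((confSig x).1 i : ℤ) : ℝ) = v + (i + 1) - N := by
      have : ((v : ℤ) : ℝ) = (((confSig x).1 i - ((i : ℤ) + 1) + N : ℤ) : ℝ) := by rw [hl]
      push_cast at this
      linarith
    have hv : ((N + p - 1 - v : ℕ) : ℝ) = N + p - 1 - v := by
      rw [Nat.sub_sub, Nat.cast_sub (by omega)]
      push_cast
      ring
    rw [hl', ← mul_inv, ← mul_inv, ← mul_inv]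
    congr 1
    have e1 : (p : ℝ) - (v + ((i : ℕ) + 1) - N) + ((i : ℕ) + 1) =
        ((N + p - 1 - v : ℕ) : ℝ) + 1 := by rw [hv]; ring
    have e2 : (0 : ℝ) + N + 1 + (v + ((i : ℕ) + 1) - N) - ((i : ℕ) + 1) = v + 1 := by ring
    have e3 : z' - (v + ((i : ℕ) + 1) - N) + ((i : ℕ) + 1) = z' - p + ((N + p : ℕ) : ℝ) - v := by
      push_cast; ring
    have e4 : w' + N + 1 + (v + ((i : ℕ) + 1) - N) - ((i : ℕ) + 1) = w' + 1 + v := by ring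
    rw [e1, e2, e3, e4, Real.Gamma_nat_eq_factorial, Real.Gamma_nat_eq_factorial]
    simp only [G, hahnWt]
    have : ((N + p - 1 - v).factorial : ℝ) ≠ 0 := by positivity
    have : (v.factorial : ℝ) ≠ 0 := by positivity
    field_simp
  have hGi : (∏ i, G (confSumEquiv x (Sum.inr i))) ≠ 0 :=
    Finset.prod_ne_zero_iff.2 fun i _ => (hG _ (confSumEquiv x (Sum.inr i)).2).ne'
  rw [zwWeight, Finset.prod_congr rfl fun i _ => hfac i, hprod, (gtDim_confSig x).2, confWt,
    Finset.prod_inv_distrib]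
  have hGx' : ∏ k, G (x.1 k) = (∏ k, (((x.1 k : ℕ).factorial : ℝ) *
      ((N + p - 1 - x.1 k : ℕ).factorial : ℝ))) ^ 2 * ∏ k, hahnWt (z' - p) w' (N + p) (x.1 k) := by
    simp only [G, Finset.prod_mul_distrib, Finset.prod_pow, mul_pow]
  have hD : (∏ k, (((x.1 k : ℕ).factorial : ℝ) * ((N + p - 1 - x.1 k : ℕ).factorial : ℝ))) ≠ 0 :=
    Finset.prod_ne_zero_iff.2 fun k _ => by positivity
  have hW : (∏ k, hahnWt (z' - p) w' (N + p) (x.1 k)) ≠ 0 :=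
    Finset.prod_ne_zero_iff.2 fun k _ => (hahnWt_pos ha hw (x.1 k).2).ne'
  rw [hGx']
  simp only [one_div, Finset.prod_inv_distrib]
  field_simp

end

noncomputable section

/-! ### The up-down chain on hole configurations -/

/-- The normalizing constant of `confWt`. -/
def confZ (a b : ℝ) (p n : ℕ) : ℝ := ∑ x : Conf p n, confWt a b x

theorem confZ_pos {a b : ℝ} (ha : -1 < a) (hb : -1 < b) {p n : ℕ} (hpn : p ≤ n) :
    0 < confZ a b p n := by
  have : Nonempty (Conf p n) := ⟨⟨Fin.castLE hpn, Fin.strictMono_castLE hpn⟩⟩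
  exact Finset.sum_pos (fun x _ => confWt_pos ha hb x) Finset.univ_nonempty

theorem inBox_of_zwMeasure_ne_zero {p : ℕ} {z' w' : ℝ} {N : ℕ} {l : Signature N}
    (h : zwMeasure p z' w' l ≠ 0) : InBox p l :=
  inBox_of_zwWeight_ne_zero (fun h0 => h (by rw [zwMeasure, h0, zero_div]))

variable {p : ℕ} {z' w' : ℝ}

/-- In the holes, `M_N` is the `p`-point Hahn ensemble. -/
theorem zwMeasure_confSig (hz : (p : ℝ) - 1 < z') (hw : -1 < w') {N : ℕ} (x : Conf p (N + p)) :
    zwMeasure p z' w' (confSig x) = confWt (z' - p) w' x / confZ (z' - p) w' p (N + p) := by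
  obtain ⟨κ, hκ, h⟩ := exists_zwWeight_confSig p hz hw N
  rw [zwMeasure, tsum_eq_sum_conf _ fun l hl => inBox_of_zwWeight_ne_zero hl]
  simp only [h, ← Finset.mul_sum]
  exact mul_div_mul_left _ _ hκ.ne'

theorem zwMeasure_confSig_pos (hz : (p : ℝ) - 1 < z') (hw : -1 < w') {N : ℕ}
    (x : Conf p (N + p)) : 0 < zwMeasure p z' w' (confSig x) := by
  rw [zwMeasure_confSig hz hw]
  exact div_pos (confWt_pos (by linarith) hw x) (confZ_pos (by linarith) hw (by omega))

theorem sum_zwMeasure (hz : (p : ℝ) - 1 < z') (hw : -1 < w') (N : ℕ) :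
    ∑ x : Conf p (N + p), zwMeasure p z' w' (confSig x) = 1 := by
  simp only [zwMeasure_confSig hz hw, ← Finset.sum_div]
  exact div_self (confZ_pos (by linarith) hw (by omega)).ne'

/-- The cotransition probabilities act on ratios `slater h / vdm` by `stepDown` on each factor. -/
theorem sum_pDown_slater {N : ℕ} (h : Fin p → ℕ → ℝ) (y : Conf p (N + 1 + p)) :
    ∑ x : Conf p (N + p), pDown (confSig x) (confSig y) *
        (slater h (fun k => x.1 k) / vdm (fun k => x.1 k)) =
      slater (fun i => stepDown (N + p) (h i)) (fun k => y.1 k) / vdm (fun k => y.1 k) /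
        ∏ a : Fin p, (((N + p : ℕ) : ℝ) - (a : ℕ)) := by
  have : ∀ x : Conf p (N + p), pDown (confSig x) (confSig y) *
      (slater h (fun k => x.1 k) / vdm (fun k => x.1 k)) =
      ((∏ k, downWt (N + p) (y.1 k) (x.1 k)) * slater h (fun k => x.1 k)) *
        (1 / vdm (fun k => y.1 k) / ∏ a : Fin p, (((N + p : ℕ) : ℝ) - (a : ℕ))) := by
    intro x
    have := (vdm_pos (x := fun k => (x.1 k : ℕ)) x.2).ne'
    rw [pDown_confSig]
    field_simp
  rw [Finset.sum_congr rfl fun x _ => this x, ← Finset.sum_mul,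
    sum_down_slater (y := fun k => (y.1 k : ℕ)) y.2 (fun k => by have := (y.1 k).2; omega)]
  ring

theorem sum_pDown {N : ℕ} (y : Conf p (N + 1 + p)) :
    ∑ x : Conf p (N + p), pDown (confSig x) (confSig y) = 1 := by
  have h := sum_pDown_slater (fun (a : Fin p) v => (v : ℝ) ^ (a : ℕ)) y
  rw [slater_stepDown_pow] at h
  have h1 : ∀ x : Conf p (N + p), slater (fun (a : Fin p) v => (v : ℝ) ^ (a : ℕ))
      (fun k => (x.1 k : ℕ)) / vdm (fun k => (x.1 k : ℕ)) = 1 := fun x => by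
    rw [← vdm_eq_slater, div_self (vdm_pos (x := fun k => (x.1 k : ℕ)) x.2).ne']
  simp only [h1, mul_one] at h
  rw [h, mul_div_assoc, div_self (vdm_pos (x := fun k => (y.1 k : ℕ)) y.2).ne', mul_one,
    div_self (prod_sub_pos p N).ne']

/-- The transition probabilities as an `h`-transform of independent up steps, with the normalizing
constant still expressed through `confZ`. -/
theorem pUp_confSig_aux (hz : (p : ℝ) - 1 < z') (hw : -1 < w') {N : ℕ} (x : Conf p (N + p))
    (y : Conf p (N + 1 + p)) :
    pUp p z' w' (confSig y) (confSig x) =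
      (∏ k, upWt (z' - p) w' (N + p) (x.1 k) (y.1 k)) * vdm (fun k => y.1 k) /
        vdm (fun k => x.1 k) * (confZ (z' - p) w' p (N + p) / confZ (z' - p) w' p (N + 1 + p) /
          ∏ a : Fin p, (((N + p : ℕ) : ℝ) - (a : ℕ))) := by
  have ha : -1 < z' - p := by linarith
  have hup : ∏ k, upWt (z' - p) w' (N + p) (x.1 k) (y.1 k) =
      (∏ k, hahnWt (z' - p) w' (N + 1 + p) (y.1 k)) * (∏ k, downWt (N + p) (y.1 k) (x.1 k)) /
        ∏ k, hahnWt (z' - p) w' (N + p) (x.1 k) := by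
    rw [← Finset.prod_mul_distrib, ← Finset.prod_div_distrib]
    refine Finset.prod_congr rfl fun k _ => ?_
    have e : hahnWt (z' - p) w' (N + 1 + p) (y.1 k) = hahnWt (z' - p) w' (N + p + 1) (y.1 k) := by
      congr 1; omega
    rw [← upWt_eq ha hw (x.1 k).2, e]
  rw [pUp, zwMeasure_confSig hz hw, zwMeasure_confSig hz hw, pDown_confSig, hup, confWt, confWt]
  have h1 := (confZ_pos ha hw (show p ≤ N + p by omega)).ne'
  have h2 := (confZ_pos ha hw (show p ≤ N + 1 + p by omega)).ne'
  have h3 := (vdm_pos (x := fun k => (x.1 k : ℕ)) x.2).ne'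
  have h4 := (vdm_pos (x := fun k => (y.1 k : ℕ)) y.2).ne'
  have h5 := (prod_sub_pos p N).ne'
  have h6 : ∏ k, hahnWt (z' - p) w' (N + p) (x.1 k) ≠ 0 :=
    Finset.prod_ne_zero_iff.2 fun k _ => (hahnWt_pos ha hw (x.1 k).2).ne'
  field_simp

theorem sum_pUp_slater_aux (hz : (p : ℝ) - 1 < z') (hw : -1 < w') {N : ℕ} (h : Fin p → ℕ → ℝ)
    (x : Conf p (N + p)) :
    ∑ y : Conf p (N + 1 + p), pUp p z' w' (confSig y) (confSig x) *
        (slater h (fun k => y.1 k) / vdm (fun k => y.1 k)) =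
      slater (fun i => stepUp (z' - p) w' (N + p) (h i)) (fun k => x.1 k) /
        vdm (fun k => x.1 k) * (confZ (z' - p) w' p (N + p) / confZ (z' - p) w' p (N + 1 + p) /
          ∏ a : Fin p, (((N + p : ℕ) : ℝ) - (a : ℕ))) := by
  rw [← sum_up_slater (show N + 1 + p = N + p + 1 by ring) (z' - p) w'
    (x := fun k => (x.1 k : ℕ)) x.2 (fun k => (x.1 k).2), Finset.sum_div, Finset.sum_mul]
  refine Finset.sum_congr rfl fun y _ => ?_
  have := (vdm_pos (x := fun k => (y.1 k : ℕ)) y.2).ne'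
  rw [pUp_confSig_aux hz hw]
  field_simp

theorem prod_add_pos {a b : ℝ} (ha : -1 < a) (hb : -1 < b) (N : ℕ) :
    0 < ∏ i : Fin p, (((N + p : ℕ) : ℝ) + a + b + 1 + (i : ℕ)) := by
  refine Finset.prod_pos fun i _ => ?_
  have h1 : ((i : ℕ) : ℝ) + 1 ≤ p := by exact_mod_cast i.2
  push_cast
  linarith

/-- The total mass of the up step does not depend on the starting point. -/
theorem sum_pUp_aux (hz : (p : ℝ) - 1 < z') (hw : -1 < w') {N : ℕ} (x : Conf p (N + p)) :
    ∑ y : Conf p (N + 1 + p), pUp p z' w' (confSig y) (confSig x) =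
      (∏ i : Fin p, (((N + p : ℕ) : ℝ) + (z' - p) + w' + 1 + (i : ℕ))) *
        (confZ (z' - p) w' p (N + p) / confZ (z' - p) w' p (N + 1 + p) /
          ∏ a : Fin p, (((N + p : ℕ) : ℝ) - (a : ℕ))) := by
  have h := sum_pUp_slater_aux hz hw (fun (a : Fin p) v => (v : ℝ) ^ (a : ℕ)) x
  rw [slater_stepUp_pow] at h
  have h1 : ∀ y : Conf p (N + 1 + p), slater (fun (a : Fin p) v => (v : ℝ) ^ (a : ℕ))
      (fun k => (y.1 k : ℕ)) / vdm (fun k => (y.1 k : ℕ)) = 1 := fun y => by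
    rw [← vdm_eq_slater, div_self (vdm_pos (x := fun k => (y.1 k : ℕ)) y.2).ne']
  simp only [h1, mul_one] at h
  rw [h, mul_div_assoc, div_self (vdm_pos (x := fun k => (x.1 k : ℕ)) x.2).ne', mul_one]

/-- The up chain is a Markov chain: this is the coherence of the measures `M_N`. -/
theorem sum_pUp (hz : (p : ℝ) - 1 < z') (hw : -1 < w') {N : ℕ} (x : Conf p (N + p)) :
    ∑ y : Conf p (N + 1 + p), pUp p z' w' (confSig y) (confSig x) = 1 := by
  -- the sums over `y` are all equal, and their mean with respect to `M_N` is `1`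
  have h1 : ∑ x : Conf p (N + p), zwMeasure p z' w' (confSig x) *
      ∑ y : Conf p (N + 1 + p), pUp p z' w' (confSig y) (confSig x) = 1 := by
    simp only [Finset.mul_sum]
    rw [Finset.sum_comm, ← sum_zwMeasure hz hw (N + 1)]
    refine Finset.sum_congr rfl fun y _ => ?_
    rw [← mul_one (zwMeasure p z' w' (confSig y)), ← sum_pDown y, Finset.mul_sum]
    refine Finset.sum_congr rfl fun x _ => ?_
    have := (zwMeasure_confSig_pos hz hw x).ne'
    rw [pUp]
    field_simp
  simp only [sum_pUp_aux hz hw] at h1 ⊢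
  rwa [← Finset.sum_mul, sum_zwMeasure hz hw, one_mul] at h1

/-- The ratio of the normalizing constants, read off from `sum_pUp`. -/
theorem confZ_ratio (hz : (p : ℝ) - 1 < z') (hw : -1 < w') (N : ℕ) :
    confZ (z' - p) w' p (N + p) / confZ (z' - p) w' p (N + 1 + p) /
        ∏ a : Fin p, (((N + p : ℕ) : ℝ) - (a : ℕ)) =
      (∏ i : Fin p, (((N + p : ℕ) : ℝ) + (z' - p) + w' + 1 + (i : ℕ)))⁻¹ := by
  let x : Conf p (N + p) := ⟨Fin.castLE (by omega), Fin.strictMono_castLE (by omega)⟩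
  have h := sum_pUp hz hw x
  rw [sum_pUp_aux hz hw, mul_comm] at h
  exact eq_inv_of_mul_eq_one_left h

/-- The eigenvalue of the one-particle up-down chain on polynomials of degree `i`. -/
def hahnEigen (a b : ℝ) (n i : ℕ) : ℝ := (n - i) * (n + a + b + 1 + i) / (n * (n + a + b + 1))

/-- The transition operator of the one-particle up-down chain. -/
def hahnOp (a b : ℝ) (n : ℕ) (f : ℕ → ℝ) (x : ℕ) : ℝ :=
  stepUp a b n (stepDown n f) x / (n * (n + a + b + 1))

/-- The transition matrix of the up-down chain on hole configurations. -/
def chainQ (p : ℕ) (z' w' : ℝ) (N : ℕ) (x y : Conf p (N + p)) : ℝ :=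
  pUpDown p z' w' (confSig y) (confSig x)

theorem pDown_nonneg {N : ℕ} (l : Signature N) (m : Signature (N + 1)) : 0 ≤ pDown l m := by
  unfold pDown
  split_ifs <;> positivity

theorem inBox_of_pUp_ne_zero {N : ℕ} {m : Signature (N + 1)} {l : Signature N}
    (h : pUp p z' w' m l ≠ 0) : InBox p m :=
  inBox_of_zwMeasure_ne_zero fun h0 => h (by rw [pUp, h0, zero_div, zero_mul])

theorem pUpDown_eq_sum {N : ℕ} (l l' : Signature N) :
    pUpDown p z' w' l l' = ∑ y : Conf p (N + 1 + p),
      pDown l (confSig y) * pUp p z' w' (confSig y) l' :=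
  tsum_eq_sum_conf (fun m => pDown l m * pUp p z' w' m l')
    fun _ hm => inBox_of_pUp_ne_zero (right_ne_zero_of_mul hm)

theorem inBox_of_pUpDown_ne_zero {N : ℕ} {l l' : Signature N} (h : pUpDown p z' w' l l' ≠ 0) :
    InBox p l := by
  rw [pUpDown_eq_sum] at h
  obtain ⟨y, -, hy⟩ := Finset.exists_ne_zero_of_sum_ne_zero h
  refine (inBox_confSig y).of_interlaces ?_
  by_contra hc
  exact hy (by rw [pDown, if_neg hc, zero_mul])

theorem chainQ_nonneg (hz : (p : ℝ) - 1 < z') (hw : -1 < w') {N : ℕ} (x y : Conf p (N + p)) :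
    0 ≤ chainQ p z' w' N x y := by
  rw [chainQ, pUpDown_eq_sum]
  refine Finset.sum_nonneg fun u _ => mul_nonneg (pDown_nonneg _ _) ?_
  exact mul_nonneg (div_nonneg (zwMeasure_confSig_pos hz hw _).le
    (zwMeasure_confSig_pos hz hw _).le) (pDown_nonneg _ _)

theorem sum_chainQ (hz : (p : ℝ) - 1 < z') (hw : -1 < w') {N : ℕ} (x : Conf p (N + p)) :
    ∑ y, chainQ p z' w' N x y = 1 := by
  simp only [chainQ, pUpDown_eq_sum]
  rw [Finset.sum_comm]
  simp only [← Finset.sum_mul, sum_pDown, one_mul, sum_pUp hz hw]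

/-- The up-down chain is the `h`-transform, by the Vandermonde determinant, of `p` independent
copies of the one-particle chain. -/
theorem sum_chainQ_slater (hz : (p : ℝ) - 1 < z') (hw : -1 < w') {N : ℕ} (h : Fin p → ℕ → ℝ)
    (x : Conf p (N + p)) :
    ∑ y, chainQ p z' w' N x y * (slater h (fun k => y.1 k) / vdm (fun k => y.1 k)) =
      (∏ i : Fin p, hahnEigen (z' - p) w' (N + p) i)⁻¹ *
        (slater (fun i => hahnOp (z' - p) w' (N + p) (h i)) (fun k => x.1 k) /
          vdm (fun k => x.1 k)) := by
  have h1 : ∀ y, chainQ p z' w' N x y * (slater h (fun k => y.1 k) / vdm (fun k => y.1 k)) =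
      ∑ u : Conf p (N + 1 + p), pUp p z' w' (confSig u) (confSig x) *
        (pDown (confSig y) (confSig u) *
          (slater h (fun k => y.1 k) / vdm (fun k => y.1 k))) := by
    intro y
    rw [chainQ, pUpDown_eq_sum, Finset.sum_mul]
    exact Finset.sum_congr rfl fun u _ => by ring
  rw [Finset.sum_congr rfl fun y _ => h1 y, Finset.sum_comm]
  simp only [← Finset.mul_sum, sum_pDown_slater]
  simp only [← mul_div_assoc, ← Finset.sum_div]
  simp only [mul_div_assoc, sum_pUp_slater_aux hz hw, confZ_ratio hz hw]
  have hop : slater (fun i => hahnOp (z' - p) w' (N + p) (h i)) (fun k => (x.1 k : ℕ)) =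
      (∏ _k : Fin p, (((N + p : ℕ) : ℝ) * ((N + p : ℕ) + (z' - p) + w' + 1))⁻¹) *
        slater (fun i => stepUp (z' - p) w' (N + p) (stepDown (N + p) (h i)))
          (fun k => (x.1 k : ℕ)) := by
    rw [← slater_mul fun _ => (((N + p : ℕ) : ℝ) * ((N + p : ℕ) + (z' - p) + w' + 1))⁻¹]
    congr 1
    funext i v
    rw [hahnOp, div_eq_inv_mul]
  have heig : ∏ i : Fin p, hahnEigen (z' - p) w' (N + p) i =
      (∏ a : Fin p, (((N + p : ℕ) : ℝ) - (a : ℕ))) *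
        (∏ i : Fin p, (((N + p : ℕ) : ℝ) + (z' - p) + w' + 1 + (i : ℕ))) *
        ∏ _k : Fin p, (((N + p : ℕ) : ℝ) * ((N + p : ℕ) + (z' - p) + w' + 1))⁻¹ := by
    rw [← Finset.prod_mul_distrib, ← Finset.prod_mul_distrib]
    rfl
  have h2 := (prod_sub_pos p N).ne'
  have h3 := (prod_add_pos (p := p) (show -1 < z' - p by linarith) hw N).ne'
  have h4 : ∏ _k : Fin p, (((N + p : ℕ) : ℝ) * ((N + p : ℕ) + (z' - p) + w' + 1))⁻¹ ≠ 0 := by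
    refine Finset.prod_ne_zero_iff.2 fun k _ => inv_ne_zero (mul_ne_zero ?_ ?_)
    · have := k.pos
      positivity
    · have : (1 : ℝ) ≤ p := by exact_mod_cast k.pos
      push_cast
      linarith
  have h5 := (vdm_pos (x := fun k => (x.1 k : ℕ)) x.2).ne'
  rw [heig, hop]
  generalize ∏ _k : Fin p, (((N + p : ℕ) : ℝ) * ((N + p : ℕ) + (z' - p) + w' + 1))⁻¹ = c at h4 ⊢
  field_simp

end

noncomputable section

/-! ### Sums over trajectories of a finite Markov chain -/

section Paths

variable {S : Type*} [Fintype S]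

/-- The weight of a trajectory of a Markov chain with initial weights `π` and transitions `Q`. -/
def pathWt (π : S → ℝ) (Q : S → S → ℝ) {m : ℕ} (τ : Fin (m + 1) → S) : ℝ :=
  π (τ 0) * ∏ k : Fin m, Q (τ k.castSucc) (τ k.succ)

/-- Backward recursion for expectations of products along a trajectory. -/
def backward (Q : S → S → ℝ) (F : ℕ → S → ℝ) : ℕ → ℕ → S → ℝ
  | s, 0, x => F s x
  | s, m + 1, x => F s x * ∑ y, Q x y * backward Q F (s + 1) m y

/-- Expectations of products along a trajectory, by the Markov property. -/
theorem sum_pathWt_prod (Q : S → S → ℝ) (F : ℕ → S → ℝ) (m s : ℕ) (π : S → ℝ) :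
    ∑ τ : Fin (m + 1) → S, pathWt π Q τ * ∏ k : Fin (m + 1), F (s + k) (τ k) =
      ∑ x, π x * backward Q F s m x := by
  induction m generalizing s π with
  | zero =>
    rw [← (Equiv.funUnique (Fin 1) S).symm.sum_comp]
    simp [pathWt, backward]
  | succ m ih =>
    rw [← (Fin.consEquiv fun _ => S).sum_comp, Fintype.sum_prod_type]
    refine Finset.sum_congr rfl fun x _ => ?_
    rw [backward, ← mul_assoc, ← ih (s + 1) (Q x), Finset.mul_sum]
    refine Finset.sum_congr rfl fun τ _ => ?_
    have h1 : pathWt π Q (Fin.cons (α := fun _ => S) x τ) = π x * pathWt (Q x) Q τ := by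
      rw [pathWt, pathWt, Fin.prod_univ_succ]
      rfl
    have h2 : ∏ k : Fin (m + 1 + 1), F (s + k) (Fin.cons (α := fun _ => S) x τ k) =
        F s x * ∏ k : Fin (m + 1), F (s + 1 + k) (τ k) := by
      rw [Fin.prod_univ_succ]
      simp only [Fin.val_zero, add_zero, Fin.cons_zero, Fin.cons_succ, Fin.val_succ, add_assoc,
        add_comm 1]
    change pathWt π Q (Fin.cons (α := fun _ => S) x τ) *
      ∏ k : Fin (m + 1 + 1), F (s + k) (Fin.cons (α := fun _ => S) x τ k) = _
    rw [h1, h2]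
    ring

/-- Prolonging the trajectories does not change the expectation of a function of the first steps. -/
theorem sum_pathWt_restrict {Q : S → S → ℝ} (hQ : ∀ x, ∑ y, Q x y = 1) (π : S → ℝ) {m : ℕ}
    (F : (Fin (m + 1) → S) → ℝ) (d : ℕ) :
    ∑ τ : Fin (m + d + 1) → S, pathWt π Q τ * F (fun k => τ (Fin.castLE (by omega) k)) =
      ∑ τ : Fin (m + 1) → S, pathWt π Q τ * F τ := by
  induction d with
  | zero => rfl
  | succ d ih =>
    rw [← ih]
    change ∑ τ : Fin (m + d + 1 + 1) → S, _ = _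
    rw [← (Fin.snocEquiv fun _ => S).sum_comp, Fintype.sum_prod_type, Finset.sum_comm]
    refine Finset.sum_congr rfl fun τ _ => ?_
    have h1 : ∀ x : S, pathWt π Q (Fin.snoc (α := fun _ => S) τ x) =
        pathWt π Q τ * Q (τ (Fin.last _)) x := by
      intro x
      simp only [pathWt]
      rw [Fin.prod_univ_castSucc, ← Fin.castSucc_zero, Fin.snoc_castSucc]
      simp only [Fin.succ_castSucc, Fin.snoc_castSucc, Fin.succ_last, Fin.snoc_last, mul_assoc]
    calc _ = ∑ x : S, pathWt π Q τ * F (fun k => τ (Fin.castLE (by omega) k)) *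
          Q (τ (Fin.last _)) x := by
          refine Finset.sum_congr rfl fun x _ => ?_
          have h2 : (fun k : Fin (m + 1) => Fin.snoc (α := fun _ => S) τ x
              (Fin.castLE (by omega) k)) = fun k => τ (Fin.castLE (by omega) k) := by
            funext k
            exact Fin.snoc_castSucc (α := fun _ => S) x τ (Fin.castLE (by omega) k)
          change pathWt π Q (Fin.snoc (α := fun _ => S) τ x) *
            F (fun k : Fin (m + 1) => Fin.snoc (α := fun _ => S) τ x
              (Fin.castLE (by omega) k)) = _
          rw [h1, h2]
          ring
      _ = _ := by rw [← Finset.mul_sum, hQ, mul_one]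

omit [Fintype S] in
theorem pathWt_nonneg {π : S → ℝ} {Q : S → S → ℝ} (hπ : ∀ x, 0 ≤ π x) (hQ : ∀ x y, 0 ≤ Q x y)
    {m : ℕ} (τ : Fin (m + 1) → S) : 0 ≤ pathWt π Q τ :=
  mul_nonneg (hπ _) (Finset.prod_nonneg fun _ _ => hQ _ _)

theorem sum_pathWt {π : S → ℝ} {Q : S → S → ℝ} (hπ : ∑ x, π x = 1) (hQ : ∀ x, ∑ y, Q x y = 1)
    (m : ℕ) : ∑ τ : Fin (m + 1) → S, pathWt π Q τ = 1 := by
  have h := sum_pathWt_restrict (m := 0) hQ π (fun _ => 1) m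
  simp only [mul_one] at h
  have h' : ∑ τ : Fin (m + 1) → S, pathWt π Q τ = ∑ τ : Fin (0 + 1) → S, pathWt π Q τ := by
    rw [← h]
    have : 0 + m + 1 = m + 1 := by omega
    have e : ∀ j, j = m → ∑ τ : Fin (m + 1) → S, pathWt π Q τ =
        ∑ τ : Fin (j + 1) → S, pathWt π Q τ := by rintro j rfl; rfl
    exact e _ (by omega)
  rw [h', ← (Equiv.funUnique (Fin 1) S).symm.sum_comp]
  simpa [pathWt] using hπ

end Paths

/-- The backward recursion for a single particle: `U` is the transition operator, `G k` the factor
at time `k`, and `φ` the final function. -/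
def backwardOp (U : (ℕ → ℝ) → ℕ → ℝ) (G : ℕ → ℕ → ℝ) (φ : ℕ → ℝ) : ℕ → ℕ → ℕ → ℝ
  | s, 0 => G s * φ
  | s, m + 1 => G s * U (backwardOp U G φ (s + 1) m)

theorem backwardOp_tail (U : (ℕ → ℝ) → ℕ → ℝ) {G : ℕ → ℕ → ℝ} (φ : ℕ → ℝ) :
    ∀ m s, (∀ k, s ≤ k → G k = 1) → backwardOp U G φ s m = U^[m] φ := by
  intro m
  induction m with
  | zero => intro s hs; rw [backwardOp, hs s le_rfl, one_mul]; rfl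
  | succ m ih =>
    intro s hs
    rw [backwardOp, ih (s + 1) (fun k h1 => hs k (by omega)), hs s le_rfl, one_mul,
      ← Function.iterate_succ_apply' U]

theorem backwardOp_congr (U : (ℕ → ℝ) → ℕ → ℝ) {G G' : ℕ → ℕ → ℝ} (φ : ℕ → ℝ) :
    ∀ m s, (∀ k, s ≤ k → G k = G' k) → backwardOp U G φ s m = backwardOp U G' φ s m := by
  intro m
  induction m with
  | zero => intro s hs; rw [backwardOp, backwardOp, hs s le_rfl]
  | succ m ih =>
    intro s hs
    rw [backwardOp, backwardOp, ih (s + 1) (fun k h1 => hs k (by omega)), hs s le_rfl]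

theorem backwardOp_mul_first (U : (ℕ → ℝ) → ℕ → ℝ) {G G' : ℕ → ℕ → ℝ} (φ g : ℕ → ℝ) (m s : ℕ)
    (h1 : ∀ k, s < k → G k = G' k) (h2 : G s = g * G' s) :
    backwardOp U G φ s m = g * backwardOp U G' φ s m := by
  rcases m with _ | m
  · rw [backwardOp, backwardOp, h2, mul_assoc]
  · rw [backwardOp, backwardOp, h2, backwardOp_congr U φ m (s + 1) (fun k hk => h1 k (by omega)),
      mul_assoc]

theorem backwardOp_skip (U : (ℕ → ℝ) → ℕ → ℝ) {G : ℕ → ℕ → ℝ} (φ : ℕ → ℝ) (m : ℕ) :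
    ∀ d s, (∀ k, s ≤ k → k < s + d → G k = 1) →
      backwardOp U G φ s (m + d) = U^[d] (backwardOp U G φ (s + d) m) := by
  intro d
  induction d with
  | zero => intro s _; rfl
  | succ d ih =>
    intro s hs
    rw [← add_assoc, backwardOp, ih (s + 1) (fun k h1 h2 => hs k (by omega) (by omega)),
      hs s le_rfl (by omega), one_mul, ← Function.iterate_succ_apply' U,
      show s + 1 + d = s + (d + 1) by ring]

/-- Evolution of a single particle with multiplications by `g i` at the times `σ i`, starting at
the time `s` with `r` multiplications left, the first of them being the `i`-th one, up to the
time `H`. -/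
def evolN (U : (ℕ → ℝ) → ℕ → ℝ) (H : ℕ) (σ : ℕ → ℕ) (g : ℕ → ℕ → ℝ) (φ : ℕ → ℝ) :
    ℕ → ℕ → ℕ → ℕ → ℝ
  | 0, s, _ => U^[H - s] φ
  | r + 1, s, i => U^[σ i - s] (g i * evolN U H σ g φ r (σ i) (i + 1))

/-- Only the times `σ i` matter in the backward recursion. Several `σ i` may coincide; their factors
are then multiplied. -/
theorem backwardOp_eq_evolN (U : (ℕ → ℝ) → ℕ → ℝ) (H : ℕ) {σ : ℕ → ℕ} (hσ : Monotone σ)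
    (g : ℕ → ℕ → ℝ) (φ : ℕ → ℝ) :
    ∀ r s i, s ≤ H → (∀ j < r, s ≤ σ (i + j) ∧ σ (i + j) ≤ H) →
      backwardOp U (fun k => ∏ j ∈ Finset.range r, if σ (i + j) = k then g (i + j) else 1) φ s
        (H - s) = evolN U H σ g φ r s i := by
  intro r
  induction r with
  | zero =>
    intro s i _ _
    rw [evolN, backwardOp_tail U φ]
    intro k _
    simp
  | succ r ih =>
    intro s i hs h
    have h0 := h 0 (by omega)
    rw [add_zero] at h0
    have e1 : H - s = (H - σ i) + (σ i - s) := by omega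
    have e2 : s + (σ i - s) = σ i := by omega
    rw [evolN, e1, backwardOp_skip U φ (H - σ i) (σ i - s) s, e2,
      ← ih (σ i) (i + 1) h0.2]
    · congr 1
      refine backwardOp_mul_first U φ (g i) _ _ ?_ ?_
      · intro k hk
        rw [Finset.prod_range_succ', add_zero, if_neg (by omega), mul_one]
        refine Finset.prod_congr rfl fun j _ => ?_
        rw [show i + (j + 1) = i + 1 + j by ring]
      · rw [Finset.prod_range_succ', add_zero, if_pos rfl, mul_comm]
        congr 1
        refine Finset.prod_congr rfl fun j _ => ?_
        rw [show i + (j + 1) = i + 1 + j by ring]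
    · intro j hj
      have := h (j + 1) (by omega)
      rw [show i + 1 + j = i + (j + 1) by ring]
      exact ⟨hσ (by omega), this.2⟩
    · intro k _ hk
      refine Finset.prod_eq_one fun j _ => ?_
      have := hσ (show i ≤ i + j by omega)
      rw [if_neg (by omega)]


/-! ### The Cauchy–Binet formula -/

/-- Injective tuples are the rearrangements of the increasing ones. -/
theorem sum_injective_eq {p n : ℕ} (f : (Fin p → Fin n) → ℝ)
    (hf : ∀ x, ¬ Function.Injective x → f x = 0) :
    ∑ x, f x = ∑ y : Conf p n, ∑ σ : Equiv.Perm (Fin p), f (y.1 ∘ σ) := by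
  classical
  rw [← Fintype.sum_prod_type' (f := fun (y : Conf p n) (σ : Equiv.Perm (Fin p)) => f (y.1 ∘ σ)),
    ← Finset.sum_filter_of_ne (p := Function.Injective) (fun x _ h => by
      by_contra hc; exact h (hf x hc))]
  symm
  refine Finset.sum_bij (fun z _ => z.1.1 ∘ z.2) ?_ ?_ ?_ ?_
  · intro z _
    simp only [Finset.mem_filter, Finset.mem_univ, true_and]
    exact z.1.2.injective.comp z.2.injective
  · rintro ⟨y, σ⟩ - ⟨y', σ'⟩ - h
    simp only at h
    have hr : Set.range y.1 = Set.range y'.1 := by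
      rw [← σ.surjective.range_comp y.1, h, σ'.surjective.range_comp y'.1]
    have hy : y = y' := Subtype.ext ((StrictMono.range_inj y.2 y'.2).1 hr)
    subst hy
    have : σ = σ' := by
      ext k
      exact congrArg Fin.val (y.2.injective (congrFun h k))
    rw [this]
  · intro x hx
    simp only [Finset.mem_filter, Finset.mem_univ, true_and] at hx
    refine ⟨⟨⟨x ∘ Tuple.sort x, (Tuple.monotone_sort x).strictMono_of_injective
      (hx.comp (Tuple.sort x).injective)⟩, (Tuple.sort x)⁻¹⟩, Finset.mem_univ _, ?_⟩
    funext k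
    simp
  · intro z _
    rfl

/-- The Cauchy–Binet formula for Slater determinants with a product weight. -/
theorem cauchyBinet {p n : ℕ} (w : ℕ → ℝ) (f g : Fin p → ℕ → ℝ) :
    ∑ x : Conf p n, slater f (fun k => x.1 k) * slater g (fun k => x.1 k) * ∏ k, w (x.1 k) =
      (Matrix.of fun a b : Fin p => ∑ v : Fin n, w v * f a v * g b v).det := by
  rw [← sum_prod_mul_slater (fun a v => w v * f a v) g, sum_injective_eq]
  · refine Finset.sum_congr rfl fun y _ => ?_
    have h1 : ∀ σ : Equiv.Perm (Fin p), slater g (fun k => ((y.1 ∘ σ) k : ℕ)) =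
        Equiv.Perm.sign σ * slater g (fun k => y.1 k) := fun σ =>
      Matrix.det_permute σ (Matrix.of fun k a : Fin p => g a (y.1 k))
    have h2 : slater f (fun k => (y.1 k : ℕ)) = ∑ σ : Equiv.Perm (Fin p),
        (Equiv.Perm.sign σ : ℝ) * ∏ a, f a (y.1 (σ a)) := by
      simp [slater, Matrix.det_apply']
    rw [h2, Finset.sum_mul, Finset.sum_mul]
    refine Finset.sum_congr rfl fun σ _ => ?_
    rw [h1, Finset.prod_mul_distrib, ← Equiv.prod_comp σ fun k => w (y.1 k)]
    simp only [Function.comp]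
    ring
  · intro x hx
    rw [slater_eq_zero g, mul_zero]
    intro h
    exact hx fun i j hij => h (congrArg Fin.val hij)

end

noncomputable section

/-! ### Finite-dimensional distributions of the chain -/

/-- The rescaled hole configuration. -/
def confPt {p N : ℕ} (x : Conf p (N + p)) (k : Fin p) : ℝ := (x.1 k : ℝ) / ((N : ℝ) + p - 1)

/-- The stationary distribution of the up-down chain on hole configurations. -/
def chainPi (p : ℕ) (z' w' : ℝ) (N : ℕ) (x : Conf p (N + p)) : ℝ :=
  zwMeasure p z' w' (confSig x)

/-- The up-down chain lives on the signatures in the box. -/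
theorem prelimitLaw_eq (p : ℕ) (z' w' : ℝ) (N : ℕ) {n : ℕ} (t : Fin n → ℝ≥0) :
    prelimitLaw p z' w' N t = ∑ τ : Fin (maxStep N t + 1) → Conf p (N + p),
      ENNReal.ofReal (pathWt (chainPi p z' w' N) (chainQ p z' w' N) τ) •
        Measure.dirac fun i => confPt (τ ⟨stepCount N (t i), stepCount_lt N t i⟩) := by
  ext s hs
  rw [prelimitLaw, Measure.sum_apply _ hs, Measure.finsetSum_apply,
    ← tsum_fintype (L := .unconditional _)]
  have hinj : Function.Injective fun (τ : Fin (maxStep N t + 1) → Conf p (N + p)) k =>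
      confSig (τ k) := fun τ τ' h => funext fun k => confSig_injective (congrFun h k)
  rw [← hinj.tsum_eq]
  · refine tsum_congr fun τ => ?_
    have h1 : ∀ x : Conf p (N + p), scaledParticle p (confSig x) = confPt x := fun x => by
      funext k
      rw [scaledParticle, particle_confSig, confPt]
    simp only [h1]
    rfl
  · intro τ hτ
    simp only [Function.mem_support, Measure.smul_apply, smul_eq_mul] at hτ
    have hτ' : pathProb p z' w' τ ≠ 0 := fun h0 => hτ (by simp [h0])
    have hbox : ∀ k, InBox p (τ k) := by
      intro k
      induction k using Fin.cases with
      | zero => exact inBox_of_zwMeasure_ne_zero (left_ne_zero_of_mul hτ')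
      | succ k =>
        exact inBox_of_pUpDown_ne_zero
          (Finset.prod_ne_zero_iff.1 (right_ne_zero_of_mul hτ') k (Finset.mem_univ k))
    choose σ hσ using fun k => exists_confSig (hbox k)
    exact ⟨σ, funext hσ⟩

variable {p : ℕ} {z' w' : ℝ}

theorem chainPi_nonneg (hz : (p : ℝ) - 1 < z') (hw : -1 < w') {N : ℕ} (x : Conf p (N + p)) :
    0 ≤ chainPi p z' w' N x := (zwMeasure_confSig_pos hz hw x).le

/-- Integrals over the finite-dimensional distributions as finite sums over trajectories of
configurations. -/
theorem integral_prelimitLaw (hz : (p : ℝ) - 1 < z') (hw : -1 < w') (N : ℕ) {n : ℕ}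
    (t : Fin n → ℝ≥0) (f : (Fin n → Fin p → ℝ) → ℝ) :
    ∫ y, f y ∂(prelimitLaw p z' w' N t) =
      ∑ τ : Fin (maxStep N t + 1) → Conf p (N + p),
        pathWt (chainPi p z' w' N) (chainQ p z' w' N) τ *
          f fun i => confPt (τ ⟨stepCount N (t i), stepCount_lt N t i⟩) := by
  rw [prelimitLaw_eq, integral_finsetSum_measure]
  · refine Finset.sum_congr rfl fun τ _ => ?_
    rw [integral_smul_measure, integral_dirac, ENNReal.toReal_ofReal
      (pathWt_nonneg (chainPi_nonneg hz hw) (chainQ_nonneg hz hw) τ), smul_eq_mul]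
  · intro τ _
    exact (integrable_dirac (by simp)).smul_measure ENNReal.ofReal_ne_top

/-- The normalized one-particle weight. -/
def hahnProb (a b : ℝ) (n x : ℕ) : ℝ := hahnWt a b n x / ∑ v : Fin n, hahnWt a b n v

/-- Iteration of `sum_chainQ_slater`: the backward recursion of the interacting chain is a Slater
determinant of one-particle backward recursions, divided by the Vandermonde determinant. -/
theorem backward_chain (hz : (p : ℝ) - 1 < z') (hw : -1 < w') (N : ℕ) (G : ℕ → ℕ → ℝ)
    (Φ : Fin p → ℕ → ℝ) {c : ℝ} (hc : c ≠ 0) (hΦ : ∀ x, slater Φ x = c * vdm x) (m : ℕ) :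
    ∀ (s : ℕ) (x : Conf p (N + p)),
      backward (chainQ p z' w' N) (fun k x => ∏ j, G k (x.1 j)) s m x =
        ((∏ i : Fin p, hahnEigen (z' - p) w' (N + p) i)⁻¹) ^ m *
          (slater (fun b => backwardOp (hahnOp (z' - p) w' (N + p)) G (Φ b) s m)
            (fun k => x.1 k) / vdm (fun k => x.1 k)) / c := by
  induction m with
  | zero =>
    intro s x
    have h1 := slater_mul (G s) Φ (fun k => (x.1 k : ℕ))
    have h2 := (vdm_pos (x := fun k => (x.1 k : ℕ)) x.2).ne'
    change (∏ j, G s (x.1 j)) = _ * (slater (fun a v => G s v * Φ a v) (fun k => (x.1 k : ℕ)) / _) / c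
    rw [h1, hΦ]
    field_simp
  | succ m ih =>
    intro s x
    have h1 := slater_mul (G s) (fun b => hahnOp (z' - p) w' (N + p)
      (backwardOp (hahnOp (z' - p) w' (N + p)) G (Φ b) (s + 1) m)) (fun k => (x.1 k : ℕ))
    have h3 := sum_chainQ_slater hz hw
      (fun b => backwardOp (hahnOp (z' - p) w' (N + p)) G (Φ b) (s + 1) m) x
    change _ = _ * (slater (fun b v => G s v * hahnOp (z' - p) w' (N + p)
      (backwardOp (hahnOp (z' - p) w' (N + p)) G (Φ b) (s + 1) m) v)
        (fun k => (x.1 k : ℕ)) / _) / c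
    rw [h1, backward]
    simp only [ih, mul_div_assoc]
    have h4 : ∀ y, chainQ p z' w' N x y *
        (((∏ i : Fin p, hahnEigen (z' - p) w' (N + p) i)⁻¹) ^ m *
          (slater (fun b => backwardOp (hahnOp (z' - p) w' (N + p)) G (Φ b) (s + 1) m)
            (fun k => y.1 k) / vdm (fun k => (y.1 k : ℕ)) / c)) =
        (chainQ p z' w' N x y *
          (slater (fun b => backwardOp (hahnOp (z' - p) w' (N + p)) G (Φ b) (s + 1) m)
            (fun k => y.1 k) / vdm (fun k => (y.1 k : ℕ)))) *
        (((∏ i : Fin p, hahnEigen (z' - p) w' (N + p) i)⁻¹) ^ m / c) := fun y => by ring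
    rw [Finset.sum_congr rfl fun y _ => h4 y, ← Finset.sum_mul, h3]
    ring

/-- Multiplicative statistics of the stationary up-down chain are `p × p` determinants. -/
theorem sum_pathWt_chain (hz : (p : ℝ) - 1 < z') (hw : -1 < w') (N : ℕ) (G : ℕ → ℕ → ℝ)
    (Φ : Fin p → ℕ → ℝ) {c : ℝ} (hc : c ≠ 0) (hΦ : ∀ x, slater Φ x = c * vdm x) (m : ℕ) :
    ∑ τ : Fin (m + 1) → Conf p (N + p), pathWt (chainPi p z' w' N) (chainQ p z' w' N) τ *
        ∏ k : Fin (m + 1), ∏ j, G k ((τ k).1 j) =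
      ((∏ i : Fin p, hahnEigen (z' - p) w' (N + p) i)⁻¹) ^ m *
        ((Matrix.of fun a b : Fin p => ∑ v : Fin (N + p), hahnProb (z' - p) w' (N + p) v *
          Φ a v * backwardOp (hahnOp (z' - p) w' (N + p)) G (Φ b) 0 m v).det /
        (Matrix.of fun a b : Fin p => ∑ v : Fin (N + p), hahnProb (z' - p) w' (N + p) v *
          Φ a v * Φ b v).det) := by
  have h0 := sum_pathWt_prod (chainQ p z' w' N) (fun k x => ∏ j, G k (x.1 j)) m 0
    (chainPi p z' w' N)
  simp only [zero_add] at h0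
  rw [h0]
  simp only [backward_chain hz hw N G Φ hc hΦ]
  rw [← cauchyBinet, ← cauchyBinet]
  have ha : -1 < z' - p := by linarith
  have hZ := (confZ_pos ha hw (show p ≤ N + p by omega)).ne'
  set T := ∑ v : Fin (N + p), hahnWt (z' - p) w' (N + p) v with hT
  have hTp : T ^ p ≠ 0 := by
    by_cases hp : p = 0
    · simp [hp]
    · have : Nonempty (Fin (N + p)) := ⟨⟨0, by omega⟩⟩
      exact pow_ne_zero _ (Finset.sum_pos (fun v _ => hahnWt_pos ha hw v.2)
        Finset.univ_nonempty).ne'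
  have hprod : ∀ x : Conf p (N + p), ∏ k, hahnProb (z' - p) w' (N + p) (x.1 k) =
      (∏ k, hahnWt (z' - p) w' (N + p) (x.1 k)) / T ^ p := by
    intro x
    simp only [hahnProb, Finset.prod_div_distrib, Finset.prod_const, Finset.card_univ,
      Fintype.card_fin, ← hT]
  have hden : ∑ x : Conf p (N + p), slater Φ (fun k => x.1 k) * slater Φ (fun k => x.1 k) *
      ∏ k, hahnProb (z' - p) w' (N + p) (x.1 k) = c ^ 2 * confZ (z' - p) w' p (N + p) / T ^ p := by
    rw [confZ, Finset.mul_sum, Finset.sum_div]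
    refine Finset.sum_congr rfl fun x _ => ?_
    rw [hprod, hΦ, confWt]
    ring
  rw [hden, Finset.sum_div, Finset.mul_sum]
  refine Finset.sum_congr rfl fun x _ => ?_
  have h2 := (vdm_pos (x := fun k => (x.1 k : ℕ)) x.2).ne'
  rw [hprod, hΦ, chainPi, zwMeasure_confSig hz hw, confWt]
  field_simp

end

noncomputable section

/-! ### Jacobi polynomials -/

section Jacobi

open Polynomial

/-- The coefficient of `(1 - x)^j` in the Jacobi polynomial of degree `k`. -/
def jacCoeff (a b : ℝ) (k j : ℕ) : ℝ :=
  (ascPochhammer ℝ k).eval (a + 1) / (k.factorial : ℝ) *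
    ((j.factorial : ℝ)⁻¹ * (ascPochhammer ℝ j).eval (-(k : ℝ)) *
      (ascPochhammer ℝ j).eval ((k : ℝ) + a + b + 1) * ((ascPochhammer ℝ j).eval (a + 1))⁻¹)

/-- The Jacobi polynomial as a polynomial. -/
def jacP (a b : ℝ) (k : ℕ) : ℝ[X] :=
  ∑ j ∈ Finset.range (k + 1), C (jacCoeff a b k j) * (1 - X) ^ j

theorem jacobiPoly_eq_eval (a b : ℝ) (k : ℕ) (x : ℝ) :
    jacobiPoly k a b x = (jacP a b k).eval x := by
  rw [jacobiPoly, ordinaryHypergeometric_eq_tsum, jacP, eval_finsetSum]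
  simp only [eval_mul, eval_C, eval_pow, eval_sub, eval_one, eval_X]
  rw [tsum_eq_sum (s := Finset.range (k + 1)), Finset.mul_sum]
  · refine Finset.sum_congr rfl fun j _ => ?_
    rw [jacCoeff, smul_eq_mul]
    ring
  · intro j hj
    rw [ascPochhammer_eval_neg_coe_nat_of_lt (by simpa using hj)]
    simp

/-- The Jacobi differential operator on polynomials. -/
def jacD (a b : ℝ) : ℝ[X] →ₗ[ℝ] ℝ[X] where
  toFun f := -(X * (1 - X) * derivative (derivative f) +
    (C (b + 1) * (1 - X) - C (a + 1) * X) * derivative f)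
  map_add' f g := by simp only [derivative_add]; ring
  map_smul' c f := by
    simp only [smul_eq_C_mul, derivative_C_mul, RingHom.id_apply]; ring

theorem jacD_apply (a b : ℝ) (f : ℝ[X]) : jacD a b f =
    -(X * (1 - X) * derivative (derivative f) +
      (C (b + 1) * (1 - X) - C (a + 1) * X) * derivative f) := rfl

theorem derivative_one_sub_X_pow (j : ℕ) :
    derivative ((1 - X : ℝ[X]) ^ j) = -(C (j : ℝ) * (1 - X) ^ (j - 1)) := by
  rw [derivative_pow]
  simp

/-- The Jacobi operator is triangular in the powers of `1 - x`. -/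
theorem jacD_one_sub_X_pow (a b : ℝ) (j : ℕ) : jacD a b ((1 - X) ^ j) =
    C ((j : ℝ) * (j + a + b + 1)) * (1 - X) ^ j - C ((j : ℝ) * (j + a)) * (1 - X) ^ (j - 1) := by
  rw [jacD_apply, derivative_one_sub_X_pow]
  rcases j with _ | _ | j
  · simp
  · simp
    ring
  · rw [derivative_neg, derivative_C_mul, derivative_one_sub_X_pow]
    simp only [add_tsub_cancel_right, Nat.cast_add, Nat.cast_one, map_add, map_one, map_mul]
    ring

/-- The two-term recurrence of the hypergeometric coefficients. -/
theorem jacCoeff_succ {a : ℝ} (ha : -1 < a) (b : ℝ) (k j : ℕ) :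
    jacCoeff a b k (j + 1) * ((j + 1) * (j + 1 + a)) =
      jacCoeff a b k j * ((j - k) * (k + a + b + 1 + j)) := by
  have h1 := (ascPochhammer_pos j (a + 1) (by linarith)).ne'
  have h2 : a + 1 + j ≠ 0 := by
    intro h; linarith
  have h3 : (j.factorial : ℝ) ≠ 0 := by positivity
  have h4 : (k.factorial : ℝ) ≠ 0 := by positivity
  have h5 : (j : ℝ) + 1 ≠ 0 := by positivity
  simp only [jacCoeff, ascPochhammer_succ_eval, Nat.factorial_succ]
  push_cast
  field_simp
  ring

/-- The Jacobi polynomials are eigenfunctions of the Jacobi operator. -/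
theorem jacD_jacP {a : ℝ} (ha : -1 < a) (b : ℝ) (k : ℕ) :
    jacD a b (jacP a b k) = C ((k : ℝ) * (k + a + b + 1)) * jacP a b k := by
  have h1 : jacD a b (jacP a b k) =
      ∑ j ∈ Finset.range (k + 1), C (jacCoeff a b k j * ((j : ℝ) * (j + a + b + 1))) * (1 - X) ^ j -
      ∑ j ∈ Finset.range (k + 1), C (jacCoeff a b k j * ((j : ℝ) * (j + a))) * (1 - X) ^ (j - 1) := by
    rw [jacP, map_sum, ← Finset.sum_sub_distrib]
    refine Finset.sum_congr rfl fun j _ => ?_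
    rw [← smul_eq_C_mul, map_smul, jacD_one_sub_X_pow, smul_eq_C_mul, mul_sub,
      ← mul_assoc, ← mul_assoc, ← C_mul, ← C_mul]
  have h2 : ∑ j ∈ Finset.range (k + 1),
      C (jacCoeff a b k j * ((j : ℝ) * (j + a))) * (1 - X : ℝ[X]) ^ (j - 1) =
      ∑ j ∈ Finset.range (k + 1), C (jacCoeff a b k j * ((j - k) * (k + a + b + 1 + j))) *
        (1 - X) ^ j := by
    rw [Finset.sum_range_succ', Finset.sum_range_succ (n := k)]
    simp only [Nat.cast_zero, zero_mul, mul_zero, C_0, add_zero, sub_self]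
    refine Finset.sum_congr rfl fun j _ => ?_
    rw [← jacCoeff_succ ha, add_tsub_cancel_right]
    push_cast
    rfl
  rw [h1, h2, jacP, ← Finset.sum_sub_distrib, Finset.mul_sum]
  refine Finset.sum_congr rfl fun j _ => ?_
  rw [← sub_mul, ← C_sub, ← mul_assoc (C ((k : ℝ) * (k + a + b + 1))), ← C_mul]
  congr 2
  ring

theorem natDegree_jacP_le (a b : ℝ) (k : ℕ) : (jacP a b k).natDegree ≤ k := by
  refine natDegree_sum_le_of_forall_le _ _ fun j hj => ?_
  refine (natDegree_C_mul_le _ _).trans (natDegree_pow_le.trans ?_)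
  have : (1 - X : ℝ[X]).natDegree = 1 := by
    rw [← natDegree_neg, neg_sub, ← C_1, natDegree_X_sub_C]
  rw [this, mul_one]
  exact Nat.lt_succ_iff.1 (Finset.mem_range.1 hj)

theorem jacCoeff_self_ne_zero {a b : ℝ} (ha : -1 < a) (hb : -1 < b) (k : ℕ) :
    jacCoeff a b k k ≠ 0 := by
  have h1 := (ascPochhammer_pos k (a + 1) (by linarith)).ne'
  have h2 : (ascPochhammer ℝ k).eval ((k : ℝ) + a + b + 1) ≠ 0 := by
    rcases k with _ | k
    · simp
    · refine (ascPochhammer_pos _ _ ?_).ne'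
      push_cast
      linarith
  have h3 : (ascPochhammer ℝ k).eval (-(k : ℝ)) ≠ 0 := by
    intro h
    obtain ⟨i, hi, h⟩ := (ascPochhammer_eval_eq_zero_iff k _).1 h
    rw [neg_neg] at h
    exact hi.ne (by exact_mod_cast h)
  unfold jacCoeff
  positivity

theorem coeff_jacP_ne_zero {a b : ℝ} (ha : -1 < a) (hb : -1 < b) (k : ℕ) :
    (jacP a b k).coeff k ≠ 0 := by
  rw [jacP, finsetSum_coeff, Finset.sum_range_succ, Finset.sum_eq_zero, zero_add, coeff_C_mul]
  · refine mul_ne_zero (jacCoeff_self_ne_zero ha hb k) ?_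
    have h : (1 - X : ℝ[X]) ^ k = C ((-1) ^ k) * (X - C 1) ^ k := by
      rw [C_pow, ← mul_pow, C_neg, C_1]
      congr 1
      ring
    have h2 := (monic_X_sub_C (1 : ℝ)).pow k
    have h3 := h2.coeff_natDegree
    rw [natDegree_pow, natDegree_X_sub_C, mul_one] at h3
    rw [h, coeff_C_mul, h3, mul_one]
    exact pow_ne_zero _ (by norm_num)
  · intro j hj
    refine coeff_eq_zero_of_natDegree_lt ((natDegree_C_mul_le _ _).trans_lt
      (natDegree_pow_le.trans_lt ?_))
    have : (1 - X : ℝ[X]).natDegree = 1 := by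
      rw [← natDegree_neg, neg_sub, ← C_1, natDegree_X_sub_C]
    rw [this, mul_one]
    exact Finset.mem_range.1 hj

theorem ascPochhammer_eval_succ_left (n : ℕ) (r : ℝ) :
    (ascPochhammer ℝ (n + 1)).eval r = r * (ascPochhammer ℝ n).eval (r + 1) := by
  rw [ascPochhammer_succ_left, eval_mul, eval_X, eval_comp, eval_add, eval_X, eval_one]

/-- Differentiation shifts the parameters of the Jacobi polynomials. -/
theorem derivative_jacP {a : ℝ} (ha : -1 < a) (b : ℝ) (k : ℕ) :
    derivative (jacP a b (k + 1)) = C ((k : ℝ) + a + b + 2) * jacP (a + 1) (b + 1) k := by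
  rw [jacP, derivative_sum, Finset.sum_range_succ', jacP, Finset.mul_sum]
  simp only [derivative_C_mul, pow_zero, derivative_one, mul_zero, add_zero]
  refine Finset.sum_congr rfl fun j _ => ?_
  rw [derivative_one_sub_X_pow, add_tsub_cancel_right, mul_neg, ← mul_assoc, ← mul_assoc,
    ← neg_mul, ← C_mul, ← C_mul, ← C_neg]
  congr 2
  have h1 := (ascPochhammer_pos j (a + 1 + 1) (by linarith)).ne'
  have h2 : a + 1 ≠ 0 := by linarith
  have h3 : (j.factorial : ℝ) ≠ 0 := by positivity
  have h4 : (k.factorial : ℝ) ≠ 0 := by positivity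
  have h5 : (j : ℝ) + 1 ≠ 0 := by positivity
  have h6 : (k : ℝ) + 1 ≠ 0 := by positivity
  simp only [jacCoeff, ascPochhammer_eval_succ_left, Nat.factorial_succ]
  have e1 : -((k + 1 : ℕ) : ℝ) + 1 = -(k : ℝ) := by push_cast; ring
  have e2 : ((k + 1 : ℕ) : ℝ) + a + b + 1 + 1 = (k : ℝ) + (a + 1) + (b + 1) + 1 := by
    push_cast; ring
  rw [e1, e2]
  push_cast
  field_simp
  ring

/-! ### Orthogonality of the Jacobi polynomials -/

/-- The weight function of the Jacobi polynomials on `(0,1)`. -/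
def jacW (a b x : ℝ) : ℝ := x ^ b * (1 - x) ^ a

theorem jacW_pos (a b : ℝ) {x : ℝ} (hx : x ∈ Set.Ioo (0 : ℝ) 1) : 0 < jacW a b x :=
  mul_pos (Real.rpow_pos_of_pos hx.1 _) (Real.rpow_pos_of_pos (by linarith [hx.2]) _)

theorem jacW_add_one (a b : ℝ) {x : ℝ} (hx : x ∈ Set.Ioo (0 : ℝ) 1) :
    jacW (a + 1) (b + 1) x = x * (1 - x) * jacW a b x := by
  have h1 : 0 < 1 - x := by linarith [hx.2]
  rw [jacW, jacW, Real.rpow_add_one hx.1.ne', Real.rpow_add_one h1.ne']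
  ring

theorem integrableOn_jacW {a b : ℝ} (ha : -1 < a) (hb : -1 < b) :
    IntegrableOn (jacW a b) (Set.Ioo 0 1) := by
  have h := Complex.betaIntegral_convergent (u := ((b + 1 : ℝ) : ℂ)) (v := ((a + 1 : ℝ) : ℂ))
    (by rw [Complex.ofReal_re]; linarith) (by rw [Complex.ofReal_re]; linarith)
  rw [intervalIntegrable_iff_integrableOn_Ioo_of_le zero_le_one] at h
  refine (IntegrableOn.congr_fun h.norm (fun x hx => ?_) measurableSet_Ioo)
  have h1 : 0 < 1 - x := by linarith [hx.2]
  have e1 : ((b + 1 : ℝ) : ℂ) - 1 = (b : ℂ) := by push_cast; ring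
  have e2 : ((a + 1 : ℝ) : ℂ) - 1 = (a : ℂ) := by push_cast; ring
  have e3 : (1 : ℂ) - (x : ℂ) = ((1 - x : ℝ) : ℂ) := by push_cast; ring
  simp only [e1, e2, e3, norm_mul]
  rw [Complex.norm_cpow_eq_rpow_re_of_pos hx.1, Complex.norm_cpow_eq_rpow_re_of_pos h1]
  simp [jacW]

theorem integrableOn_mul_jacW {a b : ℝ} (ha : -1 < a) (hb : -1 < b) {f : ℝ → ℝ}
    (hf : Continuous f) : IntegrableOn (fun x => f x * jacW a b x) (Set.Ioo 0 1) := by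
  obtain ⟨M, hM⟩ := isCompact_Icc.exists_bound_of_continuousOn (s := Set.Icc (0 : ℝ) 1)
    hf.continuousOn
  refine Integrable.bdd_mul (c := M) (integrableOn_jacW ha hb) hf.aestronglyMeasurable ?_
  filter_upwards [ae_restrict_mem measurableSet_Ioo] with x hx
  exact hM x ⟨hx.1.le, hx.2.le⟩

/-- Integration by parts: the Jacobi operator is symmetric and comes from a Dirichlet form. -/
theorem integral_jacD_mul {a b : ℝ} (ha : -1 < a) (hb : -1 < b) (f g : ℝ[X]) :
    ∫ x in Set.Ioo (0 : ℝ) 1, (jacD a b f).eval x * g.eval x * jacW a b x =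
      ∫ x in Set.Ioo (0 : ℝ) 1, (derivative f).eval x * (derivative g).eval x *
        jacW (a + 1) (b + 1) x := by
  let F' : ℝ → ℝ := fun x => (derivative f).eval x * (derivative g).eval x *
      (x * (1 - x)) * jacW a b x - (jacD a b f).eval x * g.eval x * jacW a b x
  have hi1 : IntegrableOn (fun x => (jacD a b f).eval x * g.eval x * jacW a b x)
      (Set.Ioo 0 1) := integrableOn_mul_jacW ha hb (f := fun x => (jacD a b f).eval x * g.eval x)
        (by fun_prop)
  have hi2 : IntegrableOn (fun x => (derivative f).eval x * (derivative g).eval x *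
      (x * (1 - x)) * jacW a b x) (Set.Ioo 0 1) :=
    integrableOn_mul_jacW ha hb (f := fun x => (derivative f).eval x * (derivative g).eval x *
      (x * (1 - x))) (by fun_prop)
  have hderiv : ∀ x ∈ Set.Ioo (0 : ℝ) 1, HasDerivAt
      (fun x => x ^ (b + 1) * (1 - x) ^ (a + 1) * ((derivative f).eval x * g.eval x)) (F' x) x := by
    intro x hx
    have h1 : 0 < 1 - x := by linarith [hx.2]
    have d1 : HasDerivAt (fun x : ℝ => x ^ (b + 1)) ((b + 1) * x ^ b) x := by
      simpa using Real.hasDerivAt_rpow_const (p := b + 1) (Or.inl hx.1.ne')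
    have d2 : HasDerivAt (fun x : ℝ => (1 - x) ^ (a + 1)) (-((a + 1) * (1 - x) ^ a)) x := by
      have h2 : HasDerivAt (fun x : ℝ => 1 - x) (-1) x := by
        simpa using (hasDerivAt_id x).const_sub 1
      have := h2.rpow_const (p := a + 1) (Or.inl h1.ne')
      convert this using 1
      rw [add_sub_cancel_right]
      ring
    have d3 := ((derivative f).hasDerivAt x).mul (g.hasDerivAt x)
    refine ((d1.mul d2).mul d3).congr_deriv ?_
    simp only [F', jacD_apply, jacW, eval_neg, eval_add, eval_mul, eval_sub, eval_X, eval_one,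
      eval_C, Pi.mul_apply, Real.rpow_add_one hx.1.ne', Real.rpow_add_one h1.ne']
    ring
  have hcont : ContinuousOn
      (fun x : ℝ => x ^ (b + 1) * (1 - x) ^ (a + 1) * ((derivative f).eval x * g.eval x))
      (Set.Icc 0 1) := by
    refine Continuous.continuousOn ?_
    have c1 : Continuous fun x : ℝ => x ^ (b + 1) :=
      Real.continuous_rpow_const (by linarith)
    have c2 : Continuous fun x : ℝ => (1 - x) ^ (a + 1) :=
      (Real.continuous_rpow_const (by linarith)).comp (by fun_prop)
    fun_prop
  have hint := intervalIntegral.integral_eq_sub_of_hasDerivAt_of_le zero_le_one hcont hderiv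
    ((intervalIntegrable_iff_integrableOn_Ioo_of_le zero_le_one).2 (hi2.sub hi1))
  rw [Real.zero_rpow (by linarith), sub_self, Real.zero_rpow (by linarith),
    intervalIntegral.integral_of_le zero_le_one, integral_Ioc_eq_integral_Ioo] at hint
  simp only [F'] at hint
  rw [integral_sub hi2 hi1] at hint
  have h3 : ∫ x in Set.Ioo (0 : ℝ) 1, (derivative f).eval x * (derivative g).eval x *
        jacW (a + 1) (b + 1) x = ∫ x in Set.Ioo (0 : ℝ) 1,
        (derivative f).eval x * (derivative g).eval x * (x * (1 - x)) * jacW a b x := by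
    refine setIntegral_congr_fun measurableSet_Ioo fun x hx => ?_
    simp only [jacW_add_one a b hx]
    ring
  rw [h3]
  linarith

theorem jacEigen_lt {a b : ℝ} (ha : -1 < a) (hb : -1 < b) {i j : ℕ} (hij : i < j) :
    (i : ℝ) * (i + a + b + 1) < j * (j + a + b + 1) := by
  have h1 : (i : ℝ) + 1 ≤ j := by exact_mod_cast hij
  nlinarith

/-- Orthogonality: eigenfunctions of a symmetric operator with distinct eigenvalues. -/
theorem integral_jacP_mul_jacP {a b : ℝ} (ha : -1 < a) (hb : -1 < b) {i j : ℕ} (hij : i ≠ j) :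
    ∫ x in Set.Ioo (0 : ℝ) 1, (jacP a b i).eval x * (jacP a b j).eval x * jacW a b x = 0 := by
  have key : ∀ i j : ℕ, ∫ x in Set.Ioo (0 : ℝ) 1, (jacD a b (jacP a b i)).eval x *
      (jacP a b j).eval x * jacW a b x = (i : ℝ) * (i + a + b + 1) *
      ∫ x in Set.Ioo (0 : ℝ) 1, (jacP a b i).eval x * (jacP a b j).eval x * jacW a b x := by
    intro i j
    rw [← integral_const_mul]
    refine integral_congr_ae (.of_forall fun x => ?_)
    simp only [jacD_jacP ha, eval_mul, eval_C]
    ring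
  have h1 := key i j
  have h2 := key j i
  have e1 : ∀ f g : ℝ[X], ∫ x in Set.Ioo (0 : ℝ) 1, f.eval x * g.eval x * jacW (a + 1) (b + 1) x =
      ∫ x in Set.Ioo (0 : ℝ) 1, g.eval x * f.eval x * jacW (a + 1) (b + 1) x := fun f g =>
    integral_congr_ae (.of_forall fun x => by simp only; ring)
  have e2 : ∫ x in Set.Ioo (0 : ℝ) 1, (jacP a b j).eval x * (jacP a b i).eval x * jacW a b x =
      ∫ x in Set.Ioo (0 : ℝ) 1, (jacP a b i).eval x * (jacP a b j).eval x * jacW a b x :=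
    integral_congr_ae (.of_forall fun x => by simp only; ring)
  rw [integral_jacD_mul ha hb] at h1 h2
  rw [e1, h1, e2] at h2
  have hne : (i : ℝ) * (i + a + b + 1) ≠ j * (j + a + b + 1) := by
    rcases lt_or_gt_of_ne hij with h | h
    · exact (jacEigen_lt ha hb h).ne
    · exact (jacEigen_lt ha hb h).ne'
  by_contra h0
  exact hne (mul_right_cancel₀ h0 h2)

/-- The squared norm of a Jacobi polynomial. -/
def jacH (a b : ℝ) (k : ℕ) : ℝ :=
  ∫ x in Set.Ioo (0 : ℝ) 1, (jacP a b k).eval x ^ 2 * jacW a b x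

theorem jacP_zero (a b : ℝ) : jacP a b 0 = 1 := by
  simp [jacP, jacCoeff]

theorem jacH_zero (a b : ℝ) : jacH a b 0 = ∫ x in Set.Ioo (0 : ℝ) 1, jacW a b x := by
  simp [jacH, jacP_zero]

/-- The recursion of the squared norms, from integration by parts and `derivative_jacP`. -/
theorem jacH_succ {a b : ℝ} (ha : -1 < a) (hb : -1 < b) (k : ℕ) :
    jacH a b (k + 1) = (k + a + b + 2) / (k + 1) * jacH (a + 1) (b + 1) k := by
  have h := integral_jacD_mul ha hb (jacP a b (k + 1)) (jacP a b (k + 1))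
  have h1 : ∫ x in Set.Ioo (0 : ℝ) 1, (jacD a b (jacP a b (k + 1))).eval x *
      (jacP a b (k + 1)).eval x * jacW a b x = (k + 1) * (k + a + b + 2) * jacH a b (k + 1) := by
    rw [jacH, ← integral_const_mul]
    refine integral_congr_ae (.of_forall fun x => ?_)
    simp only [jacD_jacP ha, eval_mul, eval_C]
    push_cast
    ring
  have h2 : ∫ x in Set.Ioo (0 : ℝ) 1, (derivative (jacP a b (k + 1))).eval x *
      (derivative (jacP a b (k + 1))).eval x * jacW (a + 1) (b + 1) x =
      (k + a + b + 2) ^ 2 * jacH (a + 1) (b + 1) k := by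
    rw [jacH, ← integral_const_mul]
    refine integral_congr_ae (.of_forall fun x => ?_)
    simp only [derivative_jacP ha, eval_mul, eval_C]
    ring
  rw [h1, h2] at h
  have h4 : (k : ℝ) + a + b + 2 ≠ 0 := by linarith
  have h5 : (k : ℝ) + 1 ≠ 0 := by positivity
  have h6 : (k + 1) * jacH a b (k + 1) = (k + a + b + 2) * jacH (a + 1) (b + 1) k :=
    mul_left_cancel₀ h4 (by linear_combination h)
  rw [div_mul_eq_mul_div, eq_div_iff h5, mul_comm, h6]

theorem setIntegral_jacW_pos {a b : ℝ} (ha : -1 < a) (hb : -1 < b) {s t : ℝ} (hs : 0 ≤ s)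
    (hst : s < t) (ht : t ≤ 1) : 0 < ∫ x in Set.Ioo s t, jacW a b x := by
  have hsub : Set.Ioo s t ⊆ Set.Ioo 0 1 := Set.Ioo_subset_Ioo hs ht
  rw [setIntegral_pos_iff_support_of_nonneg_ae]
  · have : Function.support (jacW a b) ∩ Set.Ioo s t = Set.Ioo s t :=
      Set.inter_eq_right.2 fun x hx => (jacW_pos a b (hsub hx)).ne'
    rw [this, Real.volume_Ioo]
    simpa using hst
  · filter_upwards [ae_restrict_mem measurableSet_Ioo] with x hx
    exact (jacW_pos a b (hsub hx)).le
  · exact (integrableOn_jacW ha hb).mono_set hsub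

theorem jacH_pos {a b : ℝ} (ha : -1 < a) (hb : -1 < b) (k : ℕ) : 0 < jacH a b k := by
  induction k generalizing a b with
  | zero => rw [jacH_zero]; exact setIntegral_jacW_pos ha hb le_rfl zero_lt_one le_rfl
  | succ k ih =>
    rw [jacH_succ ha hb]
    exact mul_pos (div_pos (by linarith) (by positivity)) (ih (by linarith) (by linarith))

end Jacobi

end

noncomputable section

/-! ### Growth of the normalized Jacobi polynomials -/

section Growth

open Polynomial

/-- A crude exponential bound, with `x ^ n / n! ≤ exp x` for the quotients of Pochhammer symbols and
factorials. -/
theorem jacCoeff_abs_le {a b : ℝ} (ha : -1 < a) {B : ℝ}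
    (hB : |a| + |b| + 1 ≤ B) {k j : ℕ} (hj : j ≤ k) :
    |jacCoeff a b k j| ≤ Real.exp (3 * k + B) := by
  have ha' := abs_le.1 (show |a| ≤ |a| from le_rfl)
  have hb' := abs_le.1 (show |b| ≤ |b| from le_rfl)
  have hk0 : (0 : ℝ) ≤ k := by positivity
  -- the three Pochhammer symbols are products of at most `k` factors
  have h1 : ∀ d : ℕ, j + d ≤ k → (ascPochhammer ℝ (j + d)).eval (a + 1) ≤
      (ascPochhammer ℝ j).eval (a + 1) * (2 * k + B) ^ d := by
    intro d
    induction d with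
    | zero => intro _; simp
    | succ d ih =>
      intro hd
      have hd' : ((j + d : ℕ) : ℝ) + 1 ≤ k := by exact_mod_cast hd
      have hp' := ascPochhammer_pos j (a + 1) (by linarith)
      rw [← add_assoc, ascPochhammer_succ_eval, pow_succ, ← mul_assoc]
      refine mul_le_mul (ih (by omega)) (by linarith) ?_ ?_
      · have : (0 : ℝ) ≤ ((j + d : ℕ) : ℝ) := by positivity
        linarith
      · have : 0 ≤ 2 * (k : ℝ) + B := by linarith
        positivity
  have h2 : ∀ i : ℕ, i ≤ k → |(ascPochhammer ℝ i).eval (-(k : ℝ))| ≤ (k : ℝ) ^ i := by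
    intro i
    induction i with
    | zero => intro _; simp
    | succ i ih =>
      intro hi
      have hi' : (i : ℝ) + 1 ≤ k := by exact_mod_cast hi
      rw [ascPochhammer_succ_eval, abs_mul, pow_succ]
      refine mul_le_mul (ih (by omega)) ?_ (abs_nonneg _) (by positivity)
      rw [abs_le]
      constructor <;> linarith
  have h3 : ∀ i : ℕ, i ≤ k → |(ascPochhammer ℝ i).eval ((k : ℝ) + a + b + 1)| ≤
      (2 * k + B) ^ i := by
    intro i
    induction i with
    | zero => intro _; simp
    | succ i ih =>
      intro hi
      have hi' : (i : ℝ) + 1 ≤ k := by exact_mod_cast hi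
      rw [ascPochhammer_succ_eval, abs_mul, pow_succ]
      have : 0 ≤ 2 * (k : ℝ) + B := by linarith
      refine mul_le_mul (ih (by omega)) ?_ (abs_nonneg _) (by positivity)
      rw [abs_le]
      constructor <;> linarith
  obtain ⟨d, rfl⟩ := Nat.exists_eq_add_of_le hj
  have hp := ascPochhammer_pos (j + d) (a + 1) (by linarith)
  have hp' := ascPochhammer_pos j (a + 1) (by linarith)
  have hnn : 0 ≤ 2 * ((j + d : ℕ) : ℝ) + B := by linarith
  have e1 : |jacCoeff a b (j + d) j| =
      ((ascPochhammer ℝ (j + d)).eval (a + 1) / (ascPochhammer ℝ j).eval (a + 1)) *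
      |(ascPochhammer ℝ j).eval (((j + d : ℕ) : ℝ) + a + b + 1)| / ((j + d).factorial : ℝ) *
      (|(ascPochhammer ℝ j).eval (-((j + d : ℕ) : ℝ))| / (j.factorial : ℝ)) := by
    rw [jacCoeff, abs_mul, abs_mul, abs_mul, abs_mul, abs_div, abs_inv, abs_inv, abs_of_pos hp,
      abs_of_pos hp', Nat.abs_cast, Nat.abs_cast]
    field_simp
  have e2 : (ascPochhammer ℝ (j + d)).eval (a + 1) / (ascPochhammer ℝ j).eval (a + 1) ≤
      (2 * ((j + d : ℕ) : ℝ) + B) ^ d := by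
    rw [div_le_iff₀ hp', mul_comm]
    exact h1 d le_rfl
  have e3 : (2 * ((j + d : ℕ) : ℝ) + B) ^ d * (2 * ((j + d : ℕ) : ℝ) + B) ^ j /
      ((j + d).factorial : ℝ) ≤ Real.exp (2 * ((j + d : ℕ) : ℝ) + B) := by
    rw [← pow_add, add_comm d j]
    exact Real.pow_div_factorial_le_exp _ hnn _
  have e4 : ((j + d : ℕ) : ℝ) ^ j / (j.factorial : ℝ) ≤ Real.exp ((j + d : ℕ) : ℝ) :=
    Real.pow_div_factorial_le_exp _ hk0 _
  have e5 : Real.exp (3 * ((j + d : ℕ) : ℝ) + B) =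
      Real.exp (2 * ((j + d : ℕ) : ℝ) + B) * Real.exp ((j + d : ℕ) : ℝ) := by
    rw [← Real.exp_add]; congr 1; ring
  rw [e1, e5]
  refine mul_le_mul (le_trans ?_ e3) (le_trans ?_ e4) (by positivity) (Real.exp_pos _).le
  · gcongr
    exact h3 j hj
  · gcongr
    exact h2 j hj

theorem jacP_abs_le {a : ℝ} (ha : -1 < a) (b : ℝ) (k : ℕ) {x : ℝ}
    (hx : x ∈ Set.Icc (0 : ℝ) 1) :
    |(jacP a b k).eval x| ≤ (k + 1) * Real.exp (3 * k + (|a| + |b| + 1)) := by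
  rw [jacP, eval_finsetSum]
  refine (Finset.abs_sum_le_sum_abs _ _).trans ?_
  have : ∀ j ∈ Finset.range (k + 1), |(C (jacCoeff a b k j) * (1 - X) ^ j).eval x| ≤
      Real.exp (3 * k + (|a| + |b| + 1)) := by
    intro j hj
    simp only [eval_mul, eval_C, eval_pow, eval_sub, eval_one, eval_X, abs_mul, abs_pow]
    have h1 : |1 - x| ^ j ≤ 1 := pow_le_one₀ (abs_nonneg _) (by
      rw [abs_le]; constructor <;> linarith [hx.1, hx.2])
    have h2 := jacCoeff_abs_le (b := b) ha le_rfl (Nat.lt_succ_iff.1 (Finset.mem_range.1 hj))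
    calc _ ≤ Real.exp (3 * k + (|a| + |b| + 1)) * 1 :=
          mul_le_mul h2 h1 (by positivity) (Real.exp_pos _).le
      _ = _ := mul_one _
  refine (Finset.sum_le_sum this).trans ?_
  simp

/-- For positive parameters the factor in `jacH_succ` is at least `1`, so that the norm of a Jacobi
polynomial is bounded below by a norm in degree zero. -/
theorem jacH_zero_le {a b : ℝ} (ha : 0 < a) (hb : 0 < b) (k : ℕ) :
    jacH (a + k) (b + k) 0 ≤ jacH a b k := by
  induction k generalizing a b with
  | zero => simp
  | succ k ih =>
    rw [jacH_succ (by linarith) (by linarith)]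
    have h1 := ih (a := a + 1) (b := b + 1) (by linarith) (by linarith)
    have e1 : a + ((k + 1 : ℕ) : ℝ) = a + 1 + k := by push_cast; ring
    have e2 : b + ((k + 1 : ℕ) : ℝ) = b + 1 + k := by push_cast; ring
    rw [e1, e2]
    refine h1.trans ?_
    have h2 := jacH_pos (a := a + 1) (b := b + 1) (by linarith) (by linarith) k
    refine le_mul_of_one_le_left h2.le ?_
    rw [one_le_div (by positivity)]
    linarith

/-- The squared norm in degree zero decays at most exponentially, because `x (1 - x) ≥ 3 / 16` on
`(1/4, 3/4)`. -/
theorem jacH_zero_lower {a b : ℝ} (ha : -1 < a) (hb : -1 < b) (k : ℕ) :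
    (3 / 16) ^ k * ∫ x in Set.Ioo (1 / 4 : ℝ) (3 / 4), jacW a b x ≤ jacH (a + k) (b + k) 0 := by
  have hsub : Set.Ioo (1 / 4 : ℝ) (3 / 4) ⊆ Set.Ioo 0 1 :=
    Set.Ioo_subset_Ioo (by norm_num) (by norm_num)
  have hi := integrableOn_jacW (a := a + k) (b := b + k) (by linarith) (by linarith)
  rw [jacH_zero]
  refine le_trans ?_ (setIntegral_mono_set hi ?_ hsub.eventuallyLE)
  · rw [← integral_const_mul]
    refine setIntegral_mono_on (((integrableOn_jacW ha hb).mono_set hsub).const_mul _)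
      (hi.mono_set hsub) measurableSet_Ioo fun x hx => ?_
    have hx' := hsub hx
    have h1 : 0 < 1 - x := by linarith [hx'.2]
    have h2 : jacW (a + k) (b + k) x = (x * (1 - x)) ^ k * jacW a b x := by
      rw [jacW, jacW, Real.rpow_add_natCast hx'.1.ne', Real.rpow_add_natCast h1.ne', mul_pow]
      ring
    rw [h2]
    refine mul_le_mul_of_nonneg_right ?_ (jacW_pos a b hx').le
    refine pow_le_pow_left₀ (by norm_num) ?_ _
    nlinarith [hx.1, hx.2]
  · filter_upwards [ae_restrict_mem measurableSet_Ioo] with x hx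
    exact (jacW_pos _ _ hx).le

/-- The orthonormal Jacobi polynomials. -/
def jacN (a b : ℝ) (k : ℕ) : ℝ[X] := C (√(jacH a b k))⁻¹ * jacP a b k

theorem natDegree_jacN_le (a b : ℝ) (k : ℕ) : (jacN a b k).natDegree ≤ k :=
  (natDegree_C_mul_le _ _).trans (natDegree_jacP_le a b k)

theorem coeff_jacN_ne_zero {a b : ℝ} (ha : -1 < a) (hb : -1 < b) (k : ℕ) :
    (jacN a b k).coeff k ≠ 0 := by
  rw [jacN, coeff_C_mul]
  exact mul_ne_zero (inv_ne_zero (Real.sqrt_pos.2 (jacH_pos ha hb k)).ne')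
    (coeff_jacP_ne_zero ha hb k)

theorem jacD_jacN {a : ℝ} (ha : -1 < a) (b : ℝ) (k : ℕ) :
    jacD a b (jacN a b k) = C ((k : ℝ) * (k + a + b + 1)) * jacN a b k := by
  rw [jacN, ← smul_eq_C_mul, map_smul, jacD_jacP ha, mul_smul_comm]

theorem integral_jacN_mul_jacN {a b : ℝ} (ha : -1 < a) (hb : -1 < b) (i j : ℕ) :
    ∫ x in Set.Ioo (0 : ℝ) 1, (jacN a b i).eval x * (jacN a b j).eval x * jacW a b x =
      if i = j then 1 else 0 := by
  have h1 : ∫ x in Set.Ioo (0 : ℝ) 1, (jacN a b i).eval x * (jacN a b j).eval x * jacW a b x =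
      (√(jacH a b i))⁻¹ * (√(jacH a b j))⁻¹ *
      ∫ x in Set.Ioo (0 : ℝ) 1, (jacP a b i).eval x * (jacP a b j).eval x * jacW a b x := by
    rw [← integral_const_mul]
    refine integral_congr_ae (.of_forall fun x => ?_)
    simp only [jacN, eval_mul, eval_C]
    ring
  rw [h1]
  split_ifs with h
  · subst h
    have h2 : ∫ x in Set.Ioo (0 : ℝ) 1, (jacP a b i).eval x * (jacP a b i).eval x * jacW a b x =
        jacH a b i := by
      rw [jacH]
      refine integral_congr_ae (.of_forall fun x => ?_)
      simp only
      ring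
    rw [h2, ← mul_inv, Real.mul_self_sqrt (jacH_pos ha hb i).le,
      inv_mul_cancel₀ (jacH_pos ha hb i).ne']
  · rw [integral_jacP_mul_jacP ha hb h, mul_zero]

/-- The functions `j^k` are the orthonormal Jacobi polynomials times the square root of the weight. -/
theorem jacobiFun_eq (p : ℕ) (z' w' : ℝ) (k : ℕ) (x : ℝ) :
    jacobiFun p z' w' k x = (jacN (z' - p) w' k).eval x * √(jacW (z' - p) w' x) := by
  have h : (∫ y in Set.Ioo (0 : ℝ) 1, jacobiPoly k (z' - p) w' y ^ 2 * jacobiWeight p z' w' y) =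
      jacH (z' - p) w' k := by
    simp only [jacobiPoly_eq_eval]
    rfl
  rw [jacobiFun, h, jacN, eval_mul, eval_C, jacobiPoly_eq_eval]
  change _ * √(jacW (z' - p) w' x) / _ = _
  ring

/-- The orthonormal Jacobi polynomials grow at most exponentially on `[0,1]`. -/
theorem exists_jacN_sq_le {a b : ℝ} (ha : -1 < a) (hb : -1 < b) :
    ∃ M R : ℝ, 0 < M ∧ 0 < R ∧ ∀ (k : ℕ), ∀ x ∈ Set.Icc (0 : ℝ) 1,
      (jacN a b k).eval x ^ 2 ≤ M * R ^ k := by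
  set c := ∫ x in Set.Ioo (1 / 4 : ℝ) (3 / 4), jacW (a + 1) (b + 1) x
  have hcpos : 0 < c := setIntegral_jacW_pos (by linarith) (by linarith) (by norm_num)
    (by norm_num) (by norm_num)
  have h0pos := jacH_pos ha hb 0
  set e := a + b + 2
  have hepos : 0 < e := by linarith
  set B := |a| + |b| + 1
  -- one differentiation makes both parameters positive, so that `jacH_zero_le` applies
  have hlow : ∀ k : ℕ, min (jacH a b 0) (e * c) * (3 / 32) ^ k ≤ jacH a b k := by
    intro k
    rcases k with _ | k
    · simp
    · have h1 := jacH_zero_le (a := a + 1) (b := b + 1) (by linarith) (by linarith) k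
      have h2 := jacH_zero_lower (a := a + 1) (b := b + 1) (by linarith) (by linarith) k
      have h2k : ((k : ℝ) + 1) ≤ 2 ^ k := by exact_mod_cast Nat.lt_two_pow_self (n := k)
      rw [jacH_succ ha hb]
      calc min (jacH a b 0) (e * c) * (3 / 32) ^ (k + 1)
          ≤ (e * c) * (3 / 32) ^ k := by
            refine mul_le_mul (min_le_right _ _) ?_ (by positivity) (by positivity)
            exact pow_le_pow_of_le_one (by norm_num) (by norm_num) (Nat.le_succ k)
        _ = e / 2 ^ k * ((3 / 16) ^ k * c) := by
            rw [show (3 / 32 : ℝ) = 3 / 16 / 2 by norm_num, div_pow]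
            field_simp
        _ ≤ (k + a + b + 2) / (k + 1) * jacH (a + 1) (b + 1) k := by
            refine mul_le_mul ?_ (h2.trans h1) (by positivity)
              (div_nonneg (by linarith) (by positivity))
            exact div_le_div₀ (by linarith) (by linarith) (by positivity) h2k
  refine ⟨Real.exp (2 * B) / min (jacH a b 0) (e * c), 4 * Real.exp 6 / (3 / 32), by positivity,
    by positivity, fun k x hx => ?_⟩
  have h1 := jacP_abs_le ha b k hx
  have hH := jacH_pos ha hb k
  have h2 : (jacN a b k).eval x ^ 2 = |(jacP a b k).eval x| ^ 2 / jacH a b k := by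
    rw [jacN, eval_mul, eval_C, mul_pow, inv_pow, Real.sq_sqrt hH.le, sq_abs]
    ring
  have h2k : ((k : ℝ) + 1) ≤ 2 ^ k := by exact_mod_cast Nat.lt_two_pow_self (n := k)
  have h3 : |(jacP a b k).eval x| ^ 2 ≤ Real.exp (2 * B) * (4 * Real.exp 6) ^ k := by
    calc |(jacP a b k).eval x| ^ 2 ≤ (2 ^ k * Real.exp (3 * k + B)) ^ 2 := by
          refine pow_le_pow_left₀ (abs_nonneg _) (h1.trans ?_) 2
          exact mul_le_mul_of_nonneg_right h2k (Real.exp_pos _).le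
      _ = _ := by
          have e1 : Real.exp (3 * k + B) = Real.exp 3 ^ k * Real.exp B := by
            rw [Real.exp_add, mul_comm (3 : ℝ), Real.exp_nat_mul]
          have e2 : Real.exp 6 = Real.exp 3 ^ 2 := by
            rw [← Real.exp_nat_mul]; norm_num
          have e3 : Real.exp (2 * B) = Real.exp B ^ 2 := by
            rw [← Real.exp_nat_mul]; norm_num
          rw [e1, e2, e3, show (4 : ℝ) = 2 ^ 2 by norm_num, ← mul_pow, ← pow_mul, mul_comm 2 k,
            pow_mul, mul_pow, mul_pow, mul_pow, mul_pow]
          ring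
  rw [h2, div_pow, div_le_iff₀ hH]
  refine h3.trans ?_
  have h4 : Real.exp (2 * B) / min (jacH a b 0) (e * c) * ((4 * Real.exp 6) ^ k / (3 / 32) ^ k) *
      (min (jacH a b 0) (e * c) * (3 / 32) ^ k) = Real.exp (2 * B) * (4 * Real.exp 6) ^ k := by
    field_simp
  rw [← h4]
  exact mul_le_mul_of_nonneg_left (hlow k) (by positivity)

/-- The Gaussian decay of `exp (-c K(k))` beats exponential growth. -/
theorem summable_exp_jacEigen (s M : ℝ) {R c : ℝ} (hR : 0 < R) (hc : 0 < c) :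
    Summable fun k : ℕ => Real.exp (-c * ((k : ℝ) * (k + s))) * (M * R ^ k) := by
  have h : Summable fun k : ℕ => Real.exp (-c * ((k : ℝ) * (k + s))) * R ^ k := by
    refine summable_of_ratio_test_tendsto_lt_one (l := 0) one_pos
      (.of_forall fun k => by positivity) ?_
    have h1 : ∀ k : ℕ, ‖Real.exp (-c * (((k + 1 : ℕ) : ℝ) * (((k + 1 : ℕ) : ℝ) + s))) *
        R ^ (k + 1)‖ / ‖Real.exp (-c * ((k : ℝ) * (k + s))) * R ^ k‖ =
        R * Real.exp (-(c * (2 * k + s + 1))) := by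
      intro k
      rw [Real.norm_of_nonneg (by positivity), Real.norm_of_nonneg (by positivity),
        div_eq_iff (by positivity), pow_succ]
      have : Real.exp (-c * (((k + 1 : ℕ) : ℝ) * (((k + 1 : ℕ) : ℝ) + s))) =
          Real.exp (-(c * (2 * k + s + 1))) * Real.exp (-c * ((k : ℝ) * (k + s))) := by
        rw [← Real.exp_add]; congr 1; push_cast; ring
      rw [this]
      ring
    simp only [h1]
    rw [← mul_zero R]
    refine Tendsto.const_mul R (Real.tendsto_exp_neg_atTop_nhds_zero.comp ?_)
    refine Tendsto.const_mul_atTop hc ?_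
    refine tendsto_atTop_add_const_right _ _ (tendsto_atTop_add_const_right _ _ ?_)
    exact Tendsto.const_mul_atTop two_pos tendsto_natCast_atTop_atTop
  exact (h.mul_left M).congr fun k => by ring

end Growth

end

noncomputable section

/-! ### The Hahn operator in the scaling limit -/

section Scaling

open Polynomial

theorem hahnOp_mul (a b : ℝ) (n : ℕ) (f : ℕ → ℝ) (x : ℕ) :
    stepUp a b n (stepDown n f) x = n * (n + a + b + 1) * f x +
      ((b + 1 + x) * (n - 1 - x) * (f (x + 1) - f x) +
        (a + n - x) * x * (f (x - 1) - f x)) := by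
  simp only [stepUp, stepDown, add_tsub_cancel_right]
  push_cast
  ring

theorem hahnDenom_pos {a b : ℝ} (ha : -1 < a) (hb : -1 < b) {n : ℕ} (hn : 0 < n) :
    0 < (n : ℝ) * (n + a + b + 1) := by
  have : (1 : ℝ) ≤ n := by exact_mod_cast hn
  exact mul_pos (by linarith) (by linarith)

/-- The difference form of the one-particle generator. -/
theorem hahnOp_sub {a b : ℝ} (ha : -1 < a) (hb : -1 < b) {n : ℕ} (hn : 0 < n) (f : ℕ → ℝ)
    (x : ℕ) : n * (n + a + b + 1) * (hahnOp a b n f x - f x) =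
      (b + 1 + x) * (n - 1 - x) * (f (x + 1) - f x) +
        (a + n - x) * x * (f (x - 1) - f x) := by
  have h := (hahnDenom_pos ha hb hn).ne'
  rw [hahnOp, hahnOp_mul, mul_sub, mul_div_cancel₀ _ h]
  ring

/-- The one-particle chain is a contraction for the supremum norm on `{0, …, n - 1}`. -/
theorem abs_hahnOp_le {a b : ℝ} (ha : -1 < a) (hb : -1 < b) {n : ℕ} {f : ℕ → ℝ} {ε : ℝ}
    (hf : ∀ v < n, |f v| ≤ ε) : ∀ v < n, |hahnOp a b n f v| ≤ ε := by
  intro x hx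
  have hpos := hahnDenom_pos ha hb (show 0 < n by omega)
  have hx1 : (x : ℝ) + 1 ≤ n := by exact_mod_cast hx
  have hx0 : (0 : ℝ) ≤ x := by positivity
  have h1 : |(n - x : ℝ) * f x + x * f (x - 1)| ≤ n * ε := by
    refine (abs_add_le _ _).trans ?_
    rw [abs_mul, abs_mul, abs_of_nonneg (show (0 : ℝ) ≤ n - x by linarith), abs_of_nonneg hx0]
    have := mul_le_mul_of_nonneg_left (hf x hx) (show (0 : ℝ) ≤ n - x by linarith)
    have := mul_le_mul_of_nonneg_left (hf (x - 1) (by omega)) hx0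
    linarith
  have h2 : |(n - (x + 1) : ℝ) * f (x + 1) + (x + 1) * f x| ≤ n * ε := by
    refine (abs_add_le _ _).trans ?_
    rw [abs_mul, abs_mul, abs_of_nonneg (show (0 : ℝ) ≤ n - (x + 1) by linarith),
      abs_of_nonneg (show (0 : ℝ) ≤ x + 1 by linarith)]
    have h3 := mul_le_mul_of_nonneg_left (hf x hx) (show (0 : ℝ) ≤ x + 1 by linarith)
    have h4 : (n - (x + 1) : ℝ) * |f (x + 1)| ≤ (n - (x + 1)) * ε := by
      by_cases h : x + 1 < n
      · exact mul_le_mul_of_nonneg_left (hf _ h) (by linarith)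
      · have : (n : ℝ) = x + 1 := by
          have : n = x + 1 := by omega
          rw [this]; push_cast; ring
        rw [this]; simp
    linarith
  have e : stepUp a b n (stepDown n f) x = (a + n - x) * ((n - x : ℝ) * f x + x * f (x - 1)) +
      (b + 1 + x) * ((n - (x + 1) : ℝ) * f (x + 1) + (x + 1) * f x) := by
    simp only [stepUp, stepDown, add_tsub_cancel_right]
    push_cast
    ring
  rw [hahnOp, abs_div, abs_of_pos hpos, div_le_iff₀ hpos, e]
  refine (abs_add_le _ _).trans ?_
  rw [abs_mul, abs_mul, abs_of_nonneg (show 0 ≤ a + n - x by linarith),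
    abs_of_nonneg (show 0 ≤ b + 1 + x by linarith)]
  have := mul_le_mul_of_nonneg_left h1 (show 0 ≤ a + n - x by linarith)
  have := mul_le_mul_of_nonneg_left h2 (show 0 ≤ b + 1 + x by linarith)
  linarith

theorem hahnOp_sub_fun (a b : ℝ) (n : ℕ) (f g : ℕ → ℝ) :
    hahnOp a b n (f - g) = hahnOp a b n f - hahnOp a b n g := by
  funext x
  simp only [hahnOp, stepUp, stepDown, Pi.sub_apply]
  ring

theorem hahnOp_smul (a b : ℝ) (n : ℕ) (c : ℝ) (f : ℕ → ℝ) :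
    hahnOp a b n (c • f) = c • hahnOp a b n f := by
  funext x
  simp only [hahnOp, stepUp, stepDown, Pi.smul_apply, smul_eq_mul]
  ring

theorem hahnOp_add (a b : ℝ) (n : ℕ) (f g : ℕ → ℝ) :
    hahnOp a b n (f + g) = hahnOp a b n f + hahnOp a b n g := by
  funext x
  simp only [hahnOp, stepUp, stepDown, Pi.add_apply]
  ring

/-- The Hahn operator as a linear map. -/
def hahnLin (a b : ℝ) (n : ℕ) : (ℕ → ℝ) →ₗ[ℝ] (ℕ → ℝ) where
  toFun := hahnOp a b n
  map_add' := hahnOp_add a b n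
  map_smul' := hahnOp_smul a b n

theorem hahnOp_iterate (a b : ℝ) (n s : ℕ) : (hahnOp a b n)^[s] = ⇑(hahnLin a b n ^ s) := by
  rw [Module.End.coe_pow]
  rfl

theorem abs_hahnOp_iterate_le {a b : ℝ} (ha : -1 < a) (hb : -1 < b) {n : ℕ} {f : ℕ → ℝ} {ε : ℝ}
    (hf : ∀ v < n, |f v| ≤ ε) (s : ℕ) : ∀ v < n, |(hahnOp a b n)^[s] f v| ≤ ε := by
  induction s with
  | zero => exact hf
  | succ s ih =>
    rw [Function.iterate_succ_apply']
    exact abs_hahnOp_le ha hb ih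

/-- An approximate eigenfunction of the one-particle chain stays one under iteration. -/
theorem abs_hahnOp_iterate_sub_le {a b : ℝ} (ha : -1 < a) (hb : -1 < b) {n : ℕ} {f : ℕ → ℝ}
    {θ δ : ℝ} (hθ : |θ| ≤ 1) (hf : ∀ v < n, |hahnOp a b n f v - θ * f v| ≤ δ) (s : ℕ) :
    ∀ v < n, |(hahnOp a b n)^[s] f v - θ ^ s * f v| ≤ s * δ := by
  induction s with
  | zero => intro v hv; simp
  | succ s ih =>
    intro v hv
    have h1 : (hahnOp a b n)^[s + 1] f v - θ ^ (s + 1) * f v =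
        (hahnOp a b n) ((hahnOp a b n)^[s] f - θ ^ s • f) v +
          θ ^ s * (hahnOp a b n f v - θ * f v) := by
      rw [hahnOp_sub_fun, hahnOp_smul, Function.iterate_succ_apply']
      simp only [Pi.sub_apply, Pi.smul_apply, smul_eq_mul]
      ring
    rw [h1]
    refine (abs_add_le _ _).trans ?_
    have h2 := abs_hahnOp_le ha hb (f := (hahnOp a b n)^[s] f - θ ^ s • f) ih v hv
    have h3 : |θ ^ s * (hahnOp a b n f v - θ * f v)| ≤ δ := by
      rw [abs_mul, abs_pow]
      calc _ ≤ 1 * δ := mul_le_mul (pow_le_one₀ (abs_nonneg _) hθ) (hf v hv) (abs_nonneg _)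
            zero_le_one
        _ = δ := one_mul _
    push_cast
    linarith

/-- Stationarity of the Hahn weight for the one-particle chain. -/
theorem sum_hahnWt_mul_hahnOp {a b : ℝ} (ha : -1 < a) (hb : -1 < b) {n : ℕ} (hn : 0 < n)
    (f : ℕ → ℝ) :
    ∑ v : Fin n, hahnWt a b n v * hahnOp a b n f v = ∑ v : Fin n, hahnWt a b n v * f v := by
  rw [Fin.sum_univ_eq_sum_range (fun v => hahnWt a b n v * hahnOp a b n f v),
    Fin.sum_univ_eq_sum_range (fun v => hahnWt a b n v * f v), ← sub_eq_zero,
    ← Finset.sum_sub_distrib]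
  have hpos := (hahnDenom_pos ha hb hn).ne'
  -- the current through the bond between `v` and `v + 1`
  let J : ℕ → ℝ := fun v => hahnWt a b n v * ((b + 1 + v) * (n - 1 - v)) * (f (v + 1) - f v)
  obtain ⟨d, rfl⟩ := Nat.exists_eq_add_of_le' hn
  have h1 : ∀ v ∈ Finset.range (d + 1), ((d + 1 : ℕ) : ℝ) * ((d + 1 : ℕ) + a + b + 1) *
      (hahnWt a b (d + 1) v * hahnOp a b (d + 1) f v - hahnWt a b (d + 1) v * f v) =
      J v - if v = 0 then 0 else J (v - 1) := by
    intro v hv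
    have hv' := Finset.mem_range.1 hv
    have h2 := hahnOp_sub ha hb hn f v
    rw [← mul_sub, mul_left_comm, h2]
    rcases v with _ | v
    · simp [J]; ring
    · have h3 := hahnWt_balance ha hb hv'
      rw [if_neg (by omega), add_tsub_cancel_right]
      simp only [J]
      push_cast at h3 ⊢
      linear_combination (f v - f (v + 1)) * h3
  have h4 : ((d + 1 : ℕ) : ℝ) * ((d + 1 : ℕ) + a + b + 1) * ∑ v ∈ Finset.range (d + 1),
      (hahnWt a b (d + 1) v * hahnOp a b (d + 1) f v - hahnWt a b (d + 1) v * f v) = 0 := by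
    rw [Finset.mul_sum, Finset.sum_congr rfl h1, Finset.sum_sub_distrib,
      Finset.sum_range_succ' (fun v => if v = 0 then 0 else J (v - 1)), Finset.sum_range_succ]
    have : J d = 0 := by simp [J]
    simp [this]
  exact (mul_eq_zero.1 h4).resolve_left hpos

/-- Third-order Taylor bound for polynomials on `[0,1]`. -/
theorem exists_taylor_bound (f : ℝ[X]) : ∃ M : ℝ, ∀ u ∈ Set.Icc (0 : ℝ) 1, ∀ h : ℝ, |h| ≤ 1 →
    |f.eval (u + h) - f.eval u - h * (derivative f).eval u -
      h ^ 2 / 2 * (derivative (derivative f)).eval u| ≤ M * |h| ^ 3 := by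
  induction f using Polynomial.induction_on with
  | C a => exact ⟨0, fun u _ h _ => by simp⟩
  | add f g hf hg =>
    obtain ⟨M, hM⟩ := hf
    obtain ⟨M', hM'⟩ := hg
    refine ⟨M + M', fun u hu h hh => ?_⟩
    have h1 := hM u hu h hh
    have h2 := hM' u hu h hh
    simp only [eval_add, derivative_add]
    calc _ = |(f.eval (u + h) - f.eval u - h * (derivative f).eval u -
          h ^ 2 / 2 * (derivative (derivative f)).eval u) +
          (g.eval (u + h) - g.eval u - h * (derivative g).eval u -
          h ^ 2 / 2 * (derivative (derivative g)).eval u)| := by congr 1; ring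
      _ ≤ _ := (abs_add_le _ _).trans (by linarith)
  | monomial k c hf =>
    have e : (C c * X ^ (k + 1) : ℝ[X]) = X * (C c * X ^ k) := by ring
    rw [e]
    generalize (C c * X ^ k : ℝ[X]) = g at hf
    obtain ⟨M, hM⟩ := hf
    obtain ⟨M', hM'⟩ := isCompact_Icc.exists_bound_of_continuousOn (s := Set.Icc (0 : ℝ) 1)
      (derivative (derivative g)).continuous.continuousOn
    refine ⟨2 * M + M' / 2, fun u hu h hh => ?_⟩
    have h1 := hM u hu h hh
    have h2 := hM' u hu
    rw [Real.norm_eq_abs] at h2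
    have e2 : (X * g).eval (u + h) - (X * g).eval u - h * (derivative (X * g)).eval u -
        h ^ 2 / 2 * (derivative (derivative (X * g))).eval u =
        (u + h) * (g.eval (u + h) - g.eval u - h * (derivative g).eval u -
          h ^ 2 / 2 * (derivative (derivative g)).eval u) +
          h ^ 3 / 2 * (derivative (derivative g)).eval u := by
      simp only [derivative_mul, derivative_X, one_mul, derivative_add, eval_add, eval_mul, eval_X]
      ring
    rw [e2]
    refine (abs_add_le _ _).trans ?_
    rw [abs_mul, abs_mul, abs_div, abs_pow, abs_two]
    have h3 : |u + h| ≤ 2 := by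
      refine (abs_add_le _ _).trans ?_
      rw [abs_of_nonneg hu.1]
      linarith [hu.2]
    have h4 : |u + h| * |g.eval (u + h) - g.eval u - h * (derivative g).eval u -
          h ^ 2 / 2 * (derivative (derivative g)).eval u| ≤ 2 * (M * |h| ^ 3) :=
      mul_le_mul h3 h1 (abs_nonneg _) two_pos.le
    have h5 : |h| ^ 3 / 2 * |(derivative (derivative g)).eval u| ≤ |h| ^ 3 / 2 * M' :=
      mul_le_mul_of_nonneg_left h2 (by positivity)
    linarith

/-- The grid points `v / (N + p - 1)`. -/
def gridPt (p N v : ℕ) : ℝ := (v : ℝ) / ((N : ℝ) + p - 1)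

theorem gridPt_mem {p N v : ℕ} (hN : 2 ≤ N) (hv : v < N + p) :
    gridPt p N v ∈ Set.Icc (0 : ℝ) 1 := by
  have h2 : (2 : ℝ) ≤ N := by exact_mod_cast hN
  have hv' : (v : ℝ) + 1 ≤ N + p := by exact_mod_cast hv
  have hL : (0 : ℝ) < (N : ℝ) + p - 1 := by linarith
  refine ⟨div_nonneg (by positivity) hL.le, (div_le_one hL).2 (by linarith)⟩

/-- The functions `F N` on the grids converge uniformly to the polynomial `f`. -/
def GridTendsto (p : ℕ) (F : ℕ → ℕ → ℝ) (f : ℝ[X]) : Prop :=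
  ∀ ε > 0, ∀ᶠ N in atTop, ∀ v < N + p, |F N v - f.eval (gridPt p N v)| ≤ ε

theorem gridTendsto_eval (p : ℕ) (f : ℝ[X]) :
    GridTendsto p (fun N v => f.eval (gridPt p N v)) f :=
  fun ε hε => .of_forall fun N v _ => by simpa using hε.le

theorem exists_bound_grid (p : ℕ) (f : ℝ[X]) : ∃ M : ℝ, 0 < M ∧ ∀ᶠ N in atTop, ∀ v < N + p,
    |f.eval (gridPt p N v)| ≤ M := by
  obtain ⟨M, hM⟩ := isCompact_Icc.exists_bound_of_continuousOn (s := Set.Icc (0 : ℝ) 1)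
    f.continuous.continuousOn
  refine ⟨|M| + 1, by positivity, ?_⟩
  filter_upwards [eventually_ge_atTop 2] with N hN v hv
  have := hM _ (gridPt_mem hN hv)
  rw [Real.norm_eq_abs] at this
  linarith [le_abs_self M]

theorem GridTendsto.add {p : ℕ} {F G : ℕ → ℕ → ℝ} {f g : ℝ[X]} (hF : GridTendsto p F f)
    (hG : GridTendsto p G g) : GridTendsto p (fun N => F N + G N) (f + g) := by
  intro ε hε
  filter_upwards [hF (ε / 2) (by positivity), hG (ε / 2) (by positivity)] with N h1 h2 v hv
  have h3 := h1 v hv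
  have h4 := h2 v hv
  rw [Pi.add_apply, eval_add]
  calc _ = |(F N v - f.eval (gridPt p N v)) + (G N v - g.eval (gridPt p N v))| := by
        congr 1; ring
    _ ≤ _ := (abs_add_le _ _).trans (by linarith)

theorem GridTendsto.mul_eval {p : ℕ} {F : ℕ → ℕ → ℝ} {f : ℝ[X]} (hF : GridTendsto p F f)
    (g : ℝ[X]) : GridTendsto p (fun N => (fun v => g.eval (gridPt p N v)) * F N) (g * f) := by
  intro ε hε
  obtain ⟨M, hM, hg⟩ := exists_bound_grid p g
  filter_upwards [hF (ε / M) (by positivity), hg] with N h1 h2 v hv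
  rw [Pi.mul_apply, eval_mul, ← mul_sub, abs_mul]
  calc _ ≤ M * (ε / M) := mul_le_mul (h2 v hv) (h1 v hv) (abs_nonneg _) hM.le
    _ = ε := by field_simp

theorem GridTendsto.smul_eval {p : ℕ} {c : ℕ → ℝ} {c' : ℝ} (hc : Tendsto c atTop (𝓝 c'))
    (f : ℝ[X]) : GridTendsto p (fun N v => c N * f.eval (gridPt p N v)) (C c' * f) := by
  intro ε hε
  obtain ⟨M, hM, hf⟩ := exists_bound_grid p f
  filter_upwards [Metric.tendsto_nhds.1 hc (ε / M) (by positivity), hf] with N h1 h2 v hv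
  rw [Real.dist_eq] at h1
  rw [eval_mul, eval_C, ← sub_mul, abs_mul]
  calc _ ≤ (ε / M) * M := mul_le_mul h1.le (h2 v hv) (abs_nonneg _) (by positivity)
    _ = ε := by field_simp

/-- The Taylor remainder of order `L⁻³`, multiplied by jump rates of order `L²`, is of order `L⁻¹`. -/
theorem abs_remainder_le {A L M c x r : ℝ} (hA : 2 ≤ A) (hL1 : 1 ≤ L) (hc : |c| + 2 ≤ A)
    (hx0 : 0 ≤ x) (hx1 : x ≤ 1) (hr : |r| ≤ M * (1 / L) ^ 3) :
    |(c + 1 + L * x) * (1 - x) * L * r| ≤ 2 * A * |M| * (1 / L) := by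
  have hc' := abs_le.1 (show |c| ≤ |c| from le_rfl)
  have g1 : |(c + 1 + L * x) * (1 - x)| ≤ 2 * A * L := by
    rw [abs_mul]
    have k1 : 0 ≤ L * x := mul_nonneg (by linarith) hx0
    have k2 : L * x ≤ L := mul_le_of_le_one_right (by linarith) hx1
    have h1 : |c + 1 + L * x| ≤ A + L := abs_le.2 ⟨by linarith, by linarith⟩
    have h3 : |1 - x| ≤ 1 := abs_le.2 ⟨by linarith, by linarith⟩
    have h4 : A ≤ A * L := le_mul_of_one_le_right (by linarith) hL1
    have h5 : L ≤ A * L := le_mul_of_one_le_left (by linarith) (by linarith)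
    calc _ ≤ (A + L) * 1 := mul_le_mul h1 h3 (abs_nonneg _) (by linarith)
      _ ≤ _ := by linarith
  rw [abs_mul, abs_mul _ L, abs_of_pos (show 0 < L by linarith)]
  have hr' : |r| ≤ |M| * (1 / L) ^ 3 :=
    hr.trans (mul_le_mul_of_nonneg_right (le_abs_self M) (by positivity))
  calc _ ≤ (2 * A * L * L) * (|M| * (1 / L) ^ 3) := by gcongr
    _ = _ := by field_simp

/-- The generator of the one-particle chain converges to minus the Jacobi operator. -/
theorem gridTendsto_generator {a b : ℝ} (ha : -1 < a) (hb : -1 < b) (p : ℕ) (f : ℝ[X]) :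
    GridTendsto p (fun N v => ((N + p : ℕ) : ℝ) * ((N + p : ℕ) + a + b + 1) *
      (hahnOp a b (N + p) (fun v => f.eval (gridPt p N v)) v - f.eval (gridPt p N v)))
      (-jacD a b f) := by
  intro ε hε
  obtain ⟨M, hM⟩ := exists_taylor_bound f
  obtain ⟨M', hM'⟩ := isCompact_Icc.exists_bound_of_continuousOn (s := Set.Icc (0 : ℝ) 1)
    (derivative (derivative f)).continuous.continuousOn
  set A := |a| + |b| + 2 with hA
  have hA0 : 0 < A := by positivity
  have hA2 : 2 ≤ A := by rw [hA]; linarith [abs_nonneg a, abs_nonneg b]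
  set B := A * |M'| + 4 * A * |M| with hB
  have hLim : Tendsto (fun N : ℕ => B * (1 / ((N : ℝ) + p - 1))) atTop (𝓝 0) := by
    rw [← mul_zero B]
    refine Tendsto.const_mul B ?_
    simp only [one_div]
    refine tendsto_inv_atTop_zero.comp ?_
    simp only [add_sub_assoc]
    exact tendsto_atTop_add_const_right _ _ tendsto_natCast_atTop_atTop
  filter_upwards [eventually_ge_atTop 2, hLim.eventually_le_const hε] with N hN hNε v hv
  have h2 : (2 : ℝ) ≤ N := by exact_mod_cast hN
  have hu := gridPt_mem hN hv
  set L : ℝ := (N : ℝ) + p - 1 with hL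
  have hL1 : 1 ≤ L := by linarith
  have hL0 : L ≠ 0 := by linarith
  set u := gridPt p N v with hu_def
  have hv : (v : ℝ) = L * u := by
    rw [hu_def, gridPt, ← hL]; field_simp
  have hup : gridPt p N (v + 1) = u + 1 / L := by
    rw [hu_def, gridPt, gridPt, ← hL]; push_cast; ring
  have hn : ((N + p : ℕ) : ℝ) = L + 1 := by rw [hL]; push_cast; ring
  have hdown : (v : ℝ) * (f.eval (gridPt p N (v - 1)) - f.eval u) =
      v * (f.eval (u + -(1 / L)) - f.eval u) := by
    rcases v with _ | v
    · simp
    · have : gridPt p N (v + 1 - 1) = u + -(1 / L) := by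
        rw [hu_def, gridPt, gridPt, ← hL, add_tsub_cancel_right]; push_cast; ring
      rw [this]
  rw [hahnOp_sub ha hb (by omega), hup, mul_assoc (a + ((N + p : ℕ) : ℝ) - v), hdown, hn, hv]
  have hh : |1 / L| ≤ 1 := by
    rw [abs_of_pos (by positivity), div_le_one (by positivity)]; exact hL1
  have t1 := hM u hu (1 / L) hh
  have t2 := hM u hu (-(1 / L)) (by rwa [abs_neg])
  rw [abs_neg] at t2
  have t3 := hM' u hu
  rw [Real.norm_eq_abs] at t3
  rw [abs_of_pos (show 0 < 1 / L by positivity)] at t1 t2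
  set r1 := f.eval (u + 1 / L) - f.eval u - 1 / L * (derivative f).eval u -
    (1 / L) ^ 2 / 2 * (derivative (derivative f)).eval u with hr1
  set r2 := f.eval (u + -(1 / L)) - f.eval u - -(1 / L) * (derivative f).eval u -
    (-(1 / L)) ^ 2 / 2 * (derivative (derivative f)).eval u with hr2
  have e1 : f.eval (u + 1 / L) - f.eval u = r1 + 1 / L * (derivative f).eval u +
    (1 / L) ^ 2 / 2 * (derivative (derivative f)).eval u := by rw [hr1]; ring
  have e2 : f.eval (u + -(1 / L)) - f.eval u = r2 + -(1 / L) * (derivative f).eval u +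
    (-(1 / L)) ^ 2 / 2 * (derivative (derivative f)).eval u := by rw [hr2]; ring
  have ha' := abs_le.1 (show |a| ≤ |a| from le_rfl)
  have hb' := abs_le.1 (show |b| ≤ |b| from le_rfl)
  have hu0 := hu.1
  have hu1 := hu.2
  set f2 := (derivative (derivative f)).eval u with hf2
  -- the terms of order `L` in the second-order Taylor expansion cancel
  have key : (b + 1 + L * u) * (L + 1 - 1 - L * u) * (f.eval (u + 1 / L) - f.eval u) +
      (a + (L + 1) - L * u) * (L * u * (f.eval (u + -(1 / L)) - f.eval u)) -
      (-jacD a b f).eval u =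
      ((b + 1) * (1 - u) + (a + 1) * u) / 2 * f2 * (1 / L) +
      ((b + 1 + L * u) * (1 - u) * L * r1 + (a + 1 + L * (1 - u)) * u * L * r2) := by
    rw [e1, e2, jacD_apply]
    simp only [neg_neg, eval_add, eval_mul, eval_sub, eval_X, eval_one, eval_C, ← hf2]
    field_simp
    ring
  rw [key]
  have b1 : |((b + 1) * (1 - u) + (a + 1) * u) / 2 * f2 * (1 / L)| ≤ A * |M'| * (1 / L) := by
    rw [abs_mul, abs_mul, abs_of_pos (show 0 < 1 / L by positivity)]
    refine mul_le_mul_of_nonneg_right (mul_le_mul ?_ (t3.trans (le_abs_self M')) (abs_nonneg _)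
      hA0.le) (by positivity)
    have g1 := mul_nonneg (show 0 ≤ b + 1 by linarith) (show 0 ≤ 1 - u by linarith)
    have g2 := mul_nonneg (show 0 ≤ a + 1 by linarith) hu0
    have g3 := mul_le_of_le_one_right (show 0 ≤ b + 1 by linarith) (show 1 - u ≤ 1 by linarith)
    have g4 := mul_le_of_le_one_right (show 0 ≤ a + 1 by linarith) hu1
    rw [abs_of_nonneg (by linarith)]
    linarith
  have b2 := abs_remainder_le hA2 hL1 (c := b) (by linarith [abs_nonneg a]) hu0 hu1 t1
  have b3 := abs_remainder_le hA2 hL1 (c := a) (x := 1 - u) (by linarith [abs_nonneg b]) (by linarith) (by linarith) t2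
  rw [sub_sub_cancel] at b3
  refine (abs_add_le _ _).trans ?_
  have b4 := abs_add_le ((b + 1 + L * u) * (1 - u) * L * r1) ((a + 1 + L * (1 - u)) * u * L * r2)
  linarith

end Scaling

end

noncomputable section

/-! ### Expansions in Jacobi polynomials and the limit semigroup -/

section Semigroup

open Polynomial

/-- The eigenvalue of the Jacobi operator. -/
def jacK (a b : ℝ) (k : ℕ) : ℝ := (k : ℝ) * (k + a + b + 1)

/-- The inner product of polynomials in `L²((0,1), x^b (1-x)^a dx)`. -/
def jacIP (a b : ℝ) (f g : ℝ[X]) : ℝ :=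
  ∫ x in Set.Ioo (0 : ℝ) 1, f.eval x * g.eval x * jacW a b x

theorem integrableOn_jacIP {a b : ℝ} (ha : -1 < a) (hb : -1 < b) (f g : ℝ[X]) :
    IntegrableOn (fun x => f.eval x * g.eval x * jacW a b x) (Set.Ioo 0 1) :=
  integrableOn_mul_jacW ha hb (f := fun x => f.eval x * g.eval x) (by fun_prop)

theorem jacIP_sum_right {a b : ℝ} (ha : -1 < a) (hb : -1 < b) (f : ℝ[X]) {ι : Type*}
    (s : Finset ι) (c : ι → ℝ) (g : ι → ℝ[X]) :
    jacIP a b f (∑ k ∈ s, C (c k) * g k) = ∑ k ∈ s, c k * jacIP a b f (g k) := by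
  simp only [jacIP, eval_finsetSum, eval_mul, eval_C, ← integral_const_mul]
  rw [← integral_finsetSum _ fun k _ => (integrableOn_jacIP ha hb f (g k)).const_mul (c k)]
  refine integral_congr_ae (.of_forall fun x => ?_)
  simp only [Finset.mul_sum, Finset.sum_mul]
  exact Finset.sum_congr rfl fun k _ => by ring

theorem jacIP_mul_left (a b : ℝ) (f g h : ℝ[X]) : jacIP a b f (g * h) = jacIP a b (f * g) h :=
  integral_congr_ae (.of_forall fun x => by simp only [eval_mul]; ring)

/-- The orthonormal Jacobi polynomials of degree below `D` span the polynomials of degree below `D`. -/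
theorem exists_jacN_expansion {a b : ℝ} (ha : -1 < a) (hb : -1 < b) (D : ℕ) :
    ∀ f : ℝ[X], f.degree < D → ∃ c : ℕ → ℝ, f = ∑ k ∈ Finset.range D, C (c k) * jacN a b k := by
  induction D with
  | zero =>
    intro f hf
    refine ⟨0, ?_⟩
    rw [degree_lt_iff_coeff_zero] at hf
    ext m
    simpa using hf m (by omega)
  | succ D ih =>
    intro f hf
    have h0 := coeff_jacN_ne_zero ha hb D
    set e := f.coeff D / (jacN a b D).coeff D with he
    obtain ⟨c, hc⟩ := ih (f - C e * jacN a b D) (by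
      rw [degree_lt_iff_coeff_zero] at hf ⊢
      intro m hm
      rw [coeff_sub, coeff_C_mul]
      rcases hm.lt_or_eq with h | rfl
      · rw [hf m h, coeff_eq_zero_of_natDegree_lt ((natDegree_jacN_le a b D).trans_lt h)]
        simp
      · rw [he, div_mul_cancel₀ _ h0, sub_self])
    refine ⟨Function.update c D e, ?_⟩
    rw [Finset.sum_range_succ, Function.update_self]
    rw [sub_eq_iff_eq_add] at hc
    conv_lhs => rw [hc]
    congr 1
    refine Finset.sum_congr rfl fun k hk => ?_
    rw [Function.update_of_ne (Finset.mem_range.1 hk).ne]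

theorem jacIP_jacN {a b : ℝ} (ha : -1 < a) (hb : -1 < b) (i j : ℕ) :
    jacIP a b (jacN a b i) (jacN a b j) = if i = j then 1 else 0 :=
  integral_jacN_mul_jacN ha hb i j

/-- The expansion of a polynomial in the orthonormal Jacobi polynomials. -/
theorem eq_sum_jacIP {a b : ℝ} (ha : -1 < a) (hb : -1 < b) {D : ℕ} {f : ℝ[X]}
    (hf : f.degree < D) :
    f = ∑ k ∈ Finset.range D, C (jacIP a b (jacN a b k) f) * jacN a b k := by
  obtain ⟨c, hc⟩ := exists_jacN_expansion ha hb D f hf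
  conv_lhs => rw [hc]
  refine Finset.sum_congr rfl fun k hk => ?_
  conv_rhs => rw [hc, jacIP_sum_right ha hb]
  congr 2
  simp only [jacIP_jacN ha hb, mul_ite, mul_one, mul_zero]
  rw [Finset.sum_ite_eq, if_pos hk]

theorem jacIP_jacN_eq_zero {a b : ℝ} (ha : -1 < a) (hb : -1 < b) {k : ℕ} {f : ℝ[X]}
    (hf : f.degree < k) : jacIP a b (jacN a b k) f = 0 := by
  obtain ⟨c, hc⟩ := exists_jacN_expansion ha hb k f hf
  rw [hc, jacIP_sum_right ha hb]
  refine Finset.sum_eq_zero fun j hj => ?_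
  rw [jacIP_jacN ha hb, if_neg (Finset.mem_range.1 hj).ne', mul_zero]

/-- The Jacobi semigroup `exp(-t D)` on polynomials. -/
def jacS (a b t : ℝ) (f : ℝ[X]) : ℝ[X] :=
  ∑ k ∈ Finset.range (f.natDegree + 1),
    C (Real.exp (-(t * jacK a b k)) * jacIP a b (jacN a b k) f) * jacN a b k

theorem jacS_eq_sum {a b : ℝ} (ha : -1 < a) (hb : -1 < b) (t : ℝ) {D : ℕ} {f : ℝ[X]}
    (hf : f.degree < D) : jacS a b t f = ∑ k ∈ Finset.range D,
      C (Real.exp (-(t * jacK a b k)) * jacIP a b (jacN a b k) f) * jacN a b k := by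
  have hz : ∀ k : ℕ, f.degree < k →
      C (Real.exp (-(t * jacK a b k)) * jacIP a b (jacN a b k) f) * jacN a b k = 0 := by
    intro k hk
    rw [jacIP_jacN_eq_zero ha hb hk, mul_zero, C_0, zero_mul]
  have hd : f.degree < (f.natDegree + 1 : ℕ) := by
    refine degree_le_natDegree.trans_lt ?_
    exact_mod_cast Nat.lt_succ_self _
  rcases le_total D (f.natDegree + 1) with h | h
  · refine (Finset.sum_subset (Finset.range_mono h) fun k _ hk => hz k (hf.trans_le ?_)).symm
    exact Nat.cast_le.2 (not_lt.1 (mt Finset.mem_range.2 hk))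
  · refine Finset.sum_subset (Finset.range_mono h) fun k _ hk => hz k (hd.trans_le ?_)
    exact Nat.cast_le.2 (not_lt.1 (mt Finset.mem_range.2 hk))

theorem degree_jacN_lt (a b : ℝ) {k D : ℕ} (h : k < D) : (jacN a b k).degree < D :=
  (degree_le_of_natDegree_le (natDegree_jacN_le a b k)).trans_lt (by exact_mod_cast h)

theorem degree_jacS_lt {a b : ℝ} (ha : -1 < a) (hb : -1 < b) (t : ℝ) {D : ℕ} {f : ℝ[X]}
    (hf : f.degree < D) : (jacS a b t f).degree < D := by
  rw [jacS_eq_sum ha hb t hf, ← mem_degreeLT]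
  refine Submodule.sum_mem _ fun k hk => ?_
  rw [← smul_eq_C_mul]
  exact Submodule.smul_mem _ _ (mem_degreeLT.2 (degree_jacN_lt a b (Finset.mem_range.1 hk)))

theorem jacIP_jacS {a b : ℝ} (ha : -1 < a) (hb : -1 < b) (t : ℝ) (f : ℝ[X]) (k : ℕ) :
    jacIP a b (jacN a b k) (jacS a b t f) =
      Real.exp (-(t * jacK a b k)) * jacIP a b (jacN a b k) f := by
  have hf : f.degree < (f.natDegree + 1 + k : ℕ) := by
    refine degree_le_natDegree.trans_lt ?_
    exact_mod_cast (by omega : f.natDegree < f.natDegree + 1 + k)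
  rw [jacS_eq_sum ha hb t hf, jacIP_sum_right ha hb]
  simp only [jacIP_jacN ha hb, mul_ite, mul_one, mul_zero]
  by_cases hk : k ∈ Finset.range (f.natDegree + 1 + k)
  · rw [Finset.sum_ite_eq, if_pos hk]
  · simp at hk

/-! ### Convergence of the one-particle chain -/

/-- `(1 - K / m) ^ s` tends to `exp (-t K)` when `s / m` tends to `t`. -/
theorem tendsto_eigen_pow (K : ℝ) {m : ℕ → ℝ} (hm : Tendsto m atTop atTop) {s : ℕ → ℕ} {t : ℝ}
    (hs : Tendsto (fun N => (s N : ℝ) / m N) atTop (𝓝 t)) :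
    Tendsto (fun N => (1 - K / m N) ^ s N) atTop (𝓝 (Real.exp (-(t * K)))) := by
  have h1 : Tendsto (fun x : ℝ => x * Real.log (1 + -(K / x))) atTop (𝓝 (-K)) := by
    refine Real.tendsto_mul_log_one_add_of_tendsto ?_
    refine tendsto_const_nhds.congr' ?_
    filter_upwards [eventually_ne_atTop 0] with x hx
    field_simp
  have h2 := (h1.comp hm).mul hs
  have h3 : Tendsto (fun N => Real.exp ((m N * Real.log (1 + -(K / m N))) * (s N / m N))) atTop
      (𝓝 (Real.exp (-K * t))) := (Real.continuous_exp.tendsto _).comp h2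
  rw [show -(t * K) = -K * t by ring]
  refine h3.congr' ?_
  have h4 : Tendsto (fun N => 1 + -(K / m N)) atTop (𝓝 (1 + -0)) :=
    (hm.const_div_atTop K).neg.const_add 1
  rw [neg_zero, add_zero] at h4
  filter_upwards [h4.eventually_const_lt (show (0 : ℝ) < 1 by norm_num),
    hm.eventually_ne_atTop 0] with N h5 h6
  rw [← sub_eq_add_neg] at h5
  rw [← sub_eq_add_neg, show m N * Real.log (1 - K / m N) * (s N / m N) =
    s N * Real.log (1 - K / m N) by field_simp, Real.exp_nat_mul, Real.exp_log h5]

/-- The time scale of the one-particle chain. -/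
def timeScale (a b : ℝ) (p N : ℕ) : ℝ := ((N + p : ℕ) : ℝ) * ((N + p : ℕ) + a + b + 1)

theorem tendsto_timeScale_div (a b : ℝ) (p : ℕ) :
    Tendsto (fun N => timeScale a b p N / (N : ℝ) ^ 2) atTop (𝓝 1) := by
  have h1 : ∀ c : ℝ, Tendsto (fun N : ℕ => 1 + c / (N : ℝ)) atTop (𝓝 1) := fun c => by
    simpa using (tendsto_const_div_atTop_nhds_zero_nat c).const_add 1
  have h2 := (h1 p).mul (h1 (p + a + b + 1))
  rw [mul_one] at h2
  refine h2.congr' ?_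
  filter_upwards [eventually_ne_atTop 0] with N hN
  have : (N : ℝ) ≠ 0 := by exact_mod_cast hN
  rw [timeScale]
  push_cast
  field_simp
  ring

theorem tendsto_timeScale (a b : ℝ) (p : ℕ) : Tendsto (timeScale a b p) atTop atTop := by
  have h1 : Tendsto (fun N : ℕ => (N : ℝ) ^ 2) atTop atTop :=
    (tendsto_pow_atTop two_ne_zero).comp tendsto_natCast_atTop_atTop
  have h2 := (tendsto_timeScale_div a b p).pos_mul_atTop one_pos h1
  refine h2.congr' ?_
  filter_upwards [eventually_ne_atTop 0] with N hN
  have : (N : ℝ) ≠ 0 := by exact_mod_cast hN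
  field_simp

theorem tendsto_steps_div (a b : ℝ) (p : ℕ) {s : ℕ → ℕ} {t : ℝ}
    (hs : Tendsto (fun N => (s N : ℝ) / (N : ℝ) ^ 2) atTop (𝓝 t)) :
    Tendsto (fun N => (s N : ℝ) / timeScale a b p N) atTop (𝓝 t) := by
  have h := hs.div (tendsto_timeScale_div a b p) one_ne_zero
  rw [div_one] at h
  refine h.congr' ?_
  filter_upwards [eventually_ne_atTop 0] with N hN
  have : (N : ℝ) ≠ 0 := by exact_mod_cast hN
  simp only [Pi.div_apply]
  field_simp

theorem GridTendsto.sum {p : ℕ} {ι : Type*} (s : Finset ι) {F : ι → ℕ → ℕ → ℝ} {f : ι → ℝ[X]}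
    (h : ∀ k ∈ s, GridTendsto p (F k) (f k)) :
    GridTendsto p (fun N => ∑ k ∈ s, F k N) (∑ k ∈ s, f k) := by
  classical
  induction s using Finset.induction_on with
  | empty => intro ε hε; exact .of_forall fun N v _ => by simpa using hε.le
  | insert k s hk ih =>
    simp only [Finset.sum_insert hk]
    exact (h k (Finset.mem_insert_self k s)).add
      (ih fun j hj => h j (Finset.mem_insert_of_mem hj))

/-- Iterates of the one-particle chain on a Jacobi polynomial. -/
theorem gridTendsto_iterate_jacN {a b : ℝ} (ha : -1 < a) (hb : -1 < b) (p k : ℕ) {s : ℕ → ℕ}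
    {t : ℝ} (hs : Tendsto (fun N => (s N : ℝ) / (N : ℝ) ^ 2) atTop (𝓝 t)) :
    GridTendsto p (fun N => (hahnOp a b (N + p))^[s N] fun v => (jacN a b k).eval (gridPt p N v))
      (C (Real.exp (-(t * jacK a b k))) * jacN a b k) := by
  intro ε hε
  have hm := tendsto_timeScale a b p
  have hsm := tendsto_steps_div a b p hs
  have hpow := GridTendsto.smul_eval (p := p) (tendsto_eigen_pow (jacK a b k) hm hsm) (jacN a b k)
  have hKm : ∀ᶠ N in atTop, |jacK a b k / timeScale a b p N| ≤ 1 := by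
    have := (hm.const_div_atTop (jacK a b k)).abs
    rw [abs_zero] at this
    exact this.eventually_le_const one_pos
  have hKn : 0 ≤ jacK a b k := by
    rw [jacK]
    rcases k with _ | k
    · simp
    · have : (0 : ℝ) ≤ k := by positivity
      push_cast
      exact mul_nonneg (by positivity) (by linarith)
  have hgen := gridTendsto_generator ha hb p (jacN a b k) (ε / 2 / (|t| + 1)) (by positivity)
  filter_upwards [hpow (ε / 2) (by positivity), hgen, hKm, eventually_ge_atTop 1,
    hsm.eventually_le_const (show t < |t| + 1 by linarith [le_abs_self t])]
    with N h1 h2 h3 h4 h5 v hv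
  have hmpos : 0 < timeScale a b p N := hahnDenom_pos ha hb (by omega)
  have h6 : |1 - jacK a b k / timeScale a b p N| ≤ 1 := by
    have := abs_le.1 h3
    have : 0 ≤ jacK a b k / timeScale a b p N := div_nonneg hKn hmpos.le
    rw [abs_le]
    constructor <;> linarith
  -- there are `s N = O(N ^ 2)` steps, and each of them costs an error of order `o(N ^ (-2))`
  have h7 := abs_hahnOp_iterate_sub_le ha hb (f := fun v => (jacN a b k).eval (gridPt p N v))
    (δ := ε / 2 / (|t| + 1) / timeScale a b p N) h6 (by
      intro v hv
      have h8 := h2 v hv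
      rw [jacD_jacN ha, eval_neg, eval_mul, eval_C, sub_neg_eq_add] at h8
      change |timeScale a b p N * _ + jacK a b k * _| ≤ _ at h8
      rw [le_div_iff₀ hmpos]
      nth_rewrite 2 [← abs_of_pos hmpos]
      rw [← abs_mul]
      refine (congrArg abs ?_).trans_le h8
      have h9 : jacK a b k / timeScale a b p N * timeScale a b p N = jacK a b k :=
        div_mul_cancel₀ _ hmpos.ne'
      linear_combination (jacN a b k).eval (gridPt p N v) * h9) (s N) v hv
  have h8 := h1 v hv
  have h9 : (s N : ℝ) * (ε / 2 / (|t| + 1) / timeScale a b p N) ≤ ε / 2 := by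
    calc _ = (s N : ℝ) / timeScale a b p N * (ε / 2 / (|t| + 1)) := by ring
      _ ≤ (|t| + 1) * (ε / 2 / (|t| + 1)) := mul_le_mul_of_nonneg_right h5 (by positivity)
      _ = ε / 2 := by field_simp
  calc _ = |((hahnOp a b (N + p))^[s N] (fun v => (jacN a b k).eval (gridPt p N v)) v -
        (1 - jacK a b k / timeScale a b p N) ^ s N * (jacN a b k).eval (gridPt p N v)) +
        ((1 - jacK a b k / timeScale a b p N) ^ s N * (jacN a b k).eval (gridPt p N v) -
        (C (Real.exp (-(t * jacK a b k))) * jacN a b k).eval (gridPt p N v))| := by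
        congr 1; ring
    _ ≤ _ := (abs_add_le _ _).trans (by linarith)

/-- The rescaled one-particle chain converges to the Jacobi semigroup. -/
theorem GridTendsto.iterate {a b : ℝ} (ha : -1 < a) (hb : -1 < b) {p : ℕ} {F : ℕ → ℕ → ℝ}
    {f : ℝ[X]} (hF : GridTendsto p F f) {s : ℕ → ℕ} {t : ℝ}
    (hs : Tendsto (fun N => (s N : ℝ) / (N : ℝ) ^ 2) atTop (𝓝 t)) :
    GridTendsto p (fun N => (hahnOp a b (N + p))^[s N] (F N)) (jacS a b t f) := by
  have hd : f.degree < (f.natDegree + 1 : ℕ) := by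
    refine degree_le_natDegree.trans_lt ?_
    exact_mod_cast Nat.lt_succ_self _
  have h1 : GridTendsto p (fun N => (hahnOp a b (N + p))^[s N] fun v => f.eval (gridPt p N v))
      (jacS a b t f) := by
    have h2 := GridTendsto.sum (p := p) (Finset.range (f.natDegree + 1)) (fun k _ =>
      (gridTendsto_iterate_jacN ha hb p k hs).mul_eval (C (jacIP a b (jacN a b k) f)))
    have e1 : ∀ N, (hahnOp a b (N + p))^[s N] (fun v => f.eval (gridPt p N v)) =
        ∑ k ∈ Finset.range (f.natDegree + 1),
          (fun v => (C (jacIP a b (jacN a b k) f)).eval (gridPt p N v)) *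
          (hahnOp a b (N + p))^[s N] (fun v => (jacN a b k).eval (gridPt p N v)) := by
      intro N
      have e3 : (fun v => f.eval (gridPt p N v)) = ∑ k ∈ Finset.range (f.natDegree + 1),
          jacIP a b (jacN a b k) f • fun v => (jacN a b k).eval (gridPt p N v) := by
        funext v
        conv_lhs => rw [eq_sum_jacIP ha hb hd]
        simp [eval_finsetSum]
      rw [e3, hahnOp_iterate, map_sum]
      refine Finset.sum_congr rfl fun k _ => ?_
      rw [map_smul]
      funext v
      simp
    have e2 : jacS a b t f = ∑ k ∈ Finset.range (f.natDegree + 1),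
        C (jacIP a b (jacN a b k) f) * (C (Real.exp (-(t * jacK a b k))) * jacN a b k) := by
      refine Finset.sum_congr rfl fun k _ => ?_
      rw [C_mul]; ring
    simp only [e1, e2]
    exact h2
  intro ε hε
  filter_upwards [h1 (ε / 2) (by positivity), hF (ε / 2) (by positivity)] with N h2 h3 v hv
  have h4 := abs_hahnOp_iterate_le ha hb (f := F N - fun v => f.eval (gridPt p N v)) h3 (s N) v hv
  rw [hahnOp_iterate, map_sub, Pi.sub_apply, ← hahnOp_iterate] at h4
  have h5 := h2 v hv
  calc _ = |((hahnOp a b (N + p))^[s N] (F N) v -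
        (hahnOp a b (N + p))^[s N] (fun v => f.eval (gridPt p N v)) v) +
        ((hahnOp a b (N + p))^[s N] (fun v => f.eval (gridPt p N v)) v -
          (jacS a b t f).eval (gridPt p N v))| := by congr 1; ring
    _ ≤ _ := (abs_add_le _ _).trans (by linarith)

/-- The mean with respect to the normalized Hahn weight. -/
def hahnMean (a b : ℝ) (n : ℕ) (f : ℕ → ℝ) : ℝ := ∑ v : Fin n, hahnProb a b n v * f v

theorem sum_hahnWt_pos {a b : ℝ} (ha : -1 < a) (hb : -1 < b) {n : ℕ} (hn : 0 < n) :
    0 < ∑ v : Fin n, hahnWt a b n v := by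
  have : Nonempty (Fin n) := ⟨⟨0, hn⟩⟩
  exact Finset.sum_pos (fun v _ => hahnWt_pos ha hb v.2) Finset.univ_nonempty

theorem hahnMean_const {a b : ℝ} (ha : -1 < a) (hb : -1 < b) {n : ℕ} (hn : 0 < n) (c : ℝ) :
    hahnMean a b n (fun _ => c) = c := by
  simp only [hahnMean, hahnProb, ← Finset.sum_mul, ← Finset.sum_div]
  rw [div_self (sum_hahnWt_pos ha hb hn).ne', one_mul]

theorem abs_hahnMean_le {a b : ℝ} (ha : -1 < a) (hb : -1 < b) {n : ℕ} (hn : 0 < n) {f : ℕ → ℝ}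
    {ε : ℝ} (hf : ∀ v < n, |f v| ≤ ε) : |hahnMean a b n f| ≤ ε := by
  have hp : ∀ v : Fin n, 0 ≤ hahnProb a b n v := fun v =>
    div_nonneg (hahnWt_pos ha hb v.2).le (sum_hahnWt_pos ha hb hn).le
  rw [← hahnMean_const ha hb hn ε, hahnMean, hahnMean]
  refine (Finset.abs_sum_le_sum_abs _ _).trans (Finset.sum_le_sum fun v _ => ?_)
  rw [abs_mul, abs_of_nonneg (hp v)]
  exact mul_le_mul_of_nonneg_left (hf v v.2) (hp v)

theorem hahnMean_smul (a b : ℝ) (n : ℕ) (c : ℝ) (f : ℕ → ℝ) :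
    hahnMean a b n (fun v => c * f v) = c * hahnMean a b n f := by
  simp only [hahnMean, Finset.mul_sum]
  exact Finset.sum_congr rfl fun v _ => by ring

theorem hahnMean_sub (a b : ℝ) (n : ℕ) (f g : ℕ → ℝ) :
    hahnMean a b n (fun v => f v - g v) = hahnMean a b n f - hahnMean a b n g := by
  simp only [hahnMean, mul_sub, Finset.sum_sub_distrib]

/-- Stationarity, for the mean. -/
theorem hahnMean_hahnOp {a b : ℝ} (ha : -1 < a) (hb : -1 < b) {n : ℕ} (hn : 0 < n) (f : ℕ → ℝ) :
    hahnMean a b n (hahnOp a b n f) = hahnMean a b n f := by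
  have := sum_hahnWt_mul_hahnOp ha hb hn f
  simp only [hahnMean, hahnProb, div_mul_eq_mul_div, ← Finset.sum_div]
  rw [this]

/-- The mean of a Jacobi polynomial of positive degree tends to zero: the generator has mean zero, and
in the limit it multiplies the polynomial by a non-zero eigenvalue. -/
theorem tendsto_hahnMean_jacN {a b : ℝ} (ha : -1 < a) (hb : -1 < b) (p k : ℕ) (hk : k ≠ 0) :
    Tendsto (fun N => hahnMean a b (N + p) fun v => (jacN a b k).eval (gridPt p N v)) atTop
      (𝓝 0) := by
  have hK : 0 < jacK a b k := by
    rw [jacK]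
    have : (1 : ℝ) ≤ k := by exact_mod_cast Nat.one_le_iff_ne_zero.2 hk
    exact mul_pos (by linarith) (by linarith)
  rw [Metric.tendsto_nhds]
  intro ε hε
  filter_upwards [gridTendsto_generator ha hb p (jacN a b k) (jacK a b k * (ε / 2))
    (by positivity), eventually_ge_atTop 1] with N h1 hN
  have hn : 0 < N + p := by omega
  have h2 := abs_hahnMean_le ha hb hn h1
  rw [hahnMean_sub, hahnMean_smul, hahnMean_sub, hahnMean_hahnOp ha hb hn, sub_self, mul_zero,
    zero_sub, abs_neg, jacD_jacN ha] at h2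
  have h3 : (fun v => (-(C ((k : ℝ) * (k + a + b + 1)) * jacN a b k)).eval (gridPt p N v)) =
      fun v => -jacK a b k * (jacN a b k).eval (gridPt p N v) := by
    funext v
    rw [eval_neg, eval_mul, eval_C, jacK]
    ring
  rw [h3, hahnMean_smul, abs_mul, abs_neg, abs_of_pos hK] at h2
  have h4 := le_of_mul_le_mul_left h2 hK
  rw [Real.dist_eq, sub_zero]
  linarith

/-- The Hahn weights converge to the Jacobi weight. -/
theorem GridTendsto.hahnMean {a b : ℝ} (ha : -1 < a) (hb : -1 < b) {p : ℕ} {F : ℕ → ℕ → ℝ}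
    {f : ℝ[X]} (hF : GridTendsto p F f) :
    Tendsto (fun N => hahnMean a b (N + p) (F N)) atTop (𝓝 ((jacH a b 0)⁻¹ * jacIP a b 1 f)) := by
  have hd : f.degree < (f.natDegree + 1 : ℕ) := by
    refine degree_le_natDegree.trans_lt ?_
    exact_mod_cast Nat.lt_succ_self _
  have h0 : jacN a b 0 = C (√(jacH a b 0))⁻¹ := by rw [jacN, jacP_zero, mul_one]
  have h1 : Tendsto (fun N => _root_.hahnMean a b (N + p) fun v => f.eval (gridPt p N v)) atTop
      (𝓝 ((jacH a b 0)⁻¹ * jacIP a b 1 f)) := by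
    have e1 : ∀ N, (_root_.hahnMean a b (N + p) fun v => f.eval (gridPt p N v)) =
        ∑ k ∈ Finset.range (f.natDegree + 1), jacIP a b (jacN a b k) f *
          _root_.hahnMean a b (N + p) fun v => (jacN a b k).eval (gridPt p N v) := by
      intro N
      simp only [← hahnMean_smul]
      simp only [_root_.hahnMean]
      rw [Finset.sum_comm]
      refine Finset.sum_congr rfl fun v _ => ?_
      rw [← Finset.mul_sum]
      congr 1
      conv_lhs => rw [eq_sum_jacIP ha hb hd]
      simp [eval_finsetSum]
    simp only [e1]
    simp only [Finset.sum_range_succ']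
    have h2 : (jacH a b 0)⁻¹ * jacIP a b 1 f =
        ∑ k ∈ Finset.range f.natDegree, jacIP a b (jacN a b (k + 1)) f * 0 +
          jacIP a b (jacN a b 0) f * (√(jacH a b 0))⁻¹ := by
      have h3 : jacIP a b (jacN a b 0) f = (√(jacH a b 0))⁻¹ * jacIP a b 1 f := by
        rw [h0, jacIP, jacIP, ← integral_const_mul]
        refine integral_congr_ae (.of_forall fun x => ?_)
        simp only [eval_C, eval_one]
        ring
      rw [h3, mul_right_comm, ← mul_inv, Real.mul_self_sqrt (jacH_pos ha hb 0).le]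
      simp
    rw [h2]
    refine Tendsto.add (tendsto_finsetSum _ fun k _ => Tendsto.const_mul _
      (tendsto_hahnMean_jacN ha hb p (k + 1) (by omega))) (Tendsto.const_mul _ ?_)
    refine tendsto_const_nhds.congr' ?_
    filter_upwards [eventually_ge_atTop 1] with N hN
    simp only [h0, eval_C]
    rw [hahnMean_const ha hb (by omega)]
  rw [Metric.tendsto_nhds] at h1 ⊢
  intro ε hε
  filter_upwards [h1 (ε / 2) (by positivity), hF (ε / 3) (by positivity), eventually_ge_atTop 1]
    with N h2 h3 hN
  have h4 := abs_hahnMean_le ha hb (show 0 < N + p by omega) h3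
  rw [hahnMean_sub] at h4
  rw [Real.dist_eq] at h2 ⊢
  calc _ = |(_root_.hahnMean a b (N + p) (F N) -
          _root_.hahnMean a b (N + p) fun v => f.eval (gridPt p N v)) +
          ((_root_.hahnMean a b (N + p) fun v => f.eval (gridPt p N v)) -
            (jacH a b 0)⁻¹ * jacIP a b 1 f)| := by congr 1; ring
    _ < ε := (abs_add_le _ _).trans_lt (by linarith)

end Semigroup

end

noncomputable section

/-! ### The limit of multiplicative statistics -/

section MultiplicativeStatistics

open Polynomial

/-- The action on polynomials of the Jacobi semigroup, started at time `t` and run up to time `T`,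
with multiplication by `g i, …, g (i + r - 1)` at the times `τ i, …, τ (i + r - 1)`; the
continuous-time analogue of `evolN`. -/
def evolLim (a b : ℝ) (τ : ℕ → ℝ) (T : ℝ) (g : ℕ → ℝ[X]) (φ : ℝ[X]) : ℕ → ℝ → ℕ → ℝ[X]
  | 0, t, _ => jacS a b (T - t) φ
  | r + 1, t, i => jacS a b (τ i - t) (g i * evolLim a b τ T g φ r (τ i) (i + 1))

theorem tendsto_stepCount_div (t : ℝ≥0) :
    Tendsto (fun N => (stepCount N t : ℝ) / (N : ℝ) ^ 2) atTop (𝓝 t) := by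
  have h1 : Tendsto (fun N : ℕ => (N : ℝ) ^ 2) atTop atTop :=
    (tendsto_pow_atTop two_ne_zero).comp tendsto_natCast_atTop_atTop
  exact (tendsto_nat_floor_mul_div_atTop t.2).comp h1

theorem stepCount_mono (N : ℕ) : Monotone (stepCount N) := fun _ _ h =>
  Nat.floor_mono (mul_le_mul_of_nonneg_right (NNReal.coe_le_coe.2 h) (by positivity))

/-- Convergence of the one-particle evolution with insertions. -/
theorem gridTendsto_evolN {a b : ℝ} (ha : -1 < a) (hb : -1 < b) (p : ℕ) {τ : ℕ → ℝ≥0}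
    (hτ : Monotone τ) {T : ℝ≥0} (hT : ∀ j, τ j ≤ T) (g : ℕ → ℝ[X]) (φ : ℝ[X]) :
    ∀ (r : ℕ) (t : ℝ≥0) (i : ℕ), t ≤ τ i →
      GridTendsto p (fun N => evolN (hahnOp a b (N + p)) (stepCount N T) (fun j => stepCount N (τ j))
        (fun j v => (g j).eval (gridPt p N v)) (fun v => φ.eval (gridPt p N v)) r
        (stepCount N t) i) (evolLim a b (fun j => τ j) T g φ r t i) := by
  have hsub : ∀ {t u : ℝ≥0}, t ≤ u → Tendsto
      (fun N => ((stepCount N u - stepCount N t : ℕ) : ℝ) / (N : ℝ) ^ 2) atTop (𝓝 (u - t)) := by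
    intro t u htu
    refine ((tendsto_stepCount_div u).sub (tendsto_stepCount_div t)).congr fun N => ?_
    rw [Nat.cast_sub (stepCount_mono N htu), sub_div]
  intro r
  induction r with
  | zero =>
    intro t i ht
    exact (gridTendsto_eval p φ).iterate ha hb (hsub (ht.trans (hT i)))
  | succ r ih =>
    intro t i ht
    exact ((ih (τ i) (i + 1) (hτ (Nat.le_succ i))).mul_eval (g i)).iterate ha hb (hsub ht)

/-- The eigenvalues of the one-particle chain are exact: they involve the Jacobi eigenvalues without an
error term. -/
theorem hahnEigen_eq {a b : ℝ} (ha : -1 < a) (hb : -1 < b) (p : ℕ) {N : ℕ} (hN : 1 ≤ N) (i : ℕ) :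
    hahnEigen a b (N + p) i = 1 - jacK a b i / timeScale a b p N := by
  have hmpos : 0 < timeScale a b p N := hahnDenom_pos ha hb (by omega)
  rw [eq_sub_iff_add_eq]
  change _ / timeScale a b p N + _ = _
  rw [← add_div, div_eq_one_iff_eq hmpos.ne', jacK, timeScale]
  ring

/-- The limit of the normalization in `sum_pathWt_chain`. -/
theorem tendsto_prod_hahnEigen {a b : ℝ} (ha : -1 < a) (hb : -1 < b) (p : ℕ) (T : ℝ≥0) :
    Tendsto (fun N => ((∏ i : Fin p, hahnEigen a b (N + p) i)⁻¹) ^ stepCount N T) atTop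
      (𝓝 (∏ i : Fin p, Real.exp (T * jacK a b i))) := by
  have h1 : ∀ i : Fin p, Tendsto (fun N =>
      ((1 - jacK a b i / timeScale a b p N) ^ stepCount N T)⁻¹) atTop
      (𝓝 (Real.exp (T * jacK a b i))) := fun i => by
    have := (tendsto_eigen_pow (jacK a b i) (tendsto_timeScale a b p)
      (tendsto_steps_div a b p (tendsto_stepCount_div T))).inv₀ (Real.exp_ne_zero _)
    rwa [← Real.exp_neg, neg_neg] at this
  refine (tendsto_finsetProd _ fun i _ => h1 i).congr' ?_
  filter_upwards [eventually_ge_atTop 1] with N hN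
  rw [inv_pow, ← Finset.prod_pow, ← Finset.prod_inv_distrib]
  exact Finset.prod_congr rfl fun i _ => by rw [hahnEigen_eq ha hb p hN]

/-- Up to a constant, the Vandermonde determinant is the Slater determinant of the Jacobi polynomials. -/
theorem exists_slater_jacN {a b : ℝ} (ha : -1 < a) (hb : -1 < b) (p : ℕ) {N : ℕ} (hN : 2 ≤ N) :
    ∃ c : ℝ, c ≠ 0 ∧ ∀ x : Fin p → ℕ,
      slater (fun i : Fin p => fun v => (jacN a b i).eval (gridPt p N v)) x = c * vdm x := by
  have h2 : (2 : ℝ) ≤ N := by exact_mod_cast hN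
  have hL : (N : ℝ) + p - 1 ≠ 0 := by linarith
  set e : ℝ := ((N : ℝ) + p - 1)⁻¹ with he
  have he0 : e ≠ 0 := inv_ne_zero hL
  have hcoeff : ∀ i : ℕ, ((jacN a b i).comp (C e * X)).coeff i = (jacN a b i).coeff i * e ^ i :=
    fun i => comp_C_mul_X_coeff
  have h1 : ∀ x : Fin p → ℕ, slater (fun i : Fin p => fun v => (jacN a b i).eval (gridPt p N v)) x =
      (∏ i : Fin p, ((jacN a b i).comp (C e * X)).coeff i) * vdm x := fun x => by
    rw [vdm, ← det_eval_eq_vandermonde]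
    · simp only [slater, eval_comp, eval_mul, eval_C, eval_X, gridPt, he]
      simp only [div_eq_inv_mul]
    · intro i
      refine natDegree_comp_le.trans ?_
      calc _ ≤ (i : ℕ) * 1 := Nat.mul_le_mul (natDegree_jacN_le a b i)
            (natDegree_C_mul_le e X |>.trans natDegree_X_le)
        _ = i := mul_one _
  refine ⟨_, ?_, h1⟩
  refine Finset.prod_ne_zero_iff.2 fun i _ => ?_
  rw [hcoeff]
  exact mul_ne_zero (coeff_jacN_ne_zero ha hb i) (pow_ne_zero _ he0)

theorem maxStep_eq (N : ℕ) {n : ℕ} (t : Fin n → ℝ≥0) :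
    maxStep N t = stepCount N (Finset.univ.sup t) := by
  rw [maxStep]
  exact (Finset.apply_sup_eq_sup_comp_of_linearOrder (stepCount N) (stepCount_mono N)
    (by simp [stepCount])).symm

variable {p : ℕ} {z' w' : ℝ}

/-- Multiplicative statistics before the limit. -/
theorem integral_prelimitLaw_prod (hz : (p : ℝ) - 1 < z') (hw : -1 < w') {N : ℕ} (hN : 2 ≤ N)
    {M : ℕ} {τ : ℕ → ℝ≥0} (hτ : Monotone τ) (hT : ∀ j, τ j ≤ Finset.univ.sup fun i : Fin M => τ i)
    (g : ℕ → ℝ[X]) :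
    ∫ y, ∏ i : Fin M, ∏ k, (g i).eval (y i k) ∂(prelimitLaw p z' w' N fun i : Fin M => τ i) =
      ((∏ i : Fin p, hahnEigen (z' - p) w' (N + p) i)⁻¹) ^
          stepCount N (Finset.univ.sup fun i : Fin M => τ i) *
        ((Matrix.of fun i j : Fin p => hahnMean (z' - p) w' (N + p) fun v =>
          (jacN (z' - p) w' i).eval (gridPt p N v) *
            evolN (hahnOp (z' - p) w' (N + p)) (stepCount N (Finset.univ.sup fun i : Fin M => τ i))
              (fun j => stepCount N (τ j)) (fun j v => (g j).eval (gridPt p N v))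
              (fun v => (jacN (z' - p) w' j).eval (gridPt p N v)) M 0 0 v).det /
        (Matrix.of fun i j : Fin p => hahnMean (z' - p) w' (N + p) fun v =>
          (jacN (z' - p) w' i).eval (gridPt p N v) *
            (jacN (z' - p) w' j).eval (gridPt p N v)).det) := by
  have ha : -1 < z' - p := by linarith
  obtain ⟨c, hc, hΦ⟩ := exists_slater_jacN ha hw p hN
  -- the factor at the step `k` collects all `g j` whose time falls into the step `k`
  set G : ℕ → ℕ → ℝ := fun k => ∏ j ∈ Finset.range M, if stepCount N (τ (0 + j)) = k then
    (fun v => (g (0 + j)).eval (gridPt p N v)) else 1 with hG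
  have hle : ∀ j, stepCount N (τ j) ≤ maxStep N fun i : Fin M => τ i := fun j => by
    rw [maxStep_eq]
    exact stepCount_mono N (hT j)
  have h1 := sum_pathWt_chain hz hw N G _ hc hΦ
    (maxStep N fun i : Fin M => τ i)
  have h2 : ∀ b : ℕ, backwardOp (hahnOp (z' - p) w' (N + p)) G
      (fun v => (jacN (z' - p) w' b).eval (gridPt p N v)) 0
      (maxStep N fun i : Fin M => τ i) = _ := fun b =>
    backwardOp_eq_evolN (hahnOp (z' - p) w' (N + p))
    (maxStep N fun i : Fin M => τ i) (σ := fun j => stepCount N (τ j))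
    ((stepCount_mono N).comp hτ) (fun j v => (g j).eval (gridPt p N v))
    (fun v => (jacN (z' - p) w' b).eval (gridPt p N v)) M 0 0 (Nat.zero_le _)
    (fun j _ => ⟨Nat.zero_le _, hle _⟩)
  simp only [h2] at h1
  simp only [hahnMean, ← mul_assoc]
  rw [← maxStep_eq, ← h1, integral_prelimitLaw hz hw]
  refine Finset.sum_congr rfl fun x _ => ?_
  congr 1
  simp only [hG, Finset.prod_apply, zero_add]
  have h3 : ∀ k : Fin ((maxStep N fun i : Fin M => τ i) + 1),
      ∏ j : Fin p, ∏ c ∈ Finset.range M, (if stepCount N (τ c) = k then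
        (fun v => (g c).eval (gridPt p N v)) else 1) ((x k).1 j : ℕ) =
      ∏ i : Fin M, if stepCount N (τ i) = k then
        ∏ j : Fin p, (g i).eval (gridPt p N ((x k).1 j)) else 1 := by
    intro k
    rw [Finset.prod_comm, Finset.prod_range]
    refine Finset.prod_congr rfl fun i _ => ?_
    split_ifs <;> simp
  simp only [h3]
  conv_rhs => rw [Finset.prod_comm]
  refine Finset.prod_congr rfl fun i _ => ?_
  have h4 : stepCount N (τ i) < (maxStep N fun i : Fin M => τ i) + 1 := Nat.lt_succ_of_le (hle i)
  rw [Finset.prod_eq_single (⟨stepCount N (τ i), h4⟩ : Fin _)]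
  · rw [if_pos rfl]
    rfl
  · intro k _ hk
    rw [if_neg]
    exact fun h => hk (Fin.ext h.symm)
  · simp

/-- Multiplicative statistics of the stationary chain converge to `p × p` determinants built from
the Jacobi semigroup. -/
theorem tendsto_integral_prelimitLaw_prod (hz : (p : ℝ) - 1 < z') (hw : -1 < w')
    {M : ℕ} {τ : ℕ → ℝ≥0} (hτ : Monotone τ) (hT : ∀ j, τ j ≤ Finset.univ.sup fun i : Fin M => τ i)
    (g : ℕ → ℝ[X]) :
    Tendsto (fun N => ∫ y, ∏ i : Fin M, ∏ k, (g i).eval (y i k)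
      ∂(prelimitLaw p z' w' N fun i : Fin M => τ i)) atTop
      (𝓝 ((∏ i : Fin p, Real.exp
          ((Finset.univ.sup fun i : Fin M => τ i : ℝ≥0) * jacK (z' - p) w' i)) *
        (Matrix.of fun i j : Fin p => jacIP (z' - p) w' (jacN (z' - p) w' i)
          (evolLim (z' - p) w' (fun j => τ j) (Finset.univ.sup fun i : Fin M => τ i : ℝ≥0) g
            (jacN (z' - p) w' j) M 0 0)).det)) := by
  have ha : -1 < z' - p := by linarith
  set T : ℝ≥0 := Finset.univ.sup fun i : Fin M => τ i
  set h0 := (jacH (z' - p) w' 0)⁻¹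
  have h0' : h0 ≠ 0 := inv_ne_zero (jacH_pos ha hw 0).ne'
  have hmul : ∀ f g : ℝ[X], jacIP (z' - p) w' 1 (f * g) = jacIP (z' - p) w' f g := fun f g => by
    rw [jacIP_mul_left, one_mul]
  have h1 : Tendsto (fun N => (Matrix.of fun i j : Fin p => hahnMean (z' - p) w' (N + p) fun v =>
          (jacN (z' - p) w' i).eval (gridPt p N v) *
            evolN (hahnOp (z' - p) w' (N + p)) (stepCount N T)
              (fun j => stepCount N (τ j)) (fun j v => (g j).eval (gridPt p N v))
              (fun v => (jacN (z' - p) w' j).eval (gridPt p N v)) M 0 0 v).det) atTop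
      (𝓝 (h0 • Matrix.of fun i j : Fin p => jacIP (z' - p) w' (jacN (z' - p) w' i)
          (evolLim (z' - p) w' (fun j => τ j) T g (jacN (z' - p) w' j) M 0 0)).det) := by
    refine ((continuous_id.matrix_det).tendsto _).comp ?_
    refine tendsto_pi_nhds.2 fun i => tendsto_pi_nhds.2 fun j => ?_
    have h2 := gridTendsto_evolN ha hw p hτ hT g (jacN (z' - p) w' j) M 0 0 bot_le
    have h3 := (h2.mul_eval (jacN (z' - p) w' i)).hahnMean ha hw
    rw [hmul] at h3
    have h4 : ∀ N, stepCount N 0 = 0 := fun N => by simp [stepCount]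
    simp only [h4, NNReal.coe_zero] at h3
    exact h3
  -- the Gram matrix in the denominator tends to a multiple of the identity
  have h2 : Tendsto (fun N => (Matrix.of fun i j : Fin p => hahnMean (z' - p) w' (N + p) fun v =>
          (jacN (z' - p) w' i).eval (gridPt p N v) *
            (jacN (z' - p) w' j).eval (gridPt p N v)).det) atTop
      (𝓝 (h0 • (1 : Matrix (Fin p) (Fin p) ℝ)).det) := by
    refine ((continuous_id.matrix_det).tendsto _).comp ?_
    refine tendsto_pi_nhds.2 fun i => tendsto_pi_nhds.2 fun j => ?_
    have h3 := ((gridTendsto_eval p (jacN (z' - p) w' j)).mul_eval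
      (jacN (z' - p) w' i)).hahnMean ha hw
    rw [hmul, jacIP_jacN ha hw] at h3
    have h4 : (h0 • (1 : Matrix (Fin p) (Fin p) ℝ)) i j = h0 * if (i : ℕ) = j then 1 else 0 := by
      simp [Matrix.one_apply, Fin.ext_iff]
    change Tendsto _ _ (𝓝 ((h0 • (1 : Matrix (Fin p) (Fin p) ℝ)) i j))
    rw [h4]
    exact h3
  have h3 := (tendsto_prod_hahnEigen ha hw p T).mul (h1.div h2 (by simp [h0']))
  have h4 : ∀ A : Matrix (Fin p) (Fin p) ℝ,
      (h0 • A).det / (h0 • (1 : Matrix (Fin p) (Fin p) ℝ)).det = A.det := fun A => by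
    rw [Matrix.det_smul, Matrix.det_smul, Matrix.det_one, mul_one,
      mul_div_cancel_left₀ _ (pow_ne_zero _ h0')]
  rw [h4] at h3
  refine h3.congr' ?_
  filter_upwards [eventually_ge_atTop 2] with N hN
  exact (integral_prelimitLaw_prod hz hw hN hτ hT g).symm

end MultiplicativeStatistics

end

noncomputable section

/-! ### Fredholm expansions -/

section Fredholm

open Matrix

/-- The expansion of `det (1 + S C)`, with `S` diagonal, in principal minors of `C`. -/
theorem det_one_add_smul_rows {Y R : Type*} [Fintype Y] [DecidableEq Y] [CommRing R] (s : Y → R)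
    (A : Matrix Y Y R) :
    (1 + Matrix.of fun x y => s x * A x y).det =
      ∑ S : Finset Y, (∏ y ∈ S, s y) * (A.submatrix (↑) (↑) : Matrix S S R).det := by
  have h1 : (1 + Matrix.of fun x y => s x * A x y).det =
      (detRowAlternating : (Y → R) [⋀^Y]→ₗ[R] R)
        ((fun x => s x • A x) + fun x => (1 : Matrix Y Y R) x) := by
    rw [add_comm]; rfl
  rw [h1, AlternatingMap.map_add_univ]
  refine Finset.sum_congr rfl fun S _ => ?_
  have h2 : S.piecewise (fun x => s x • A x) (fun x => (1 : Matrix Y Y R) x) =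
      fun x => (if x ∈ S then s x else 1) •
        S.piecewise (fun x => A x) (fun x => (1 : Matrix Y Y R) x) x := by
    funext x
    by_cases hx : x ∈ S <;> simp [hx]
  rw [h2, AlternatingMap.map_smul_univ, smul_eq_mul]
  congr 1
  · simp [Finset.prod_ite_mem]
  · exact det_piecewise_one_eq_submatrix_det A S

/-- The graph of a map, as a finite set of pairs. -/
def graphFinset {ι κ : Type*} [Fintype ι] [DecidableEq ι] [DecidableEq κ] (a : ι → κ) :
    Finset (ι × κ) :=
  Finset.univ.image fun i => (i, a i)

theorem mem_graphFinset {ι κ : Type*} [Fintype ι] [DecidableEq ι] [DecidableEq κ] {a : ι → κ}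
    {y : ι × κ} : y ∈ graphFinset a ↔ a y.1 = y.2 := by
  simp only [graphFinset, Finset.mem_image, Finset.mem_univ, true_and]
  constructor
  · rintro ⟨i, rfl⟩; rfl
  · intro h; exact ⟨y.1, Prod.ext rfl h⟩

/-- The minor on the graph of `a`, indexed by the domain of `a`. -/
theorem det_submatrix_graphFinset {ι κ R : Type*} [Fintype ι] [DecidableEq ι] [DecidableEq κ]
    [CommRing R] (A : Matrix (ι × κ) (ι × κ) R) (a : ι → κ) :
    (A.submatrix (↑) (↑) : Matrix (graphFinset a) (graphFinset a) R).det =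
      (Matrix.of fun i j => A (i, a i) (j, a j)).det := by
  let e : ι ≃ graphFinset a :=
    { toFun := fun i => ⟨(i, a i), mem_graphFinset.2 rfl⟩
      invFun := fun y => y.1.1
      left_inv := fun i => rfl
      right_inv := fun y => Subtype.ext (Prod.ext rfl (mem_graphFinset.1 y.2)) }
  rw [← det_submatrix_equiv_self e]
  rfl

/-- A set of pairs contributes to the coefficient of the product of all variables exactly if it is the
graph of a map. -/
theorem coeff_sum_prod_fst {ι κ : Type*} [Fintype ι] [DecidableEq ι] [Fintype κ] [DecidableEq κ]
    (c : Finset (ι × κ) → ℝ) :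
    (∑ S : Finset (ι × κ), MvPolynomial.C (c S) * ∏ y ∈ S, MvPolynomial.X y.1).coeff
      (∑ i, Finsupp.single i 1) = ∑ a : ι → κ, c (graphFinset a) := by
  have h1 : ∀ S : Finset (ι × κ), (MvPolynomial.C (c S) * ∏ y ∈ S, MvPolynomial.X y.1 :
      MvPolynomial ι ℝ) = MvPolynomial.monomial (∑ y ∈ S, Finsupp.single y.1 1) (c S) := by
    intro S
    rw [MvPolynomial.monomial_eq]
    congr 1
    induction S using Finset.induction_on with
    | empty => simp
    | insert y S hy ih =>
      rw [Finset.prod_insert hy, Finset.sum_insert hy, ih, Finsupp.prod_add_index']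
      · simp
      · simp
      · intro i m n; exact pow_add _ _ _
  simp only [h1, MvPolynomial.coeff_sum, MvPolynomial.coeff_monomial]
  rw [← Finset.sum_filter]
  symm
  have h2 : ∀ S : Finset (ι × κ), (∑ y ∈ S, Finsupp.single y.1 1 = ∑ i : ι, Finsupp.single i 1) ↔
      ∀ i, (S.filter fun y => y.1 = i).card = 1 := by
    intro S
    rw [Finsupp.ext_iff]
    refine forall_congr' fun i => ?_
    simp [Finsupp.finsetSum_apply, Finsupp.single_apply]
  refine Finset.sum_bij (fun a _ => graphFinset a) ?_ ?_ ?_ fun _ _ => rfl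
  · intro a _
    rw [Finset.mem_filter, h2]
    refine ⟨Finset.mem_univ _, fun i => Finset.card_eq_one.2 ⟨(i, a i), ?_⟩⟩
    ext y
    simp only [Finset.mem_filter, mem_graphFinset, Finset.mem_singleton, Prod.ext_iff]
    constructor
    · rintro ⟨h, rfl⟩; exact ⟨rfl, h.symm⟩
    · rintro ⟨rfl, h⟩; exact ⟨h.symm, rfl⟩
  · intro a _ b _ h
    funext i
    have h3 : (i, a i) ∈ graphFinset b := h ▸ mem_graphFinset.2 rfl
    exact (mem_graphFinset.1 h3).symm
  · intro S hS
    rw [Finset.mem_filter, h2] at hS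
    choose y hy using fun i => Finset.card_eq_one.1 (hS.2 i)
    have hy' : ∀ i, y i ∈ S ∧ (y i).1 = i := fun i => by
      have : y i ∈ S.filter fun z => z.1 = i := by rw [hy]; exact Finset.mem_singleton_self _
      exact Finset.mem_filter.1 this
    refine ⟨fun i => (y i).2, Finset.mem_univ _, ?_⟩
    ext z
    rw [mem_graphFinset]
    constructor
    · intro h
      have : z = y z.1 := Prod.ext (hy' _).2.symm h.symm
      rw [this]; exact (hy' _).1
    · intro h
      have : z ∈ S.filter fun x => x.1 = z.1 := Finset.mem_filter.2 ⟨h, rfl⟩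
      rw [hy, Finset.mem_singleton] at this
      exact (congrArg Prod.snd this).symm

/-- The coefficients of the product of all variables agree in two equal Fredholm expansions. -/
theorem sum_graphFinset_eq {ι κ κ' : Type*} [Fintype ι] [DecidableEq ι] [Fintype κ]
    [DecidableEq κ] [Fintype κ'] [DecidableEq κ'] (c : Finset (ι × κ) → ℝ)
    (c' : Finset (ι × κ') → ℝ)
    (h : ∀ s : ι → ℝ, ∑ S, (∏ y ∈ S, s y.1) * c S = ∑ S, (∏ y ∈ S, s y.1) * c' S) :
    ∑ a : ι → κ, c (graphFinset a) = ∑ a : ι → κ', c' (graphFinset a) := by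
  rw [← coeff_sum_prod_fst, ← coeff_sum_prod_fst]
  congr 1
  refine MvPolynomial.funext fun s => ?_
  simp only [map_sum, map_mul, map_prod, MvPolynomial.eval_C, MvPolynomial.eval_X]
  simpa only [mul_comm] using h s

/-- A product of linear factors as a Fredholm determinant. -/
theorem prod_one_add_eq_det {ι X R : Type*} [Fintype ι] [DecidableEq ι] [Fintype X]
    [DecidableEq X] [CommRing R] (h : ι → X → R) :
    ∏ x, (1 + ∑ i, h i x) =
      (1 + Matrix.of fun y z : ι × X => h y.1 y.2 * if y.2 = z.2 then 1 else 0).det := by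
  have h1 := det_one_add_mul_comm (Matrix.of fun (x : X) (y : ι × X) => if x = y.2 then (1 : R) else 0)
    (Matrix.of fun (y : ι × X) (x : X) => h y.1 y.2 * if y.2 = x then 1 else 0)
  have h2 : (Matrix.of fun (x : X) (y : ι × X) => if x = y.2 then (1 : R) else 0) *
      (Matrix.of fun (y : ι × X) (x : X) => h y.1 y.2 * if y.2 = x then 1 else 0) =
      diagonal fun x => ∑ i, h i x := by
    ext x x'
    simp only [mul_apply, of_apply, Fintype.sum_prod_type, diagonal_apply]
    split_ifs with hx
    · subst hx; simp
    · refine Finset.sum_eq_zero fun i _ => Finset.sum_eq_zero fun z _ => ?_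
      by_cases h3 : x = z
      · subst h3; simp [hx]
      · simp [h3]
  have h3 : (Matrix.of fun (y : ι × X) (x : X) => h y.1 y.2 * if y.2 = x then 1 else 0) *
      (Matrix.of fun (x : X) (y : ι × X) => if x = y.2 then (1 : R) else 0) =
      Matrix.of fun y z : ι × X => h y.1 y.2 * if y.2 = z.2 then 1 else 0 := by
    ext y z
    simp only [mul_apply, of_apply]
    simp
  rw [h2, h3, ← diagonal_one, diagonal_add, det_diagonal] at h1
  exact h1

theorem det_ite_eq {ι X R : Type*} [Fintype ι] [DecidableEq ι] [DecidableEq X] [CommRing R]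
    (x : ι → X) [Decidable (Function.Injective x)] :
    (Matrix.of fun i j => if x i = x j then (1 : R) else 0).det =
      if Function.Injective x then 1 else 0 := by
  split_ifs with hx
  · convert det_one (n := ι) (R := R)
    ext i j
    simp [one_apply, hx.eq_iff]
  · simp only [Function.Injective, not_forall] at hx
    obtain ⟨i, j, hij, hne⟩ := hx
    refine det_zero_of_row_eq hne ?_
    funext k
    simp [hij]

/-- The coefficient of the product of all variables in a product of linear factors. -/
theorem minor_prod_one_add {ι X R : Type*} [Fintype ι] [DecidableEq ι] [DecidableEq X]
    [CommRing R] (h : ι → X → R) (x : ι → X) [Decidable (Function.Injective x)] :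
    ((Matrix.of fun y z : ι × X => h y.1 y.2 * if y.2 = z.2 then 1 else 0).submatrix (↑) (↑) :
      Matrix (graphFinset x) (graphFinset x) R).det =
      if Function.Injective x then ∏ i, h i (x i) else 0 := by
  rw [det_submatrix_graphFinset]
  have h1 := det_mul_column (fun i => h i (x i)) (Matrix.of fun i j => if x i = x j then (1 : R) else 0)
  rw [det_ite_eq] at h1
  rw [mul_ite, mul_one, mul_zero] at h1
  exact h1

end Fredholm

/-! ### Time-ordered products -/

section TimeOrdered

open Matrix

variable {ι κ R : Type*} [Fintype ι] [Fintype κ] [DecidableEq κ] [CommRing R]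

/-- The time-ordered product `(1 + ∑_{m i = 0} B i) (1 + ∑_{m i = 1} B i) ⋯` with `r` factors. -/
def orderedProd (m : ι → ℕ) (B : ι → Matrix κ κ R) : ℕ → Matrix κ κ R
  | 0 => 1
  | r + 1 => orderedProd m B r * (1 + ∑ i, if m i = r then B i else 0)

/-- Telescoping of the time-ordered product. -/
theorem orderedProd_eq (m : ι → ℕ) (B : ι → Matrix κ κ R) (r : ℕ) :
    orderedProd m B r = 1 + ∑ i, if m i < r then orderedProd m B (m i) * B i else 0 := by
  induction r with
  | zero => simp [orderedProd]
  | succ r ih =>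
    rw [orderedProd, mul_add, mul_one]
    nth_rewrite 1 [ih]
    rw [add_assoc, Finset.mul_sum, ← Finset.sum_add_distrib]
    congr 1
    refine Finset.sum_congr rfl fun i _ => ?_
    rcases lt_trichotomy (m i) r with h | h | h
    · rw [if_pos h, if_neg h.ne, if_pos (by omega), mul_zero, add_zero]
    · rw [if_neg (by omega), if_pos h, if_pos (by omega), zero_add, h]
    · rw [if_neg (by omega), if_neg (by omega), if_neg (by omega), mul_zero, add_zero]

/-- The passage from a time-ordered product to the extended kernel: the correction `-1` appears
exactly for pairs of times in increasing order. -/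
theorem det_orderedProd [DecidableEq ι] (m : ι → ℕ) (B : ι → Matrix κ κ R) (P : Matrix κ κ R) {r : ℕ}
    (hr : ∀ i, m i < r) :
    (1 + P * (orderedProd m B r - 1)).det = (1 + Matrix.of fun x y : ι × κ =>
      (B x.1 * (P - if m x.1 < m y.1 then 1 else 0)) x.2 y.2).det := by
  set U : Matrix κ (ι × κ) R := Matrix.of fun a y => (P * orderedProd m B (m y.1)) a y.2
  set V : Matrix (ι × κ) κ R := Matrix.of fun y b => B y.1 y.2 b
  set N : Matrix (ι × κ) (ι × κ) R :=
    Matrix.of fun x y => if m x.1 < m y.1 then B x.1 x.2 y.2 else 0 with hN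
  set W : Matrix (ι × κ) (ι × κ) R := Matrix.of fun x y => (B x.1 * P) x.2 y.2 with hW
  have h1 : P * (orderedProd m B r - 1) = U * V := by
    rw [orderedProd_eq, add_sub_cancel_left, Finset.mul_sum]
    ext a b
    rw [Matrix.sum_apply, Matrix.mul_apply, Fintype.sum_prod_type]
    refine Finset.sum_congr rfl fun i _ => ?_
    rw [if_pos (hr i), ← mul_assoc, Matrix.mul_apply]
    rfl
  -- the resolvent identity, obtained from the telescoped product
  have h2 : V * U = W + V * U * N := by
    have hVU : ∀ x y : ι × κ, (V * U) x y = (B x.1 * (P * orderedProd m B (m y.1))) x.2 y.2 :=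
      fun x y => by rw [Matrix.mul_apply, Matrix.mul_apply]; rfl
    ext x y
    rw [hVU, orderedProd_eq, mul_add, mul_one, mul_add, Matrix.add_apply, Matrix.add_apply]
    congr 1
    rw [Finset.mul_sum, Finset.mul_sum, Matrix.sum_apply, Matrix.mul_apply (N := N),
      Fintype.sum_prod_type]
    refine Finset.sum_congr rfl fun i _ => ?_
    simp only [hVU, hN, of_apply]
    split_ifs with h
    · rw [← mul_assoc, ← mul_assoc, Matrix.mul_apply, mul_assoc]
    · simp
  -- `N` is strictly triangular with respect to the order of the times
  have h3 : (1 - N).det = 1 := by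
    have h4 : BlockTriangular (1 - N) fun x : ι × κ => m x.1 := by
      intro x y hxy
      have : x ≠ y := fun h => by simp [h] at hxy
      rw [Matrix.sub_apply, one_apply_ne this, hN, of_apply, if_neg (not_lt.2 (le_of_lt hxy)), sub_zero]
    rw [h4.det]
    refine Finset.prod_eq_one fun k _ => ?_
    convert det_one (n := {x : ι × κ // m x.1 = k}) (R := R)
    ext x y
    rw [toSquareBlock_def, of_apply, Matrix.sub_apply, hN, of_apply, if_neg (by rw [x.2, y.2]; exact lt_irrefl k),
      sub_zero, Matrix.one_apply, Matrix.one_apply]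
    simp [Subtype.ext_iff]
  have h5 : (1 + V * U) * (1 - N) = 1 + (W - N) := by
    rw [add_mul, one_mul, mul_sub, mul_one]
    nth_rewrite 1 [h2]
    abel
  have h6 : (1 + V * U).det = (1 + (W - N)).det := by
    rw [← h5, det_mul, h3, mul_one]
  rw [h1, det_one_add_mul_comm, h6]
  congr 2
  ext x y
  rw [Matrix.sub_apply, hW, hN, of_apply, of_apply, of_apply, mul_sub, Matrix.sub_apply]
  split_ifs <;> simp

/-- The top left `p × p` minor as a determinant of full size. -/
theorem det_submatrix_castLE {p D : ℕ} (hp : p ≤ D) (A : Matrix (Fin D) (Fin D) R) :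
    (A.submatrix (Fin.castLE hp) (Fin.castLE hp)).det =
      (1 + diagonal (fun i : Fin D => if (i : ℕ) < p then (1 : R) else 0) * (A - 1)).det := by
  set S : Finset (Fin D) := Finset.univ.filter fun i => (i : ℕ) < p with hS
  have h1 : 1 + diagonal (fun i : Fin D => if (i : ℕ) < p then (1 : R) else 0) * (A - 1) =
      Matrix.of (S.piecewise A.row (1 : Matrix (Fin D) (Fin D) R).row) := by
    ext i j
    rw [Matrix.add_apply, diagonal_mul, Matrix.sub_apply, of_apply]
    by_cases h : (i : ℕ) < p <;> simp [hS, Finset.piecewise, h]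
  rw [h1, det_piecewise_one_eq_submatrix_det]
  let e : Fin p ≃ S :=
    { toFun := fun i => ⟨Fin.castLE hp i, Finset.mem_filter.2 ⟨Finset.mem_univ _, i.2⟩⟩
      invFun := fun y => ⟨y.1, (Finset.mem_filter.1 y.2).2⟩
      left_inv := fun i => rfl
      right_inv := fun y => rfl }
  rw [← det_submatrix_equiv_self e]
  rfl

end TimeOrdered

end

noncomputable section

/-! ### Coordinates in the Jacobi basis -/

section Coordinates

open Polynomial

/-- Multiplication by `f`, conjugated by the Jacobi semigroup at time `t`, in the basis of
orthonormal Jacobi polynomials, truncated to `D × D`. -/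
def jacMat (a b : ℝ) (D : ℕ) (t : ℝ) (f : ℝ[X]) : Matrix (Fin D) (Fin D) ℝ :=
  Matrix.of fun i j => Real.exp (-(t * jacK a b i)) * jacIP a b (jacN a b i) (f * jacN a b j) *
    Real.exp (t * jacK a b j)

/-- The product `F i * F (i + 1) * ⋯ * F (i + r - 1)`. -/
def prodFrom {A : Type*} [Monoid A] (F : ℕ → A) : ℕ → ℕ → A
  | 0, _ => 1
  | r + 1, i => F i * prodFrom F r (i + 1)

theorem prodFrom_succ {A : Type*} [Monoid A] (F : ℕ → A) :
    ∀ r i, prodFrom F (r + 1) i = prodFrom F r i * F (i + r)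
  | 0, i => by simp [prodFrom]
  | r + 1, i => by
    rw [prodFrom, prodFrom_succ F r (i + 1), ← mul_assoc, prodFrom, show i + 1 + r = i + (r + 1) by
      ring]

theorem degree_mul_lt {d D : ℕ} {g h : ℝ[X]} (hg : g.natDegree ≤ d) (hh : h.degree < D) :
    (g * h).degree < (D + d : ℕ) := by
  by_cases h0 : h = 0
  · rw [h0, mul_zero, degree_zero]
    exact WithBot.bot_lt_coe _
  · have h1 := (natDegree_lt_iff_degree_lt h0).2 hh
    refine degree_le_natDegree.trans_lt ?_
    have h2 : (g * h).natDegree < D + d := natDegree_mul_le.trans_lt (by omega)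
    exact_mod_cast h2

theorem degree_evolLim_lt {a b : ℝ} (ha : -1 < a) (hb : -1 < b) (τ : ℕ → ℝ) (T : ℝ) {g : ℕ → ℝ[X]}
    {d : ℕ} (hg : ∀ l, (g l).natDegree ≤ d) {φ : ℝ[X]} {q : ℕ} (hφ : φ.degree < q) :
    ∀ r t i, (evolLim a b τ T g φ r t i).degree < (q + r * d : ℕ)
  | 0, t, i => by
    rw [zero_mul, add_zero]
    exact degree_jacS_lt ha hb _ hφ
  | r + 1, t, i => by
    refine degree_jacS_lt ha hb _ ?_
    rw [show q + (r + 1) * d = q + r * d + d by ring]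
    exact degree_mul_lt (hg i) (degree_evolLim_lt ha hb τ T hg hφ r (τ i) (i + 1))

/-- The evolution of a polynomial in the Jacobi basis is a product of the matrices `jacMat`. The
truncation at `D` is exact, since `r` multiplications by polynomials of degree at most `d` raise the
degree by at most `r d`. -/
theorem jacIP_evolLim {a b : ℝ} (ha : -1 < a) (hb : -1 < b) (τ : ℕ → ℝ) (T : ℝ) {g : ℕ → ℝ[X]}
    {d : ℕ} (hg : ∀ l, (g l).natDegree ≤ d) {D q : ℕ} (j : Fin D) (hj : (j : ℕ) < q) :
    ∀ r t i (k : Fin D), q + r * d ≤ D →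
      jacIP a b (jacN a b k) (evolLim a b τ T g (jacN a b j) r t i) =
        Real.exp (t * jacK a b k) *
          prodFrom (fun l => jacMat a b D (τ l) (g l)) r i k j * Real.exp (-(T * jacK a b j))
  | 0, t, i, k, _ => by
    rw [evolLim, jacIP_jacS ha hb, jacIP_jacN ha hb, prodFrom, Matrix.one_apply]
    by_cases h : k = j
    · subst h
      rw [if_pos rfl, if_pos rfl, mul_one, mul_one, ← Real.exp_add]
      congr 1; ring
    · rw [if_neg h, if_neg fun h' => h (Fin.ext h')]
      ring
  | r + 1, t, i, k, hD => by
    have hlt : (evolLim a b τ T g (jacN a b j) r (τ i) (i + 1)).degree < (D : ℕ) :=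
      (degree_evolLim_lt ha hb τ T hg (degree_jacN_lt a b hj) r (τ i) (i + 1)).trans_le
        (Nat.cast_le.2 (by linarith [Nat.zero_le d, Nat.succ_mul r d]))
    have h1 : jacIP a b (jacN a b k) (g i * evolLim a b τ T g (jacN a b j) r (τ i) (i + 1)) =
        ∑ l : Fin D, jacIP a b (jacN a b l) (evolLim a b τ T g (jacN a b j) r (τ i) (i + 1)) *
          jacIP a b (jacN a b k) (g i * jacN a b l) := by
      rw [jacIP_mul_left]
      conv_lhs => rw [eq_sum_jacIP ha hb hlt, jacIP_sum_right ha hb, Finset.sum_range]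
      simp only [jacIP_mul_left]
    have hD' : q + r * d ≤ D := by linarith [Nat.zero_le d, Nat.succ_mul r d]
    rw [evolLim, jacIP_jacS ha hb, h1, prodFrom, Matrix.mul_apply, Finset.mul_sum, Finset.mul_sum,
      Finset.sum_mul]
    refine Finset.sum_congr rfl fun l _ => ?_
    rw [jacIP_evolLim ha hb τ T hg j hj r (τ i) (i + 1) l hD', jacMat, Matrix.of_apply]
    have h2 : Real.exp (-((τ i - t) * jacK a b k)) =
        Real.exp (t * jacK a b k) * Real.exp (-(τ i * jacK a b k)) := by
      rw [← Real.exp_add]; congr 1; ring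
    rw [h2]
    ring

theorem jacIP_add_right {a b : ℝ} (ha : -1 < a) (hb : -1 < b) (f g h : ℝ[X]) :
    jacIP a b f (g + h) = jacIP a b f g + jacIP a b f h := by
  simp only [jacIP, eval_add]
  rw [← integral_add (integrableOn_jacIP ha hb f g) (integrableOn_jacIP ha hb f h)]
  exact integral_congr_ae (.of_forall fun x => by simp only; ring)

theorem jacMat_one {a b : ℝ} (ha : -1 < a) (hb : -1 < b) (D : ℕ) (t : ℝ) :
    jacMat a b D t 1 = 1 := by
  ext i j
  rw [jacMat, Matrix.of_apply, one_mul, jacIP_jacN ha hb, Matrix.one_apply]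
  by_cases h : i = j
  · subst h
    rw [if_pos rfl, if_pos rfl, mul_one, ← Real.exp_add, neg_add_cancel, Real.exp_zero]
  · rw [if_neg h, if_neg fun h' => h (Fin.ext h')]
    ring

theorem jacMat_add_sum {a b : ℝ} (ha : -1 < a) (hb : -1 < b) (D : ℕ) (t : ℝ) {ι : Type*}
    (S : Finset ι) (s : ι → ℝ) (f : ι → ℝ[X]) :
    jacMat a b D t (1 + ∑ i ∈ S, C (s i) * f i) =
      1 + ∑ i ∈ S, s i • jacMat a b D t (f i) := by
  rw [← jacMat_one ha hb D t]
  ext k l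
  rw [Matrix.add_apply, Matrix.sum_apply]
  simp only [jacMat, Matrix.of_apply, Matrix.smul_apply, smul_eq_mul]
  rw [add_mul, Finset.sum_mul, jacIP_add_right ha hb, mul_add, add_mul]
  congr 1
  simp only [mul_assoc]
  rw [jacIP_sum_right ha hb, Finset.sum_mul, Finset.mul_sum]
  exact Finset.sum_congr rfl fun i _ => by ring

end Coordinates

/-! ### Space-time correlations as coefficients -/

section TimeRank

variable {n : ℕ} (t : Fin n → ℝ≥0)

/-- The number of times strictly before `t i`. -/
def timeRank (i : Fin n) : ℕ := (Finset.univ.filter fun j => t j < t i).card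

/-- The times in increasing order, indexed by their ranks; at numbers which are not ranks the
previous time is repeated. -/
def timeAt (l : ℕ) : ℝ≥0 := (Finset.univ.filter fun j => timeRank t j ≤ l).sup t

theorem timeRank_lt (i : Fin n) : timeRank t i < n := by
  have h : (Finset.univ.filter fun j => t j < t i) ⊂ Finset.univ :=
    Finset.filter_ssubset.2 ⟨i, Finset.mem_univ _, lt_irrefl _⟩
  simpa [timeRank] using Finset.card_lt_card h

theorem timeRank_lt_iff (i j : Fin n) : timeRank t i < timeRank t j ↔ t i < t j := by
  constructor
  · intro h
    by_contra! hle
    refine absurd h (not_lt.2 (Finset.card_le_card ?_))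
    exact Finset.monotone_filter_right _ fun k _ hk => hk.trans_le hle
  · intro h
    refine Finset.card_lt_card (Finset.ssubset_iff_of_subset ?_ |>.2 ⟨i, ?_, ?_⟩)
    · exact Finset.monotone_filter_right _ fun k _ hk => hk.trans h
    · simpa using h
    · simp

theorem timeAt_timeRank (i : Fin n) : timeAt t (timeRank t i) = t i := by
  refine le_antisymm (Finset.sup_le fun j hj => ?_) (Finset.le_sup (f := t) ?_)
  · have h1 := (Finset.mem_filter.1 hj).2
    by_contra! hlt
    exact absurd ((timeRank_lt_iff t i j).2 hlt) (not_lt.2 h1)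
  · simp

theorem timeAt_mono : Monotone (timeAt t) := fun _ _ h =>
  Finset.sup_mono (Finset.monotone_filter_right _ fun _ _ hk => hk.trans h)

theorem timeAt_le_sup (l : ℕ) : timeAt t l ≤ Finset.univ.sup fun i : Fin n => timeAt t i := by
  refine Finset.sup_le fun j _ => ?_
  rw [← timeAt_timeRank t j]
  exact Finset.le_sup (f := fun i : Fin n => timeAt t i)
    (Finset.mem_univ (⟨timeRank t j, timeRank_lt t j⟩ : Fin n))

end TimeRank

section Coefficients

open Polynomial

variable {p : ℕ} {z' w' : ℝ} {n : ℕ}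

/-- The indicator function of the first `p` levels, minus `1` for times in increasing order. -/
def levelSign (p : ℕ) (t : Fin n → ℝ≥0) (i j : Fin n) (b : ℕ) : ℝ :=
  (if b < p then 1 else 0) - if t i < t j then 1 else 0

/-- The matrix whose minors are the coefficients of multiplicative statistics. -/
def fredholmMat (p : ℕ) (a b : ℝ) (D : ℕ) (t : Fin n → ℝ≥0) (f : Fin n → ℝ[X]) :
    Matrix (Fin n × Fin D) (Fin n × Fin D) ℝ :=
  Matrix.of fun x y => jacMat a b D (t x.1) (f x.1) x.2 y.2 * levelSign p t x.1 y.1 y.2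

/-- The factors of the multiplicative statistic, indexed by the distinct times. -/
def statFactor (t : Fin n → ℝ≥0) (f : Fin n → ℝ[X]) (s : Fin n → ℝ) (l : ℕ) : ℝ[X] :=
  1 + ∑ i ∈ Finset.univ.filter fun i => timeRank t i = l, C (s i) * f i

/-- A degree beyond which truncations are exact. -/
def statDegree (f : Fin n → ℝ[X]) : ℕ := Finset.univ.sup fun i => (f i).natDegree

theorem natDegree_statFactor_le (t : Fin n → ℝ≥0) (f : Fin n → ℝ[X]) (s : Fin n → ℝ) (l : ℕ) :
    (statFactor t f s l).natDegree ≤ statDegree f := by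
  refine (natDegree_add_le _ _).trans (max_le (by simp) ?_)
  refine natDegree_sum_le_of_forall_le _ _ fun i _ => (natDegree_C_mul_le _ _).trans ?_
  exact Finset.le_sup (f := fun i => (f i).natDegree) (Finset.mem_univ i)

/-- The limit of a multiplicative statistic as a Fredholm expansion. -/
theorem tendsto_integral_statFactor (hz : (p : ℝ) - 1 < z') (hw : -1 < w') (t : Fin n → ℝ≥0)
    (f : Fin n → ℝ[X]) (s : Fin n → ℝ) {D : ℕ} (hD : p + n * statDegree f ≤ D) :
    Tendsto (fun N => ∫ y, ∏ i : Fin n, ∏ k, (statFactor t f s i).eval (y i k)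
      ∂(prelimitLaw p z' w' N fun i : Fin n => timeAt t i)) atTop
      (𝓝 (∑ S : Finset (Fin n × Fin D), (∏ y ∈ S, s y.1) *
        ((fredholmMat p (z' - p) w' D t f).submatrix (↑) (↑) : Matrix S S ℝ).det)) := by
  have ha : -1 < z' - p := by linarith
  have hpD : p ≤ D := le_trans (Nat.le_add_right _ _) hD
  have h1 := tendsto_integral_prelimitLaw_prod hz hw (timeAt_mono t) (timeAt_le_sup t)
    (statFactor t f s)
  set T : ℝ≥0 := Finset.univ.sup fun i : Fin n => timeAt t i
  set F := fun l => jacMat (z' - p) w' D (timeAt t l) (statFactor t f s l) with hF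
  have h2 : (Matrix.of fun i j : Fin p => jacIP (z' - p) w' (jacN (z' - p) w' i)
      (evolLim (z' - p) w' (fun j => timeAt t j) T (statFactor t f s) (jacN (z' - p) w' j) n 0 0)) =
      Matrix.of fun i j : Fin p => Real.exp (-(T * jacK (z' - p) w' j)) *
        ((prodFrom F n 0).submatrix (Fin.castLE hpD) (Fin.castLE hpD)) i j := by
    ext i j
    have h3 := jacIP_evolLim ha hw (fun j => timeAt t j) T
      (fun l => natDegree_statFactor_le t f s l) (Fin.castLE hpD j) (q := p) j.2 n 0 0
      (Fin.castLE hpD i) hD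
    simp only [Fin.val_castLE, zero_mul, Real.exp_zero, one_mul] at h3
    rw [Matrix.of_apply, h3, Matrix.of_apply, mul_comm]
    rfl
  have h4 : ∀ r, prodFrom F r 0 = orderedProd (timeRank t)
      (fun i => s i • jacMat (z' - p) w' D (t i) (f i)) r := by
    intro r
    induction r with
    | zero => rfl
    | succ r ih =>
      rw [prodFrom_succ, ih, orderedProd, zero_add, hF]
      simp only [statFactor]
      rw [jacMat_add_sum ha hw, ← Finset.sum_filter]
      congr 2
      refine Finset.sum_congr rfl fun i hi => ?_
      rw [← (Finset.mem_filter.1 hi).2, timeAt_timeRank]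
  -- the factors `exp (± T K(j))` from the final time cancel
  rw [h2, Matrix.det_mul_row, ← mul_assoc, ← Finset.prod_mul_distrib,
    Finset.prod_eq_one fun i _ => by rw [← Real.exp_add, add_neg_cancel, Real.exp_zero], one_mul,
    h4, det_submatrix_castLE, det_orderedProd _ _ _ (timeRank_lt t)] at h1
  rw [← det_one_add_smul_rows (fun y : Fin n × Fin D => s y.1)]
  convert h1 using 4
  ext x y
  rw [Matrix.of_apply, Matrix.of_apply, mul_sub, Matrix.sub_apply, Matrix.mul_diagonal,
    Matrix.smul_apply, fredholmMat, Matrix.of_apply, levelSign]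
  simp only [timeRank_lt_iff]
  split_ifs <;> simp

end Coefficients

end

noncomputable section

/-! ### Expectations of the limit process -/

section Expectations

open Polynomial

variable {p : ℕ} {z' w' : ℝ} {Ω : Type*} [MeasurableSpace Ω] {P : Measure Ω}
  {J : ℝ≥0 → Ω → Fin p → ℝ}

theorem confPt_mem {N : ℕ} (hN : 2 ≤ N) (x : Conf p (N + p)) (k : Fin p) :
    confPt x k ∈ Set.Icc (0 : ℝ) 1 :=
  gridPt_mem hN (x.1 k).2

/-- The convergence of finite-dimensional distributions may be tested on unbounded continuous
functions, because all the laws live on a compact cube. -/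
theorem IsLimitProcess.tendsto_of_continuous (hz : (p : ℝ) - 1 < z') (hw : -1 < w')
    (hJ : IsLimitProcess p z' w' P J) {n : ℕ} (t : Fin n → ℝ≥0) {F : (Fin n → Fin p → ℝ) → ℝ}
    (hF : Continuous F) :
    Tendsto (fun N => ∫ y, F y ∂(prelimitLaw p z' w' N t)) atTop
      (𝓝 (∫ ω, F (fun i => J (t i) ω) ∂P)) := by
  -- clamping all coordinates to `[0,1]` makes `F` bounded without changing it on the cube
  let e : C(Fin n → Fin p → ℝ, Fin n → Fin p → Set.Icc (0 : ℝ) 1) :=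
    ⟨fun y i k => Set.projIcc 0 1 zero_le_one (y i k), by fun_prop⟩
  let F' : (Fin n → Fin p → ℝ) →ᵇ ℝ := (BoundedContinuousFunction.mkOfCompact
    (⟨fun y => F fun i k => y i k, by fun_prop⟩ : C(Fin n → Fin p → Set.Icc (0 : ℝ) 1, ℝ))
    ).compContinuous e
  have hF' : ∀ y, (∀ i k, y i k ∈ Set.Icc (0 : ℝ) 1) → F' y = F y := by
    intro y hy
    change F (fun i k => (Set.projIcc 0 1 zero_le_one (y i k) : ℝ)) = F y
    congr 1
    funext i k
    rw [Set.projIcc_of_mem _ (hy i k)]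
  have h1 := hJ.tendsto n t F'
  have h2 : ∀ ω, F' (fun i => J (t i) ω) = F fun i => J (t i) ω := fun ω =>
    hF' _ fun i k => hJ.mem_Icc _ _ _
  simp only [h2] at h1
  refine h1.congr' ?_
  filter_upwards [eventually_ge_atTop 2] with N hN
  rw [integral_prelimitLaw hz hw, integral_prelimitLaw hz hw]
  refine Finset.sum_congr rfl fun τ _ => ?_
  rw [hF' _ fun i k => confPt_mem hN _ k]

theorem IsLimitProcess.integrable_of_continuous [IsFiniteMeasure P]
    (hJ : IsLimitProcess p z' w' P J) {n : ℕ} (t : Fin n → ℝ≥0) {F : (Fin n → Fin p → ℝ) → ℝ}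
    (hF : Continuous F) : Integrable (fun ω => F fun i => J (t i) ω) P := by
  have hK : IsCompact (Set.univ.pi fun _ : Fin n => Set.univ.pi fun _ : Fin p =>
      Set.Icc (0 : ℝ) 1) :=
    isCompact_univ_pi fun _ => isCompact_univ_pi fun _ => isCompact_Icc
  obtain ⟨M, hM⟩ := hK.exists_bound_of_continuousOn hF.continuousOn
  refine Integrable.of_bound (C := M) ?_ (.of_forall fun ω => hM _ ?_)
  · exact (hF.measurable.comp (measurable_pi_lambda _ fun i => hJ.measurable _)).aestronglyMeasurable
  · exact fun i _ k _ => hJ.mem_Icc _ _ _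

/-- The values of the test functions at the particles, arranged for `prod_one_add_eq_det`. -/
def statValue {n : ℕ} (t : Fin n → ℝ≥0) (f : Fin n → ℝ[X]) (y : Fin n → Fin p → ℝ) (i : Fin n)
    (x : Fin n × Fin p) : ℝ :=
  if timeRank t i = x.1 then (f i).eval (y x.1 x.2) else 0

theorem prod_eval_statFactor {n : ℕ} (t : Fin n → ℝ≥0) (f : Fin n → ℝ[X]) (s : Fin n → ℝ)
    (y : Fin n → Fin p → ℝ) :
    ∏ l : Fin n, ∏ k, (statFactor t f s l).eval (y l k) =
      ∏ x : Fin n × Fin p, (1 + ∑ i, s i * statValue t f y i x) := by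
  rw [Fintype.prod_prod_type]
  refine Finset.prod_congr rfl fun l _ => Finset.prod_congr rfl fun k _ => ?_
  rw [statFactor, eval_add, eval_one, eval_finsetSum, Finset.sum_filter]
  congr 1
  refine Finset.sum_congr rfl fun i _ => ?_
  rw [statValue]
  split_ifs <;> simp

open Classical in
/-- The tuples of particles which contribute to the coefficient of the product of all variables are the
ones in the definition of the correlation functions. -/
theorem sum_statValue {n : ℕ} (t : Fin n → ℝ≥0) (f : Fin n → ℝ[X]) (y : Fin n → Fin p → ℝ)
    (u : Fin n → Fin p → ℝ) (hu : ∀ i, u i = y ⟨timeRank t i, timeRank_lt t i⟩) :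
    ∑ x : Fin n → Fin n × Fin p,
        (if Function.Injective x then ∏ i, statValue t f y i (x i) else 0) =
      ∑ k : {k : Fin n → Fin p // Function.Injective fun i => (k i, t i)},
        ∏ i, (f i).eval (u i (k.1 i)) := by
  have hinj : ∀ k : Fin n → Fin p, (Function.Injective fun i => (k i, t i)) ↔
      Function.Injective fun i => ((⟨timeRank t i, timeRank_lt t i⟩ : Fin n), k i) := by
    intro k
    have hr : ∀ i j, t i = t j ↔ timeRank t i = timeRank t j := fun i j => by
      rw [le_antisymm_iff, le_antisymm_iff, ← not_lt, ← not_lt, ← timeRank_lt_iff,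
        ← timeRank_lt_iff, not_lt, not_lt]
    simp only [Function.Injective, Prod.ext_iff, hr, Fin.mk.injEq, and_comm]
  symm
  rw [← Finset.sum_filter]
  refine Finset.sum_bij_ne_zero
    (fun k _ _ i => ((⟨timeRank t i, timeRank_lt t i⟩ : Fin n), k.1 i)) ?_ ?_ ?_ ?_
  · intro k _ _
    exact Finset.mem_filter.2 ⟨Finset.mem_univ _, (hinj k.1).1 k.2⟩
  · intro k _ _ k' _ _ h
    refine Subtype.ext (funext fun i => ?_)
    exact congrArg Prod.snd (congrFun h i)
  · intro x hx hx0
    have h1 : ∀ i, timeRank t i = (x i).1 := by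
      intro i
      by_contra h
      exact hx0 (Finset.prod_eq_zero (Finset.mem_univ i) (if_neg h))
    have h2 : x = fun i => ((⟨timeRank t i, timeRank_lt t i⟩ : Fin n), (x i).2) :=
      funext fun i => Prod.ext (Fin.ext (h1 i).symm) rfl
    have h3 : Function.Injective fun i => ((x i).2, t i) := by
      rw [hinj fun i => (x i).2, ← h2]
      exact (Finset.mem_filter.1 hx).2
    have h4 : ∏ i, statValue t f y i (x i) = ∏ i, (f i).eval (u i (x i).2) :=
      Finset.prod_congr rfl fun i _ => by
        rw [statValue, if_pos (h1 i), hu]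
        congr 3
        exact Fin.ext (h1 i).symm
    refine ⟨⟨fun i => (x i).2, h3⟩, Finset.mem_univ _, ?_, h2.symm⟩
    rw [h4] at hx0
    exact hx0
  · intro k _ _
    refine Finset.prod_congr rfl fun i _ => ?_
    rw [statValue, if_pos rfl, hu]

/-- Correlations of the limit process with polynomial test functions. -/
theorem IsLimitProcess.integral_sum_prod_eval [IsProbabilityMeasure P]
    (hz : (p : ℝ) - 1 < z') (hw : -1 < w') (hJ : IsLimitProcess p z' w' P J) {n : ℕ}
    (t : Fin n → ℝ≥0) (f : Fin n → ℝ[X]) {D : ℕ} (hD : p + n * statDegree f ≤ D) :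
    ∫ ω, (∑ k : {k : Fin n → Fin p // Function.Injective fun i => (k i, t i)},
        ∏ i, (f i).eval (J (t i) ω (k.1 i))) ∂P =
      ∑ a : Fin n → Fin D,
        (Matrix.of fun i j => fredholmMat p (z' - p) w' D t f (i, a i) (j, a j)).det := by
  classical
  set τ : Fin n → ℝ≥0 := fun i => timeAt t i with hτ
  let H : (Fin n → Fin p → ℝ) → Matrix (Fin n × (Fin n × Fin p)) (Fin n × (Fin n × Fin p)) ℝ :=
    fun y => Matrix.of fun u v => statValue t f y u.1 u.2 * if u.2 = v.2 then 1 else 0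
  have hval : ∀ i x, Continuous fun y : Fin n → Fin p → ℝ => statValue t f y i x := by
    intro i x
    simp only [statValue]
    split_ifs
    · exact (f i).continuous.comp (by fun_prop)
    · fun_prop
  have hH : ∀ S : Finset (Fin n × (Fin n × Fin p)), Continuous fun y =>
      ((H y).submatrix (↑) (↑) : Matrix S S ℝ).det := by
    intro S
    refine Continuous.matrix_det (continuous_matrix fun i j => ?_)
    exact (hval _ _).mul continuous_const
  have h1 : ∀ s : Fin n → ℝ, ∀ y : Fin n → Fin p → ℝ,
      ∏ l : Fin n, ∏ k, (statFactor t f s l).eval (y l k) =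
      ∑ S : Finset (Fin n × (Fin n × Fin p)), (∏ u ∈ S, s u.1) * ((H y).submatrix (↑) (↑) : Matrix S S ℝ).det := by
    intro s y
    rw [prod_eval_statFactor, prod_one_add_eq_det, ← det_one_add_smul_rows (fun u : Fin n × (Fin n × Fin p) => s u.1)]
    congr 2
    ext u v
    simp only [H, Matrix.of_apply, mul_assoc]
  have h2 : ∀ s : Fin n → ℝ,
      ∑ S : Finset (Fin n × (Fin n × Fin p)), (∏ u ∈ S, s u.1) *
        ∫ ω, ((H fun i => J (τ i) ω).submatrix (↑) (↑) : Matrix S S ℝ).det ∂P =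
      ∑ S : Finset (Fin n × Fin D), (∏ y ∈ S, s y.1) *
        ((fredholmMat p (z' - p) w' D t f).submatrix (↑) (↑) : Matrix S S ℝ).det := by
    intro s
    have hc : Continuous fun y : Fin n → Fin p → ℝ =>
        ∏ l : Fin n, ∏ k, (statFactor t f s l).eval (y l k) :=
      continuous_finsetProd _ fun l _ => continuous_finsetProd _ fun k _ =>
        (statFactor t f s l).continuous.comp (by fun_prop)
    rw [← tendsto_nhds_unique (hJ.tendsto_of_continuous hz hw τ hc)
      (tendsto_integral_statFactor hz hw t f s hD)]
    simp only [h1]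
    rw [integral_finsetSum _ fun S _ => (hJ.integrable_of_continuous τ (hH S)).const_mul _]
    exact Finset.sum_congr rfl fun S _ => (integral_const_mul _ _).symm
  -- both sides are polynomials in `s`; compare the coefficients of the product of all variables
  have h3 := sum_graphFinset_eq _ _ h2
  simp only [det_submatrix_graphFinset] at h3
  rw [← h3, ← integral_finsetSum]
  · refine integral_congr_ae (.of_forall fun ω => ?_)
    simp only
    rw [← sum_statValue t f (fun i => J (τ i) ω) (fun i => J (t i) ω)
      fun i => by rw [hτ]; simp only [timeAt_timeRank]]
    refine Finset.sum_congr rfl fun x _ => ?_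
    rw [← minor_prod_one_add, det_submatrix_graphFinset]
  · intro x _
    simp only [← det_submatrix_graphFinset]
    exact hJ.integrable_of_continuous τ (hH _)

end Expectations

end

noncomputable section

/-! ### Determinants of integrals -/

section DetIntegral

/-- Summation over the levels turns products of one-level functions into a kernel. -/
theorem sum_det_eq_det_sum {ι κ R : Type*} [Fintype ι] [DecidableEq ι] [Fintype κ] [CommRing R]
    (α : ι → R) (u : ι → κ → R) (v : ι → ι → κ → R) :
    ∑ a : ι → κ, (Matrix.of fun i j => α i * u i (a i) * v i j (a j)).det =
      (∏ i, α i) * (Matrix.of fun i j => ∑ b, v i j b * u j b).det := by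
  classical
  have h1 : ∀ a : ι → κ, (Matrix.of fun i j => α i * u i (a i) * v i j (a j)).det =
      (∏ i, α i) * (Matrix.of fun i j => v i j (a j) * u j (a j)).det := by
    intro a
    have h2 := Matrix.det_mul_column (fun i => α i * u i (a i)) (Matrix.of fun i j => v i j (a j))
    have h3 := Matrix.det_mul_row (fun i => u i (a i)) (Matrix.of fun i j => v i j (a j))
    simp only [Matrix.of_apply] at h2 h3
    simp only [mul_comm (v _ _ _)]
    rw [h2, h3, Finset.prod_mul_distrib, mul_assoc]
  simp only [h1]
  rw [← Finset.mul_sum]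
  congr 1
  simp only [Matrix.det_apply', Matrix.of_apply]
  rw [Finset.sum_comm]
  refine Finset.sum_congr rfl fun σ _ => ?_
  rw [Finset.prod_univ_sum, Finset.mul_sum]
  simp

variable {X : Type*} [MeasurableSpace X] {μ : Measure X} [SigmaFinite μ] {n : ℕ}

theorem integrable_det {h : Fin n → Fin n → X → ℝ} (hh : ∀ i j, Integrable (h i j) μ) :
    Integrable (fun x : Fin n → X => (Matrix.of fun i j => h i j (x i)).det)
      (Measure.pi fun _ => μ) := by
  simp only [← Matrix.det_transpose (Matrix.of _), Matrix.det_apply', Matrix.transpose_apply,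
    Matrix.of_apply]
  exact integrable_finsetSum _ fun σ _ =>
    (Integrable.fintype_prod (f := fun i => h i (σ i)) fun i => hh i (σ i)).const_mul _

/-- A determinant of integrals is an integral over independent variables, one for each row. -/
theorem det_integral {h : Fin n → Fin n → X → ℝ} (hh : ∀ i j, Integrable (h i j) μ) :
    (Matrix.of fun i j => ∫ x, h i j x ∂μ).det =
      ∫ x, (Matrix.of fun i j => h i j (x i)).det ∂(Measure.pi fun _ : Fin n => μ) := by
  simp only [← Matrix.det_transpose (Matrix.of _), Matrix.det_apply', Matrix.transpose_apply,
    Matrix.of_apply]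
  rw [integral_finsetSum _ fun σ _ =>
    (Integrable.fintype_prod (f := fun i => h i (σ i)) fun i => hh i (σ i)).const_mul _]
  refine Finset.sum_congr rfl fun σ _ => ?_
  rw [integral_const_mul]
  congr 1
  exact (integral_fintype_prod_eq_prod (fun i => h i (σ i))).symm

end DetIntegral

/-! ### The extended kernel -/

section Kernel

open Polynomial

variable {p : ℕ} {z' w' : ℝ} {n : ℕ}

theorem jacobiEigenvalue_eq (p : ℕ) (z' w' : ℝ) (k : ℕ) :
    jacobiEigenvalue p z' w' k = jacK (z' - p) w' k := by
  rw [jacobiEigenvalue, jacK]; ring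

/-- The coefficients of the extended kernel in the Jacobi basis. -/
def kerCoeff (p : ℕ) (a b : ℝ) (t : Fin n → ℝ≥0) (i j : Fin n) (k : ℕ) : ℝ :=
  Real.exp ((t i - t j) * jacK a b k) * levelSign p t i j k

theorem summable_kerCoeff (a b : ℝ) (t : Fin n → ℝ≥0) (i j : Fin n) (M : ℝ) {R : ℝ} (hR : 0 < R) :
    Summable fun k => |kerCoeff p a b t i j k| * (M * R ^ k) := by
  by_cases hij : t i < t j
  · have hc : (0 : ℝ) < t j - t i := sub_pos.2 (NNReal.coe_lt_coe.2 hij)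
    -- for increasing times the first `p` coefficients vanish, the others decay like a Gaussian
    refine (summable_nat_add_iff p).1 ?_
    refine ((summable_nat_add_iff p).2 (summable_exp_jacEigen (a + b + 1) M hR hc)).congr fun k => ?_
    rw [kerCoeff, levelSign, if_pos hij, if_neg (by omega), zero_sub, mul_neg, mul_one, abs_neg,
      abs_of_pos (Real.exp_pos _), jacK]
    congr 2
    ring
  · refine summable_of_ne_finset_zero (s := Finset.range p) fun k hk => ?_
    rw [kerCoeff, levelSign, if_neg hij, if_neg fun h => hk (Finset.mem_range.2 h), sub_zero,
      mul_zero, abs_zero, zero_mul]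

/-- The extended kernel, divided by `√w(x) √w(y)` and truncated at level `D`. -/
def kerTrunc (p : ℕ) (a b : ℝ) (D : ℕ) (t : Fin n → ℝ≥0) (i j : Fin n) (x y : ℝ) : ℝ :=
  ∑ k ∈ Finset.range D, kerCoeff p a b t i j k * ((jacN a b k).eval x * (jacN a b k).eval y)

/-- A summable bound for the terms of the kernel which is uniform on the square. -/
theorem exists_kerCoeff_bound {a b : ℝ} (ha : -1 < a) (hb : -1 < b) (t : Fin n → ℝ≥0)
    (i j : Fin n) : ∃ u : ℕ → ℝ, Summable u ∧ ∀ k, ∀ x ∈ Set.Icc (0 : ℝ) 1, ∀ y ∈ Set.Icc (0 : ℝ) 1,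
      |kerCoeff p a b t i j k * ((jacN a b k).eval x * (jacN a b k).eval y)| ≤ u k := by
  obtain ⟨M, R, hM, hR, h⟩ := exists_jacN_sq_le ha hb
  refine ⟨_, summable_kerCoeff (p := p) a b t i j M hR, fun k x hx y hy => ?_⟩
  rw [abs_mul]
  refine mul_le_mul_of_nonneg_left ?_ (abs_nonneg _)
  have h1 := h k x hx
  have h2 := h k y hy
  rw [abs_le]
  constructor <;> nlinarith [sq_nonneg ((jacN a b k).eval x - (jacN a b k).eval y),
    sq_nonneg ((jacN a b k).eval x + (jacN a b k).eval y)]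

/-- The truncated kernels are bounded uniformly in the truncation. -/
theorem exists_kerTrunc_bound {a b : ℝ} (ha : -1 < a) (hb : -1 < b) (t : Fin n → ℝ≥0) :
    ∃ B : ℝ, ∀ D i j, ∀ x ∈ Set.Icc (0 : ℝ) 1, ∀ y ∈ Set.Icc (0 : ℝ) 1,
      |kerTrunc p a b D t i j x y| ≤ B := by
  choose u hu hb' using fun i j => exists_kerCoeff_bound (p := p) ha hb t i j
  have hnn : ∀ i j k, 0 ≤ u i j k := fun i j k =>
    (abs_nonneg _).trans (hb' i j k 0 (by simp) 0 (by simp))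
  refine ⟨∑ i, ∑ j, ∑' k, u i j k, fun D i j x hx y hy => ?_⟩
  calc |kerTrunc p a b D t i j x y| ≤ ∑ k ∈ Finset.range D, u i j k :=
        (Finset.abs_sum_le_sum_abs _ _).trans
          (Finset.sum_le_sum fun k _ => hb' i j k x hx y hy)
    _ ≤ ∑' k, u i j k := (hu i j).sum_le_tsum _ fun k _ => hnn i j k
    _ ≤ ∑ j, ∑' k, u i j k :=
        Finset.single_le_sum (f := fun j => ∑' k, u i j k)
          (fun j _ => tsum_nonneg (hnn i j)) (Finset.mem_univ j)
    _ ≤ _ := Finset.single_le_sum (f := fun i => ∑ j, ∑' k, u i j k)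
          (fun i _ => Finset.sum_nonneg fun j _ => tsum_nonneg (hnn i j)) (Finset.mem_univ i)

/-- The two cases in the definition of the extended kernel merge into one series. -/
theorem extendedKernel_eq (hz : (p : ℝ) - 1 < z') (hw : -1 < w') (t : Fin n → ℝ≥0) (i j : Fin n)
    {x y : ℝ} (hx : x ∈ Set.Icc (0 : ℝ) 1) (hy : y ∈ Set.Icc (0 : ℝ) 1) :
    extendedKernel p z' w' x (t i) y (t j) =
      √(jacW (z' - p) w' x) * (√(jacW (z' - p) w' y) *
        ∑' k, kerCoeff p (z' - p) w' t i j k *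
          ((jacN (z' - p) w' k).eval x * (jacN (z' - p) w' k).eval y)) := by
  have ha : -1 < z' - p := by linarith
  obtain ⟨u, hu, hb⟩ := exists_kerCoeff_bound (p := p) ha hw t i j
  have hs : Summable fun k => kerCoeff p (z' - p) w' t i j k *
      ((jacN (z' - p) w' k).eval x * (jacN (z' - p) w' k).eval y) :=
    Summable.of_norm_bounded hu fun k => hb k x hx y hy
  simp only [extendedKernel, jacobiFun_eq, jacobiEigenvalue_eq, NNReal.coe_le_coe]
  split_ifs with hij
  · rw [tsum_eq_sum (s := Finset.range p) fun k hk => ?_, Finset.mul_sum, Finset.mul_sum]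
    · refine Finset.sum_congr rfl fun k hk => ?_
      rw [kerCoeff, levelSign, if_neg (not_lt.2 hij), if_pos (Finset.mem_range.1 hk)]
      ring
    · rw [kerCoeff, levelSign, if_neg (not_lt.2 hij), if_neg fun h => hk (Finset.mem_range.2 h)]
      ring
  · rw [← hs.sum_add_tsum_nat_add p, Finset.sum_eq_zero, zero_add, ← tsum_mul_left, ← tsum_mul_left,
      ← tsum_neg]
    · refine tsum_congr fun k => ?_
      rw [kerCoeff, levelSign, if_pos (not_le.1 hij), if_neg (by omega), add_comm k p]
      ring
    · intro k hk
      rw [kerCoeff, levelSign, if_pos (not_le.1 hij), if_pos (Finset.mem_range.1 hk)]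
      ring

theorem tendsto_kerTrunc {a b : ℝ} (ha : -1 < a) (hb : -1 < b) (t : Fin n → ℝ≥0) (i j : Fin n)
    {x y : ℝ} (hx : x ∈ Set.Icc (0 : ℝ) 1) (hy : y ∈ Set.Icc (0 : ℝ) 1) :
    Tendsto (fun D => kerTrunc p a b D t i j x y) atTop (𝓝 (∑' k, kerCoeff p a b t i j k *
      ((jacN a b k).eval x * (jacN a b k).eval y))) := by
  obtain ⟨u, hu, hb⟩ := exists_kerCoeff_bound (p := p) ha hb t i j
  exact (Summable.of_norm_bounded hu fun k => hb k x hx y hy).hasSum.tendsto_sum_nat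

/-- Convergence of the series in the kernel for `t < s`. -/
theorem summable_extendedKernel (hz : (p : ℝ) - 1 < z') (hw : -1 < w') {x y : ℝ}
    (hx : x ∈ Set.Ioo (0 : ℝ) 1) (hy : y ∈ Set.Ioo (0 : ℝ) 1) {t s : ℝ} (hts : t < s) :
    Summable fun i : ℕ => Real.exp ((t - s) * jacobiEigenvalue p z' w' (p + i)) *
        jacobiFun p z' w' (p + i) x * jacobiFun p z' w' (p + i) y := by
  have ha : -1 < z' - p := by linarith
  obtain ⟨M, R, hM, hR, h⟩ := exists_jacN_sq_le ha hw
  have h1 := ((summable_nat_add_iff p).2 (summable_exp_jacEigen (z' - p + w' + 1) M hR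
    (sub_pos.2 hts))).mul_right (√(jacW (z' - p) w' x) * √(jacW (z' - p) w' y))
  refine Summable.of_norm_bounded h1 fun k => ?_
  rw [jacobiFun_eq, jacobiFun_eq, jacobiEigenvalue_eq, add_comm p k]
  have h2 := h (k + p) x (Set.Ioo_subset_Icc_self hx)
  have h3 := h (k + p) y (Set.Ioo_subset_Icc_self hy)
  have h4 : |(jacN (z' - p) w' (k + p)).eval x * (jacN (z' - p) w' (k + p)).eval y| ≤
      M * R ^ (k + p) := by
    rw [abs_le]
    constructor <;> nlinarith [sq_nonneg ((jacN (z' - p) w' (k + p)).eval x -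
      (jacN (z' - p) w' (k + p)).eval y), sq_nonneg ((jacN (z' - p) w' (k + p)).eval x +
      (jacN (z' - p) w' (k + p)).eval y)]
  have h5 : Real.exp ((t - s) * jacK (z' - p) w' (k + p)) =
      Real.exp (-(s - t) * (((k + p : ℕ) : ℝ) * ((k + p : ℕ) + (z' - p + w' + 1)))) := by
    rw [jacK]; congr 1; ring
  rw [h5, Real.norm_eq_abs]
  calc _ = Real.exp (-(s - t) * (((k + p : ℕ) : ℝ) * ((k + p : ℕ) + (z' - p + w' + 1)))) *
        |(jacN (z' - p) w' (k + p)).eval x * (jacN (z' - p) w' (k + p)).eval y| *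
        (√(jacW (z' - p) w' x) * √(jacW (z' - p) w' y)) := by
        simp only [abs_mul, Real.abs_exp, abs_of_nonneg (Real.sqrt_nonneg _)]
        ring
    _ ≤ _ := by
        gcongr

/-- The measure on the open cube. -/
theorem volume_restrict_cube (n : ℕ) :
    (volume : Measure (Fin n → ℝ)).restrict (Set.univ.pi fun _ => Set.Ioo (0 : ℝ) 1) =
      Measure.pi fun _ : Fin n => (volume : Measure ℝ).restrict (Set.Ioo 0 1) := by
  rw [volume_pi, Measure.restrict_pi_pi]

theorem ae_mem_cube (n : ℕ) :
    ∀ᵐ x ∂(volume : Measure (Fin n → ℝ)).restrict (Set.univ.pi fun _ => Set.Ioo (0 : ℝ) 1),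
      ∀ i, x i ∈ Set.Ioo (0 : ℝ) 1 := by
  filter_upwards [ae_restrict_mem (MeasurableSet.univ_pi fun _ : Fin n => measurableSet_Ioo)]
    with x hx i using hx i (Set.mem_univ i)

/-- The coefficient of a multiplicative statistic as an integral against the truncated kernel. -/
theorem sum_det_fredholmMat {a b : ℝ} (ha : -1 < a) (hb : -1 < b) (D : ℕ) (t : Fin n → ℝ≥0)
    (f : Fin n → ℝ[X]) :
    ∑ l : Fin n → Fin D, (Matrix.of fun i j => fredholmMat p a b D t f (i, l i) (j, l j)).det =
      ∫ x in Set.univ.pi fun _ : Fin n => Set.Ioo (0 : ℝ) 1,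
        (∏ i, (f i).eval (x i) * jacW a b (x i)) *
          (Matrix.of fun i j => kerTrunc p a b D t i j (x i) (x j)).det := by
  let h : (Fin n → Fin D) → Fin n → Fin n → ℝ → ℝ := fun l i j x =>
    ((f i).eval x * jacW a b x) * (Real.exp (-(t i * jacK a b (l i))) * (jacN a b (l i)).eval x) *
      ((jacN a b (l j)).eval x * Real.exp (t i * jacK a b (l j)) * levelSign p t i j (l j))
  have hh : ∀ l i j, Integrable (h l i j) (volume.restrict (Set.Ioo (0 : ℝ) 1)) := by
    intro l i j
    have := integrableOn_mul_jacW ha hb (f := fun x => (f i).eval x *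
      (Real.exp (-(t i * jacK a b (l i))) * (jacN a b (l i)).eval x) *
      ((jacN a b (l j)).eval x * Real.exp (t i * jacK a b (l j)) * levelSign p t i j (l j)))
      (by fun_prop)
    refine Integrable.congr this (.of_forall fun x => ?_)
    simp only [h]
    ring
  have h1 : ∀ l : Fin n → Fin D,
      (Matrix.of fun i j => fredholmMat p a b D t f (i, l i) (j, l j)) =
      Matrix.of fun i j => ∫ x in Set.Ioo (0 : ℝ) 1, h l i j x := by
    intro l
    ext i j
    simp only [Matrix.of_apply, fredholmMat, jacMat, jacIP]
    rw [← integral_const_mul, ← integral_mul_const, ← integral_mul_const]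
    refine integral_congr_ae (.of_forall fun x => ?_)
    simp only [h, eval_mul]
    ring
  simp only [h1, fun l => det_integral (hh l)]
  rw [volume_restrict_cube, ← integral_finsetSum _ fun l _ => integrable_det (hh l)]
  refine integral_congr_ae (.of_forall fun x => ?_)
  simp only [h]
  rw [sum_det_eq_det_sum (fun i => (f i).eval (x i) * jacW a b (x i))
    (fun i (k : Fin D) => Real.exp (-(t i * jacK a b k)) * (jacN a b k).eval (x i))
    (fun i j (k : Fin D) => (jacN a b k).eval (x i) * Real.exp (t i * jacK a b k) *
      levelSign p t i j k)]
  congr 2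
  ext i j
  rw [Matrix.of_apply, Matrix.of_apply, kerTrunc, Finset.sum_range]
  refine Finset.sum_congr rfl fun k _ => ?_
  have h2 : Real.exp ((t i - t j) * jacK a b k) =
      Real.exp (t i * jacK a b k) * Real.exp (-(t j * jacK a b k)) := by
    rw [← Real.exp_add]; congr 1; ring
  rw [kerCoeff, h2]
  ring

/-- The candidate for the correlation function. -/
def detKernel (p : ℕ) (z' w' : ℝ) (t : Fin n → ℝ≥0) (x : Fin n → ℝ) : ℝ :=
  (Matrix.of fun i j : Fin n => extendedKernel p z' w' (x i) (t i) (x j) (t j)).det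

theorem abs_det_kerTrunc_le {a b : ℝ} {t : Fin n → ℝ≥0} {B : ℝ} (hB : ∀ D i j,
    ∀ x ∈ Set.Icc (0 : ℝ) 1, ∀ y ∈ Set.Icc (0 : ℝ) 1, |kerTrunc p a b D t i j x y| ≤ B) (D : ℕ)
    {x : Fin n → ℝ} (hx : ∀ i, x i ∈ Set.Icc (0 : ℝ) 1) :
    |(Matrix.of fun i j => kerTrunc p a b D t i j (x i) (x j)).det| ≤ n.factorial * B ^ n := by
  have := Matrix.det_le (A := Matrix.of fun i j => kerTrunc p a b D t i j (x i) (x j))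
    (abv := AbsoluteValue.abs) (x := B) (fun i j => hB D i j _ (hx i) _ (hx j))
  simpa using this

/-- The weights `√w(x_i) √w(x_j)` are pulled out of the rows and columns, and the truncation is removed. -/
theorem tendsto_det_kerTrunc (hz : (p : ℝ) - 1 < z') (hw : -1 < w') (t : Fin n → ℝ≥0)
    {x : Fin n → ℝ} (hx : ∀ i, x i ∈ Set.Ioo (0 : ℝ) 1) :
    Tendsto (fun D => (∏ i, jacW (z' - p) w' (x i)) *
      (Matrix.of fun i j => kerTrunc p (z' - p) w' D t i j (x i) (x j)).det) atTop
      (𝓝 (detKernel p z' w' t x)) := by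
  have ha : -1 < z' - p := by linarith
  have hx' : ∀ i, x i ∈ Set.Icc (0 : ℝ) 1 := fun i => Set.Ioo_subset_Icc_self (hx i)
  have h1 : detKernel p z' w' t x = (∏ i, jacW (z' - p) w' (x i)) *
      (Matrix.of fun i j => ∑' k, kerCoeff p (z' - p) w' t i j k *
        ((jacN (z' - p) w' k).eval (x i) * (jacN (z' - p) w' k).eval (x j))).det := by
    simp only [detKernel, fun i j => extendedKernel_eq hz hw t i j (hx' i) (hx' j)]
    have h2 := Matrix.det_mul_column (fun i => √(jacW (z' - p) w' (x i)))
      (Matrix.of fun i j => √(jacW (z' - p) w' (x j)) * ∑' k, kerCoeff p (z' - p) w' t i j k *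
        ((jacN (z' - p) w' k).eval (x i) * (jacN (z' - p) w' k).eval (x j)))
    have h3 := Matrix.det_mul_row (fun i => √(jacW (z' - p) w' (x i)))
      (Matrix.of fun i j => ∑' k, kerCoeff p (z' - p) w' t i j k *
        ((jacN (z' - p) w' k).eval (x i) * (jacN (z' - p) w' k).eval (x j)))
    simp only [Matrix.of_apply] at h2 h3
    rw [h2, h3, ← mul_assoc, ← Finset.prod_mul_distrib]
    congr 1
    exact Finset.prod_congr rfl fun i _ => Real.mul_self_sqrt (jacW_pos _ _ (hx i)).le
  rw [h1]
  refine Tendsto.const_mul _ (((continuous_id.matrix_det).tendsto _).comp ?_)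
  exact tendsto_pi_nhds.2 fun i => tendsto_pi_nhds.2 fun j =>
    tendsto_kerTrunc ha hw t i j (hx' i) (hx' j)

end Kernel

end

noncomputable section

/-! ### Measures on a cube are determined by their moments -/

section Moments

variable {n : ℕ}

/-- The algebra of polynomial functions on the cube. -/
def cubePolynomials (n : ℕ) : StarSubalgebra ℝ ((Fin n → Set.Icc (0 : ℝ) 1) →ᵇ ℝ) where
  __ := (MvPolynomial.aeval fun i : Fin n => BoundedContinuousFunction.mkOfCompact
    (⟨fun x => (x i : ℝ), by fun_prop⟩ : C(Fin n → Set.Icc (0 : ℝ) 1, ℝ))).range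
  star_mem' := fun {g} h => by
    have hg : star g = g := by ext x; simp
    rwa [hg]

theorem aeval_cube_apply (q : MvPolynomial (Fin n) ℝ) (x : Fin n → Set.Icc (0 : ℝ) 1) :
    (MvPolynomial.aeval (fun i : Fin n => BoundedContinuousFunction.mkOfCompact
      (⟨fun x => (x i : ℝ), by fun_prop⟩ : C(Fin n → Set.Icc (0 : ℝ) 1, ℝ))) q) x =
      MvPolynomial.eval (fun i => (x i : ℝ)) q := by
  induction q using MvPolynomial.induction_on with
  | C c => simp
  | add q r hq hr => simp [hq, hr]
  | mul_X q i hq => simp [hq]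

theorem separatesPoints_cubePolynomials (n : ℕ) : ((cubePolynomials n).map
    (BoundedContinuousFunction.toContinuousMapStarₐ ℝ)).SeparatesPoints := by
  intro x y hxy
  obtain ⟨i, hi⟩ := Function.ne_iff.1 hxy
  refine ⟨_, ⟨_, ⟨_, ⟨MvPolynomial.X i, rfl⟩, rfl⟩, rfl⟩, ?_⟩
  simpa [Subtype.ext_iff] using hi

/-- Finite measures on the unit cube with equal moments are equal. -/
theorem ext_of_moments {μ ν : Measure (Fin n → ℝ)} [IsFiniteMeasure μ] [IsFiniteMeasure ν]
    (hμ : ∀ᵐ x ∂μ, ∀ i, x i ∈ Set.Icc (0 : ℝ) 1) (hν : ∀ᵐ x ∂ν, ∀ i, x i ∈ Set.Icc (0 : ℝ) 1)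
    (h : ∀ e : Fin n → ℕ, ∫ x, ∏ i, x i ^ e i ∂μ = ∫ x, ∏ i, x i ^ e i ∂ν) : μ = ν := by
  -- transport to the compact cube, where polynomials are dense
  let π : (Fin n → ℝ) → Fin n → Set.Icc (0 : ℝ) 1 := fun x i => Set.projIcc 0 1 zero_le_one (x i)
  let c : (Fin n → Set.Icc (0 : ℝ) 1) → Fin n → ℝ := fun x i => x i
  have hπ : Measurable π := Continuous.measurable (by fun_prop)
  have hc : Measurable c := Continuous.measurable (by fun_prop)
  have hcπ : ∀ x : Fin n → ℝ, (∀ i, x i ∈ Set.Icc (0 : ℝ) 1) → c (π x) = x := fun x hx => by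
    funext i
    simp only [c, π, Set.projIcc_of_mem _ (hx i)]
  have hback : ∀ m : Measure (Fin n → ℝ), (∀ᵐ x ∂m, ∀ i, x i ∈ Set.Icc (0 : ℝ) 1) →
      (m.map π).map c = m := by
    intro m hm
    rw [Measure.map_map hc hπ]
    conv_rhs => rw [← Measure.map_id (μ := m)]
    refine Measure.map_congr ?_
    filter_upwards [hm] with x hx using hcπ x hx
  have hmom : ∀ m : Measure (Fin n → ℝ), (∀ᵐ x ∂m, ∀ i, x i ∈ Set.Icc (0 : ℝ) 1) →
      ∀ e : Fin n → ℕ, ∫ x, ∏ i, (x i : ℝ) ^ e i ∂(m.map π) = ∫ x, ∏ i, x i ^ e i ∂m := by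
    intro m hm e
    rw [integral_map hπ.aemeasurable (Continuous.aestronglyMeasurable (by fun_prop))]
    refine integral_congr_ae ?_
    filter_upwards [hm] with x hx
    have := hcπ x hx
    conv_rhs => rw [← this]
  have key : μ.map π = ν.map π := by
    refine ext_of_forall_mem_subalgebra_integral_eq_of_polish (𝕜 := ℝ)
      (separatesPoints_cubePolynomials n) ?_
    rintro g ⟨q, rfl⟩
    have hint : ∀ m : Measure (Fin n → Set.Icc (0 : ℝ) 1), IsFiniteMeasure m →
        ∫ x, MvPolynomial.eval (fun i => (x i : ℝ)) q ∂m =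
          ∑ d ∈ q.support, q.coeff d * ∫ x, ∏ i, (x i : ℝ) ^ d i ∂m := by
      intro m _
      simp only [MvPolynomial.eval_eq', ← integral_const_mul]
      refine integral_finsetSum _ fun d _ => Integrable.const_mul ?_ _
      exact (BoundedContinuousFunction.mkOfCompact (⟨fun x => ∏ i, (x i : ℝ) ^ d i, by fun_prop⟩ :
        C(Fin n → Set.Icc (0 : ℝ) 1, ℝ))).integrable m
    change ∫ x, (MvPolynomial.aeval _ q : (Fin n → Set.Icc (0 : ℝ) 1) →ᵇ ℝ) x ∂_ =
      ∫ x, (MvPolynomial.aeval _ q : (Fin n → Set.Icc (0 : ℝ) 1) →ᵇ ℝ) x ∂_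
    simp only [aeval_cube_apply]
    rw [hint _ inferInstance, hint _ inferInstance]
    refine Finset.sum_congr rfl fun d _ => ?_
    rw [hmom μ hμ, hmom ν hν, h]
  rw [← hback μ hμ, key, hback ν hν]

/-- A finite measure whose moments are those of a signed density has this density, which is
therefore non-negative. -/
theorem nonneg_and_eq_withDensity_of_moments {μ m : Measure (Fin n → ℝ)} [IsFiniteMeasure μ]
    (hμ : ∀ᵐ x ∂μ, ∀ i, x i ∈ Set.Icc (0 : ℝ) 1) (hm : ∀ᵐ x ∂m, ∀ i, x i ∈ Set.Icc (0 : ℝ) 1)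
    {ρ : (Fin n → ℝ) → ℝ} (hρ : Integrable ρ m)
    (h : ∀ e : Fin n → ℕ, ∫ x, ∏ i, x i ^ e i ∂μ = ∫ x, (∏ i, x i ^ e i) * ρ x ∂m) :
    (∀ᵐ x ∂m, 0 ≤ ρ x) ∧ μ = m.withDensity fun x => ENNReal.ofReal (ρ x) := by
  set νp := m.withDensity fun x => ENNReal.ofReal (ρ x) with hνp
  set νn := m.withDensity fun x => ENNReal.ofReal (-ρ x) with hνn
  have hmp : AEMeasurable (fun x => ENNReal.ofReal (ρ x)) m := hρ.aemeasurable.ennreal_ofReal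
  have hmn : AEMeasurable (fun x => ENNReal.ofReal (-ρ x)) m := hρ.neg.aemeasurable.ennreal_ofReal
  have : IsFiniteMeasure νp := isFiniteMeasure_withDensity_ofReal hρ.2
  have : IsFiniteMeasure νn := isFiniteMeasure_withDensity_ofReal hρ.neg.2
  have hp : ∀ᵐ x ∂νp, ∀ i, x i ∈ Set.Icc (0 : ℝ) 1 := (withDensity_absolutelyContinuous m _) hm
  have hn : ∀ᵐ x ∂νn, ∀ i, x i ∈ Set.Icc (0 : ℝ) 1 := (withDensity_absolutelyContinuous m _) hm
  have hbd : ∀ e : Fin n → ℕ, ∀ x : Fin n → ℝ, (∀ i, x i ∈ Set.Icc (0 : ℝ) 1) →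
      ‖∏ i, x i ^ e i‖ ≤ 1 := by
    intro e x hx
    rw [Real.norm_of_nonneg (Finset.prod_nonneg fun i _ => pow_nonneg (hx i).1 _)]
    exact Finset.prod_le_one (fun i _ => pow_nonneg (hx i).1 _)
      fun i _ => pow_le_one₀ (hx i).1 (hx i).2
  have hint : ∀ e : Fin n → ℕ, ∀ ν : Measure (Fin n → ℝ), IsFiniteMeasure ν →
      (∀ᵐ x ∂ν, ∀ i, x i ∈ Set.Icc (0 : ℝ) 1) → Integrable (fun x => ∏ i, x i ^ e i) ν := by
    intro e ν _ hν
    refine Integrable.of_bound (C := 1) (Continuous.aestronglyMeasurable (by fun_prop)) ?_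
    filter_upwards [hν] with x hx using hbd e x hx
  have hintρ : ∀ e : Fin n → ℕ, ∀ {g : (Fin n → ℝ) → ℝ}, Integrable g m →
      Integrable (fun x => (∏ i, x i ^ e i) * g x) m := by
    intro e g hg
    refine hg.bdd_mul (c := 1) (Continuous.aestronglyMeasurable (by fun_prop)) ?_
    filter_upwards [hm] with x hx using hbd e x hx
  -- compare positive measures: the negative part of the density is moved to the other side
  have key : μ + νn = νp := by
    refine ext_of_moments (ae_add_measure_iff.2 ⟨hμ, hn⟩) hp fun e => ?_
    rw [integral_add_measure (hint e μ inferInstance hμ) (hint e νn inferInstance hn), h e, hνn,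
      hνp, integral_withDensity_eq_integral_toReal_smul₀ hmn (by simp),
      integral_withDensity_eq_integral_toReal_smul₀ hmp (by simp), ← integral_add (hintρ e hρ)]
    · refine integral_congr_ae (.of_forall fun x => ?_)
      simp only [ENNReal.toReal_ofReal', smul_eq_mul]
      rcases le_total 0 (ρ x) with h0 | h0
      · rw [max_eq_right (by linarith), max_eq_left h0]; ring
      · rw [max_eq_left (by linarith), max_eq_right h0]; ring
    · refine (hintρ e hρ.neg.pos_part).congr (.of_forall fun x => ?_)
      simp only [ENNReal.toReal_ofReal', smul_eq_mul, Pi.neg_apply]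
      ring
  have hnn : ∀ᵐ x ∂m, 0 ≤ ρ x := by
    obtain ⟨ρ', hρ', hae⟩ := hρ.aemeasurable
    have hS : MeasurableSet {x | ρ' x < 0} := measurableSet_lt hρ' measurable_const
    have h1 : νp {x | ρ' x < 0} = 0 := by
      rw [hνp, withDensity_apply _ hS, lintegral_eq_zero_iff' hmp.restrict]
      rw [EventuallyEq, ae_restrict_iff' hS]
      filter_upwards [hae] with x hx hx0
      rw [hx]
      exact ENNReal.ofReal_of_nonpos hx0.le
    have h2 : νn {x | ρ' x < 0} = 0 := by
      rw [← key, Measure.add_apply] at h1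
      exact (add_eq_zero.1 h1).2
    rw [hνn, withDensity_apply _ hS, lintegral_eq_zero_iff' hmn.restrict, EventuallyEq,
      ae_restrict_iff' hS] at h2
    filter_upwards [hae, h2] with x hx h3
    by_contra! hlt
    have h4 := h3 (show ρ' x < 0 by rw [← hx]; exact hlt)
    rw [Pi.zero_apply, ENNReal.ofReal_eq_zero] at h4
    linarith
  refine ⟨hnn, ?_⟩
  have h0 : νn = 0 := by
    rw [hνn, withDensity_eq_zero_iff hmn]
    filter_upwards [hnn] with x hx
    exact ENNReal.ofReal_of_nonpos (by linarith)
  rw [← key, h0, add_zero]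

end Moments

/-! ### Correlation functions -/

section Correlation

open Polynomial

variable {p : ℕ} {z' w' : ℝ} {n : ℕ}

theorem measurable_jacW (a b : ℝ) : Measurable (jacW a b) := by
  unfold jacW
  fun_prop

theorem measurable_det_kerTrunc (a b : ℝ) (D : ℕ) (t : Fin n → ℝ≥0) :
    Measurable fun x : Fin n → ℝ =>
      (Matrix.of fun i j => kerTrunc p a b D t i j (x i) (x j)).det := by
  refine Continuous.measurable (Continuous.matrix_det (continuous_matrix fun i j => ?_))
  simp only [Matrix.of_apply, kerTrunc]
  fun_prop

theorem measurable_prod_jacW (a b : ℝ) :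
    Measurable fun x : Fin n → ℝ => ∏ i, jacW a b (x i) :=
  Finset.measurable_prod _ fun i _ => (measurable_jacW a b).comp (measurable_pi_apply i)

theorem aemeasurable_detKernel (hz : (p : ℝ) - 1 < z') (hw : -1 < w') (t : Fin n → ℝ≥0) :
    AEMeasurable (detKernel p z' w' t)
      (volume.restrict (Set.univ.pi fun _ : Fin n => Set.Ioo (0 : ℝ) 1)) := by
  refine aemeasurable_of_tendsto_metrizable_ae atTop (fun D =>
    ((measurable_prod_jacW (z' - p) w').mul
      (measurable_det_kerTrunc (p := p) (z' - p) w' D t)).aemeasurable) ?_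
  filter_upwards [ae_mem_cube n] with x hx
  exact tendsto_det_kerTrunc hz hw t hx

theorem integrable_prod_jacW {a b : ℝ} (ha : -1 < a) (hb : -1 < b) (n : ℕ) :
    Integrable (fun x : Fin n → ℝ => ∏ i, jacW a b (x i))
      (volume.restrict (Set.univ.pi fun _ : Fin n => Set.Ioo (0 : ℝ) 1)) := by
  rw [volume_restrict_cube]
  exact Integrable.fintype_prod fun _ => integrableOn_jacW ha hb

theorem integrable_detKernel (hz : (p : ℝ) - 1 < z') (hw : -1 < w') (t : Fin n → ℝ≥0) :
    Integrable (detKernel p z' w' t)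
      (volume.restrict (Set.univ.pi fun _ : Fin n => Set.Ioo (0 : ℝ) 1)) := by
  have ha : -1 < z' - p := by linarith
  obtain ⟨B, hB⟩ := exists_kerTrunc_bound (p := p) ha hw t
  refine ((integrable_prod_jacW ha hw n).mul_const (n.factorial * B ^ n)).mono'
    (aemeasurable_detKernel hz hw t).aestronglyMeasurable ?_
  filter_upwards [ae_mem_cube n] with x hx
  refine le_of_tendsto (tendsto_det_kerTrunc hz hw t hx).norm (.of_forall fun D => ?_)
  rw [Real.norm_eq_abs, abs_mul, abs_of_nonneg (Finset.prod_nonneg fun i _ =>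
    (jacW_pos _ _ (hx i)).le)]
  exact mul_le_mul_of_nonneg_left
    (abs_det_kerTrunc_le hB D fun i => Set.Ioo_subset_Icc_self (hx i))
    (Finset.prod_nonneg fun i _ => (jacW_pos _ _ (hx i)).le)

variable {Ω : Type*} [MeasurableSpace Ω] {P : Measure Ω} {J : ℝ≥0 → Ω → Fin p → ℝ}

/-- The correlation identity for products of polynomials. -/
theorem IsLimitProcess.integral_sum_prod_eval_eq [IsProbabilityMeasure P]
    (hz : (p : ℝ) - 1 < z') (hw : -1 < w') (hJ : IsLimitProcess p z' w' P J)
    (t : Fin n → ℝ≥0) (f : Fin n → ℝ[X]) :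
    ∫ ω, (∑ k : {k : Fin n → Fin p // Function.Injective fun i => (k i, t i)},
        ∏ i, (f i).eval (J (t i) ω (k.1 i))) ∂P =
      ∫ x in Set.univ.pi fun _ : Fin n => Set.Ioo (0 : ℝ) 1,
        (∏ i, (f i).eval (x i)) * detKernel p z' w' t x := by
  have ha : -1 < z' - p := by linarith
  obtain ⟨B, hB⟩ := exists_kerTrunc_bound (p := p) ha hw t
  have hK : IsCompact (Set.univ.pi fun _ : Fin n => Set.Icc (0 : ℝ) 1) :=
    isCompact_univ_pi fun _ => isCompact_Icc
  have hf : Continuous fun x : Fin n → ℝ => ∏ i, (f i).eval (x i) := by fun_prop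
  obtain ⟨M, hM⟩ := hK.exists_bound_of_continuousOn hf.continuousOn
  have h1 : Tendsto (fun D => ∫ x in Set.univ.pi fun _ : Fin n => Set.Ioo (0 : ℝ) 1,
      (∏ i, (f i).eval (x i)) * ((∏ i, jacW (z' - p) w' (x i)) *
        (Matrix.of fun i j => kerTrunc p (z' - p) w' D t i j (x i) (x j)).det)) atTop
      (𝓝 (∫ x in Set.univ.pi fun _ : Fin n => Set.Ioo (0 : ℝ) 1,
        (∏ i, (f i).eval (x i)) * detKernel p z' w' t x)) := by
    refine tendsto_integral_of_dominated_convergence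
      (fun x => M * ((∏ i, jacW (z' - p) w' (x i)) * (n.factorial * B ^ n))) (fun D => ?_)
      (((integrable_prod_jacW ha hw n).mul_const _).const_mul _) (fun D => ?_) ?_
    · exact (hf.measurable.mul ((measurable_prod_jacW _ _).mul
        (measurable_det_kerTrunc _ _ D t))).aestronglyMeasurable
    · filter_upwards [ae_mem_cube n] with x hx
      have hx' : ∀ i, x i ∈ Set.Icc (0 : ℝ) 1 := fun i => Set.Ioo_subset_Icc_self (hx i)
      have hnn : 0 ≤ ∏ i, jacW (z' - p) w' (x i) :=
        Finset.prod_nonneg fun i _ => (jacW_pos _ _ (hx i)).le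
      have hMx := hM x fun i _ => hx' i
      rw [norm_mul]
      refine mul_le_mul hMx ?_ (norm_nonneg _) ((norm_nonneg _).trans hMx)
      rw [Real.norm_eq_abs, abs_mul, abs_of_nonneg hnn]
      exact mul_le_mul_of_nonneg_left (abs_det_kerTrunc_le hB D hx') hnn
    · filter_upwards [ae_mem_cube n] with x hx
      exact (tendsto_det_kerTrunc hz hw t hx).const_mul _
  refine tendsto_nhds_unique (tendsto_const_nhds.congr' ?_) h1
  filter_upwards [eventually_ge_atTop (p + n * statDegree f)] with D hD
  rw [hJ.integral_sum_prod_eval hz hw t f hD, sum_det_fredholmMat ha hw]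
  refine integral_congr_ae (.of_forall fun x => ?_)
  simp only [Finset.prod_mul_distrib]
  ring

/-- The correlation functions of every realization of the limit process are minors of the
extended kernel. -/
theorem IsLimitProcess.isCorrelationFunction [IsProbabilityMeasure P]
    (hz : (p : ℝ) - 1 < z') (hw : -1 < w') (hJ : IsLimitProcess p z' w' P J)
    (t : Fin n → ℝ≥0) : IsCorrelationFunction P J t (detKernel p z' w' t) := by
  let Idx := {k : Fin n → Fin p // Function.Injective fun i => (k i, t i)}
  let Y : Idx → Ω → Fin n → ℝ := fun k ω i => J (t i) ω (k.1 i)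
  have hY : ∀ k, Measurable (Y k) := fun k => measurable_pi_lambda _ fun i =>
    (measurable_pi_apply (k.1 i)).comp (hJ.measurable (t i))
  -- the correlation measure: the sum of the joint laws of all admissible tuples of particles
  set μ : Measure (Fin n → ℝ) := ∑ k : Idx, P.map (Y k) with hμ
  have hμm : ∀ᵐ x ∂μ, ∀ i, x i ∈ Set.Icc (0 : ℝ) 1 := by
    have hs : MeasurableSet {x : Fin n → ℝ | ∀ i, x i ∈ Set.Icc (0 : ℝ) 1} := by
      simp only [Set.ofPred_forall]
      exact MeasurableSet.iInter fun i => measurableSet_Icc.preimage (measurable_pi_apply i)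
    rw [ae_iff, hμ, Measure.finsetSum_apply, Finset.sum_eq_zero]
    intro k _
    rw [← ae_iff, ae_map_iff (hY k).aemeasurable hs]
    exact .of_forall fun ω i => hJ.mem_Icc _ _ _
  have hm : ∀ᵐ x ∂(volume : Measure (Fin n → ℝ)).restrict
      (Set.univ.pi fun _ => Set.Ioo (0 : ℝ) 1), ∀ i, x i ∈ Set.Icc (0 : ℝ) 1 := by
    filter_upwards [ae_mem_cube n] with x hx i using Set.Ioo_subset_Icc_self (hx i)
  obtain ⟨hnn, hden⟩ := nonneg_and_eq_withDensity_of_moments (μ := μ) hμm hm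
    (integrable_detKernel hz hw t) fun e => by
      have h1 := hJ.integral_sum_prod_eval_eq hz hw t fun i => X ^ e i
      simp only [eval_pow, eval_X] at h1
      have hc : Continuous fun x : Fin n → ℝ => ∏ i, x i ^ e i := by fun_prop
      have hbd : ∀ k, Integrable (fun x : Fin n → ℝ => ∏ i, x i ^ e i) (P.map (Y k)) := by
        intro k
        rw [integrable_map_measure hc.aestronglyMeasurable (hY k).aemeasurable]
        exact hJ.integrable_of_continuous t (F := fun y => ∏ i, y i (k.1 i) ^ e i) (by fun_prop)
      rw [← h1, hμ, integral_finsetSum_measure fun k _ => hbd k, integral_finsetSum]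
      · refine Finset.sum_congr rfl fun k _ => ?_
        rw [integral_map (hY k).aemeasurable hc.aestronglyMeasurable]
      · intro k _
        exact hJ.integrable_of_continuous t (F := fun y => ∏ i, y i (k.1 i) ^ e i) (by fun_prop)
  refine ⟨aemeasurable_detKernel hz hw t, hnn, fun f hf => ?_⟩
  have h2 : ∀ k : Idx, ∫⁻ ω, f (Y k ω) ∂P = ∫⁻ x, f x ∂(P.map (Y k)) := fun k =>
    (lintegral_map hf (hY k)).symm
  change ∫⁻ ω, ∑ k : Idx, f (Y k ω) ∂P = _
  rw [lintegral_finsetSum (f := fun k ω => f (Y k ω)) _ fun k _ => hf.comp (hY k)]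
  simp only [h2]
  rw [← lintegral_finsetSum_measure, ← hμ, hden, lintegral_withDensity_eq_lintegral_mul₀
    (aemeasurable_detKernel hz hw t).ennreal_ofReal hf.aemeasurable]
  simp only [Pi.mul_apply, mul_comm]

end Correlation

end

noncomputable section

/-! ### Existence of the limit process -/

section WeakLimit

variable {X : Type*} [TopologicalSpace X] [CompactSpace X]

/-- A state has norm at most `1`. -/
theorem abs_le_norm_of_positive {L : C(X, ℝ) →ₗ[ℝ] ℝ} (hpos : ∀ f, (∀ x, 0 ≤ f x) → 0 ≤ L f)
    (hone : L 1 = 1) (f : C(X, ℝ)) : |L f| ≤ ‖f‖ := by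
  have h1 := hpos (‖f‖ • 1 - f) fun x => by
    have := (abs_le.1 (f.norm_coe_le_norm x)).2
    simpa using this
  have h2 := hpos (‖f‖ • 1 + f) fun x => by
    have := (abs_le.1 (f.norm_coe_le_norm x)).1
    simp only [ContinuousMap.add_apply, ContinuousMap.smul_apply, ContinuousMap.one_apply,
      smul_eq_mul, mul_one]
    linarith
  rw [map_sub, map_smul, hone, smul_eq_mul, mul_one] at h1
  rw [map_add, map_smul, hone, smul_eq_mul, mul_one] at h2
  exact abs_le.2 ⟨by linarith, by linarith⟩

/-- States on the continuous functions of a compact space which converge on a separating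
multiplicative set converge everywhere, by the Stone–Weierstrass theorem. -/
theorem exists_tendsto_of_separates {L : ℕ → C(X, ℝ) →ₗ[ℝ] ℝ}
    (hpos : ∀ N f, (∀ x, 0 ≤ f x) → 0 ≤ L N f) (hone : ∀ N, L N 1 = 1) (S : Submonoid C(X, ℝ))
    (hsep : ∀ x y : X, x ≠ y → ∃ f ∈ S, f x ≠ f y)
    (hconv : ∀ f ∈ S, ∃ l, Tendsto (fun N => L N f) atTop (𝓝 l)) (f : C(X, ℝ)) :
    ∃ l, Tendsto (fun N => L N f) atTop (𝓝 l) := by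
  have hspan : ∀ g ∈ Algebra.adjoin ℝ (S : Set C(X, ℝ)),
      ∃ l, Tendsto (fun N => L N g) atTop (𝓝 l) := by
    intro g hg
    have hg' : g ∈ Submodule.span ℝ (S : Set C(X, ℝ)) := by
      have := Algebra.adjoin_eq_span ℝ (S : Set C(X, ℝ))
      rw [Submonoid.closure_eq] at this
      rw [← this]
      exact hg
    clear hg
    induction hg' using Submodule.span_induction with
    | mem g hg => exact hconv g hg
    | zero => exact ⟨0, by simp⟩
    | add g h _ _ hg hh =>
      obtain ⟨l, hl⟩ := hg
      obtain ⟨l', hl'⟩ := hh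
      exact ⟨l + l', by simpa using hl.add hl'⟩
    | smul c g _ hg =>
      obtain ⟨l, hl⟩ := hg
      exact ⟨c * l, by simpa using hl.const_mul c⟩
  have hdense : f ∈ (Algebra.adjoin ℝ (S : Set C(X, ℝ))).topologicalClosure := by
    rw [ContinuousMap.subalgebra_topologicalClosure_eq_top_of_separatesPoints]
    · trivial
    · intro x y hxy
      obtain ⟨g, hg, hne⟩ := hsep x y hxy
      exact ⟨g, ⟨g, Algebra.subset_adjoin hg, rfl⟩, hne⟩
  refine cauchySeq_tendsto_of_complete (Metric.cauchySeq_iff'.2 fun ε hε => ?_)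
  obtain ⟨g, hg, hfg⟩ := Metric.mem_closure_iff.1 hdense (ε / 3) (by positivity)
  obtain ⟨l, hl⟩ := hspan g hg
  obtain ⟨N₀, hN₀⟩ := Metric.cauchySeq_iff'.1 hl.cauchySeq (ε / 3) (by positivity)
  refine ⟨N₀, fun N hN => ?_⟩
  have h1 : ∀ N, |L N f - L N g| < ε / 3 := fun N => by
    rw [← map_sub]
    exact (abs_le_norm_of_positive (hpos N) (hone N) _).trans_lt (by rwa [← dist_eq_norm])
  have h2 := hN₀ N hN
  rw [Real.dist_eq] at h2 ⊢
  have h3 := abs_lt.1 (h1 N)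
  have h4 := abs_lt.1 (h1 N₀)
  have h5 := abs_lt.1 h2
  exact abs_lt.2 ⟨by linarith, by linarith⟩

open scoped CompactlySupported in
/-- The limit of such states is given by a probability measure. -/
theorem exists_measure_of_tendsto [T2Space X] [MeasurableSpace X] [BorelSpace X]
    {L : ℕ → C(X, ℝ) →ₗ[ℝ] ℝ} (hpos : ∀ N f, (∀ x, 0 ≤ f x) → 0 ≤ L N f) (hone : ∀ N, L N 1 = 1)
    (hconv : ∀ f, ∃ l, Tendsto (fun N => L N f) atTop (𝓝 l)) :
    ∃ P : Measure X, IsProbabilityMeasure P ∧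
      ∀ f : C(X, ℝ), Tendsto (fun N => L N f) atTop (𝓝 (∫ x, f x ∂P)) := by
  choose l hl using hconv
  have hadd : ∀ f g, l (f + g) = l f + l g := fun f g => by
    refine tendsto_nhds_unique (hl (f + g)) ?_
    simpa using (hl f).add (hl g)
  have hsmul : ∀ (c : ℝ) f, l (c • f) = c * l f := fun c f => by
    refine tendsto_nhds_unique (hl (c • f)) ?_
    simpa using (hl f).const_mul c
  let Λ : C_c(X, ℝ) →ₚ[ℝ] ℝ := PositiveLinearMap.mk₀
    { toFun := fun f => l f.toContinuousMap
      map_add' := fun f g => hadd _ _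
      map_smul' := fun c f => hsmul c _ }
    fun f hf => ge_of_tendsto' (hl f.toContinuousMap) fun N => hpos N _ fun x => hf x
  have hint : ∀ f : C(X, ℝ), ∫ x, f x ∂(RealRMK.rieszMeasure Λ) = l f := fun f =>
    RealRMK.integral_rieszMeasure Λ ⟨f, HasCompactSupport.of_compactSpace f⟩
  refine ⟨RealRMK.rieszMeasure Λ, ⟨?_⟩, fun f => by rw [hint]; exact hl f⟩
  have h1 : l 1 = 1 := tendsto_nhds_unique (hl 1) (by simp [hone])
  have h2 := hint 1
  rw [h1] at h2
  simp only [ContinuousMap.one_apply, integral_const, smul_eq_mul, mul_one] at h2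
  rw [measureReal_def, ENNReal.toReal_eq_one_iff] at h2
  exact h2

end WeakLimit

section TrajectorySpace

open Polynomial

/-- Weakly increasing configurations in `[0,1]`. -/
def Chamber (p : ℕ) : Type := {x : Fin p → Set.Icc (0 : ℝ) 1 // Monotone x}

instance (p : ℕ) : TopologicalSpace (Chamber p) := inferInstanceAs (TopologicalSpace (Subtype _))

instance (p : ℕ) : T2Space (Chamber p) := inferInstanceAs (T2Space (Subtype _))

theorem isClosed_setOf_monotone_Icc (p : ℕ) :
    IsClosed {x : Fin p → Set.Icc (0 : ℝ) 1 | Monotone x} := by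
  simp only [Monotone, Set.ofPred_forall]
  exact isClosed_iInter fun i => isClosed_iInter fun j => isClosed_iInter fun _ =>
    isClosed_le (continuous_apply i) (continuous_apply j)

instance (p : ℕ) : CompactSpace (Chamber p) :=
  isCompact_iff_compactSpace.1 (isClosed_setOf_monotone_Icc p).isCompact

/-- All trajectories in the chamber, with the product topology and its Borel sets. -/
def Trajectory (p : ℕ) : Type := ℝ≥0 → Chamber p

instance (p : ℕ) : TopologicalSpace (Trajectory p) :=
  inferInstanceAs (TopologicalSpace (ℝ≥0 → Chamber p))

instance (p : ℕ) : T2Space (Trajectory p) := inferInstanceAs (T2Space (ℝ≥0 → Chamber p))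

instance (p : ℕ) : CompactSpace (Trajectory p) := inferInstanceAs (CompactSpace (ℝ≥0 → Chamber p))

instance (p : ℕ) : MeasurableSpace (Trajectory p) := borel _

instance (p : ℕ) : BorelSpace (Trajectory p) := ⟨rfl⟩

/-- The `k`-th coordinate at time `t`. -/
def coord {p : ℕ} (t : ℝ≥0) (x : Trajectory p) (k : Fin p) : ℝ := (x t).1 k

theorem continuous_coord {p : ℕ} (t : ℝ≥0) (k : Fin p) :
    Continuous fun x : Trajectory p => coord t x k := by
  have h1 : Continuous fun x : Trajectory p => x t := continuous_apply (A := fun _ : ℝ≥0 => Chamber p) t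
  have h2 : Continuous fun c : Chamber p => (c.1 k : ℝ) :=
    continuous_subtype_val.comp ((continuous_apply k).comp continuous_subtype_val)
  exact h2.comp h1

/-- Multiplicative functions of finitely many configurations. -/
def multFun {p n : ℕ} (t : Fin n → ℝ≥0) (g : Fin n → ℝ[X]) : C(Trajectory p, ℝ) where
  toFun x := ∏ i, ∏ k, (g i).eval (coord (t i) x k)
  continuous_toFun := continuous_finsetProd _ fun i _ => continuous_finsetProd _ fun k _ =>
    (g i).continuous.comp (continuous_coord (t i) k)

/-- The multiplicative functions form a monoid. -/
def multMonoid (p : ℕ) : Submonoid C(Trajectory p, ℝ) where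
  carrier := {f | ∃ (n : ℕ) (t : Fin n → ℝ≥0) (g : Fin n → ℝ[X]), f = multFun t g}
  one_mem' := ⟨0, Fin.elim0, Fin.elim0, by ext x; simp [multFun]⟩
  mul_mem' := by
    rintro _ _ ⟨n, t, g, rfl⟩ ⟨n', t', g', rfl⟩
    refine ⟨n + n', Fin.append t t', Fin.append g g', ?_⟩
    ext x
    simp [multFun, Fin.prod_univ_add]

/-- A configuration is determined by the values of `∏ₖ (s - xₖ)`. -/
theorem multMonoid_separates {p : ℕ} (x y : Trajectory p) (hxy : x ≠ y) :
    ∃ f ∈ multMonoid p, f x ≠ f y := by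
  by_contra! h
  refine hxy (funext fun t => Subtype.ext ?_)
  have h1 : ∀ s : ℝ, ∏ k, (s - coord t x k) = ∏ k, (s - coord t y k) := by
    intro s
    have := h _ ⟨1, fun _ => t, fun _ => C s - X, rfl⟩
    simpa [multFun] using this
  have h2 : ∏ k, (X - C (coord t x k)) = ∏ k, (X - C (coord t y k)) :=
    Polynomial.funext fun s => by simpa [eval_prod] using h1 s
  have hroots : ∀ z : Trajectory p, (∏ k, (X - C (coord t z k))).roots =
      (List.ofFn fun k => coord t z k : Multiset ℝ) := by
    intro z
    rw [← Fin.univ_val_map]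
    conv_rhs => rw [← roots_multiset_prod_X_sub_C (Multiset.map _ _), Multiset.map_map]
    rfl
  have h3 : (List.ofFn fun k => coord t x k).Perm (List.ofFn fun k => coord t y k) := by
    rw [← Multiset.coe_eq_coe, ← hroots, ← hroots, h2]
  have hmono : ∀ z : Trajectory p, Monotone fun k => coord t z k := fun z i j hij =>
    (z t).2 hij
  have h4 := List.ofFn_injective
    (h3.eq_of_sortedLE (hmono x).sortedLE_ofFn (hmono y).sortedLE_ofFn)
  funext k
  exact Subtype.ext (congrFun h4 k)

variable {p : ℕ} {z' w' : ℝ}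

/-- The rescaled configuration as a point of the chamber. -/
def chamberPt {N : ℕ} (x : Conf p (N + p)) : Chamber p :=
  ⟨fun k => Set.projIcc 0 1 zero_le_one (confPt x k), fun i j hij => by
    refine Set.monotone_projIcc _ (div_le_div_of_nonneg_right ?_ ?_)
    · exact_mod_cast x.2.monotone hij
    · have h1 : (1 : ℝ) ≤ p := by exact_mod_cast i.pos
      have h2 : (0 : ℝ) ≤ N := by positivity
      linarith⟩

theorem chamberPt_coe {N : ℕ} (hN : 2 ≤ N) (x : Conf p (N + p)) (k : Fin p) :
    ((chamberPt x).1 k : ℝ) = confPt x k := by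
  change (Set.projIcc 0 1 zero_le_one (confPt x k) : ℝ) = _
  rw [Set.projIcc_of_mem _ (confPt_mem hN x k)]

/-- The rescaled trajectory of the chain, stopped after `H` steps. -/
def chainTraj {N H : ℕ} (τ : Fin (H + 1) → Conf p (N + p)) : Trajectory p := fun t =>
  chamberPt (τ ⟨min (stepCount N t) H, Nat.lt_succ_of_le (min_le_right _ _)⟩)

/-- The expectation over the trajectories of the chain, stopped after `H` steps. -/
def chainState (p : ℕ) (z' w' : ℝ) (N H : ℕ) : C(Trajectory p, ℝ) →ₗ[ℝ] ℝ where
  toFun f := ∑ τ : Fin (H + 1) → Conf p (N + p),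
    pathWt (chainPi p z' w' N) (chainQ p z' w' N) τ * f (chainTraj τ)
  map_add' f g := by simp only [ContinuousMap.add_apply, mul_add, Finset.sum_add_distrib]
  map_smul' c f := by
    simp only [ContinuousMap.smul_apply, smul_eq_mul, Finset.mul_sum, RingHom.id_apply]
    exact Finset.sum_congr rfl fun τ _ => by ring

theorem chainState_nonneg (hz : (p : ℝ) - 1 < z') (hw : -1 < w') (N H : ℕ)
    (f : C(Trajectory p, ℝ)) (hf : ∀ x, 0 ≤ f x) : 0 ≤ chainState p z' w' N H f :=
  Finset.sum_nonneg fun τ _ => mul_nonneg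
    (pathWt_nonneg (chainPi_nonneg hz hw) (chainQ_nonneg hz hw) τ) (hf _)

theorem chainState_one (hz : (p : ℝ) - 1 < z') (hw : -1 < w') (N H : ℕ) :
    chainState p z' w' N H 1 = 1 := by
  simp only [chainState, LinearMap.coe_mk, AddHom.coe_mk, ContinuousMap.one_apply, mul_one]
  exact sum_pathWt (sum_zwMeasure hz hw N) (sum_chainQ hz hw) H

/-- The finite-dimensional distributions do not depend on when the chain is stopped. -/
theorem chainState_eq_integral (hz : (p : ℝ) - 1 < z') (hw : -1 < w') {N H n : ℕ} (hN : 2 ≤ N)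
    (t : Fin n → ℝ≥0) (hH : maxStep N t ≤ H) (F : (Fin n → Fin p → ℝ) → ℝ)
    (f : C(Trajectory p, ℝ)) (hf : ∀ x, f x = F fun i => coord (t i) x) :
    chainState p z' w' N H f = ∫ y, F y ∂(prelimitLaw p z' w' N t) := by
  obtain ⟨d, rfl⟩ := Nat.exists_eq_add_of_le hH
  rw [integral_prelimitLaw hz hw, ← sum_pathWt_restrict (sum_chainQ hz hw) _ _ d]
  refine Finset.sum_congr rfl fun τ _ => ?_
  rw [hf]
  congr 2
  funext i k
  have h1 : stepCount N (t i) ≤ maxStep N t := Nat.le_of_lt_succ (stepCount_lt N t i)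
  rw [coord, chainTraj, chamberPt_coe hN]
  congr 2
  exact Fin.ext (min_eq_left (h1.trans hH))

/-- On the time scale `N ^ 2`, the horizon `N ^ 3` eventually exceeds every fixed time. -/
theorem eventually_maxStep_le {n : ℕ} (t : Fin n → ℝ≥0) : ∀ᶠ N in atTop, maxStep N t ≤ N ^ 3 := by
  obtain ⟨m, hm⟩ := exists_nat_ge (Finset.univ.sup t : ℝ≥0)
  filter_upwards [eventually_ge_atTop m] with N hN
  rw [maxStep_eq]
  refine Nat.floor_le_of_le ?_
  have h1 : ((Finset.univ.sup t : ℝ≥0) : ℝ) ≤ N := by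
    have : ((Finset.univ.sup t : ℝ≥0) : ℝ) ≤ m := by exact_mod_cast hm
    exact this.trans (by exact_mod_cast hN)
  calc _ ≤ (N : ℝ) * (N : ℝ) ^ 2 := mul_le_mul_of_nonneg_right h1 (by positivity)
    _ = ((N ^ 3 : ℕ) : ℝ) := by push_cast; ring

/-- Multiplicative statistics at arbitrary times, brought into increasing order. -/
theorem multFun_eq {n : ℕ} (t : Fin n → ℝ≥0) (g : Fin n → ℝ[X]) (x : Trajectory p) :
    multFun t g x = ∏ l : Fin n, ∏ k, (∏ i ∈ Finset.univ.filter fun i => timeRank t i = (l : ℕ),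
      g i).eval (coord (timeAt t l) x k) := by
  have h1 : ∀ l : Fin n, ∏ k, (∏ i ∈ Finset.univ.filter fun i => timeRank t i = (l : ℕ),
      g i).eval (coord (timeAt t l) x k) = ∏ i, if timeRank t i = (l : ℕ) then
        ∏ k, (g i).eval (coord (t i) x k) else 1 := by
    intro l
    simp only [eval_prod]
    rw [Finset.prod_comm, Finset.prod_filter]
    refine Finset.prod_congr rfl fun i _ => ?_
    split_ifs with h
    · rw [← h, timeAt_timeRank]
    · rfl
  simp only [h1]
  rw [Finset.prod_comm]
  change ∏ i, ∏ k, (g i).eval (coord (t i) x k) = _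
  refine Finset.prod_congr rfl fun i _ => ?_
  rw [Finset.prod_eq_single (⟨timeRank t i, timeRank_lt t i⟩ : Fin n)]
  · rw [if_pos rfl]
  · intro l _ hl
    exact if_neg fun h => hl (Fin.ext h.symm)
  · simp

/-- The coordinate process on the space of trajectories is a limit process. The states of the chains,
stopped after `N ^ 3` steps, converge on multiplicative functions, which separate trajectories. -/
theorem exists_isLimitProcess (hz : (p : ℝ) - 1 < z') (hw : -1 < w') :
    ∃ (Ω : Type) (_ : MeasurableSpace Ω) (P : Measure Ω) (_ : IsProbabilityMeasure P)
      (J : ℝ≥0 → Ω → Fin p → ℝ), IsLimitProcess p z' w' P J := by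
  have hconv : ∀ f ∈ multMonoid p,
      ∃ l, Tendsto (fun N => chainState p z' w' N (N ^ 3) f) atTop (𝓝 l) := by
    rintro _ ⟨n, t, g, rfl⟩
    have h1 := tendsto_integral_prelimitLaw_prod hz hw (timeAt_mono t) (timeAt_le_sup t)
      fun l => ∏ i ∈ Finset.univ.filter fun i => timeRank t i = l, g i
    refine ⟨_, h1.congr' ?_⟩
    filter_upwards [eventually_ge_atTop 2, eventually_maxStep_le fun i : Fin n => timeAt t i]
      with N hN hH
    exact (chainState_eq_integral hz hw hN (fun i : Fin n => timeAt t i) hH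
      (fun y => ∏ l : Fin n, ∏ k, (∏ i ∈ Finset.univ.filter fun i => timeRank t i = (l : ℕ),
        g i).eval (y l k)) _ (multFun_eq t g)).symm
  obtain ⟨P, hP, hlim⟩ := exists_measure_of_tendsto
    (L := fun N => chainState p z' w' N (N ^ 3)) (fun N => chainState_nonneg hz hw N _)
    (fun N => chainState_one hz hw N _)
    (exists_tendsto_of_separates (fun N => chainState_nonneg hz hw N _)
      (fun N => chainState_one hz hw N _) (multMonoid p) multMonoid_separates hconv)
  refine ⟨Trajectory p, inferInstance, P, hP, coord, ⟨fun t => ?_, fun t x k => ((x t).1 k).2,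
    fun n t f => ?_⟩⟩
  · exact (continuous_pi fun k => continuous_coord t k).measurable
  · have hcont : Continuous fun x : Trajectory p => f fun i => coord (t i) x :=
      f.continuous.comp (continuous_pi fun i => continuous_pi fun k => continuous_coord (t i) k)
    refine (hlim ⟨_, hcont⟩).congr' ?_
    filter_upwards [eventually_ge_atTop 2, eventually_maxStep_le t] with N hN hH
    exact chainState_eq_integral hz hw hN t hH (fun y => f y) _ fun x => rfl

end TrajectorySpace

end

theorem mainTheorem2 (p : ℕ) (z' w' : ℝ) (hz : (p : ℝ) - 1 < z') (hw : -1 < w') :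
    -- the limit process exists
    (∃ (Ω : Type) (_ : MeasurableSpace Ω) (P : Measure Ω) (_ : IsProbabilityMeasure P)
      (J : ℝ≥0 → Ω → Fin p → ℝ), IsLimitProcess p z' w' P J) ∧
    -- the series in the kernel converges
    (∀ x ∈ Set.Ioo (0 : ℝ) 1, ∀ y ∈ Set.Ioo (0 : ℝ) 1, ∀ t s : ℝ, t < s →
      Summable fun i : ℕ => Real.exp ((t - s) * jacobiEigenvalue p z' w' (p + i)) *
        jacobiFun p z' w' (p + i) x * jacobiFun p z' w' (p + i) y) ∧
    -- the correlation functions are minors of the kernel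
    ∀ (Ω : Type*) [MeasurableSpace Ω] (P : Measure Ω) [IsProbabilityMeasure P]
      (J : ℝ≥0 → Ω → Fin p → ℝ), IsLimitProcess p z' w' P J →
      ∀ (n : ℕ) (t : Fin n → ℝ≥0), IsCorrelationFunction P J t fun x =>
        (Matrix.of fun i j : Fin n => extendedKernel p z' w' (x i) (t i) (x j) (t j)).det := by
  refine ⟨exists_isLimitProcess hz hw, fun x hx y hy t s hts => summable_extendedKernel hz hw hx hy hts,
    fun Ω _ P _ J hJ n t => hJ.isCorrelationFunction hz hw t⟩
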